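/- For $\kappa,d>0$ and $(\alpha,\beta,\gamma,\delta)\in\mathbb R^4$ let $(\phi,a)$ denote the solution on $[-d,d]$ (where it exists) of $$\phi''=\kappa^2\phi(\phi^2+a^2-1),\qquad a''=\phi^2a,\qquad (\phi,\phi',a,a')(0)=(\alpha,\beta,\gamma,\delta).$$ Put $q=\partial\phi/\partial\beta$, $r=\partial\phi/\partial\gamma$, $s=\partial\phi/\partial\delta$, $v=\partial a/\partial\beta$, $w=\partial a/\partial\gamma$, $z=\partial a/\partial\delta$, let primes denote $x$-derivatives (so that $q'(x)=\partial\phi'(x)/\partial\beta$, etc.), and let $$J=\det\begin{pmatrix} q'(d)&r'(d)&s'(d)\\ q'(-d)&r'(-d)&s'(-d)\\ v'(d)-v'(-d)&w'(d)-w'(-d)&z'(d)-z'(-d)\end{pmatrix},\qquad M=q'(d)w'(d)-r'(d)v'(d);$$ thus $J$ is the Jacobian determinant of $(\beta,\gamma,\delta)\mapsto(\phi'(d),\phi'(-d),a'(d)-a'(-d))$. There is a constant $D_0>0$ such that for all $\kappa,d>0$ with $D:=\kappa d\ge D_0$ the following hold. 1. (Symmetric branch.) For each $\alpha\in(0,1]$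 there is exactly one $\delta=\delta_0(\alpha)\ge0$ such that the solution with initial data $(\alpha,0,0,\delta)$ exists on $[-d,d]$, has $\phi>0$ there and satisfies $\phi'(d)=0$. Moreover $\delta_0(\alpha)>0$ for $\alpha<1$, and $\delta_0(1)=0$. At each point $(\alpha,0,0,\delta_0(\alpha))$, $0<\alpha\le1$, the value of $(\phi,\phi',a,a')$ at any $x\in[-d,d]$ is a differentiable function of the initial data, and $$J=4s'(d)\bigl(q'(d)w'(d)-r'(d)v'(d)\bigr).$$ Write $J(\alpha)$, $M(\alpha)$ for the values of $J$, $M$ at $(\alpha,0,0,\delta_0(\alpha))$. 2. (Change of sign.) There are $0<\alpha_1<\alpha_2<1$ such that $J(\alpha)<0$ for $0<\alpha<\alpha_1$ and $J(\alpha)>0$ for $\alpha_2<\alpha<1$. Moreover $M(1)>0$. 3. (Limit $\alpha\to0$.) There are $\lambda>0$ and a function $g>0$ on $[0,D]$ with $$g''=(\lambda^2y^2-1)g,\qquad g(0)=1,\quad g'(0)=g'(D)=0,$$ and for every such pair $(\lambda,g)$ $$\lim_{\alpha\to0^+}\frac{M(\alpha)}{\alpha^2}=\frac1{\kappa g(D)}\left(\int_0^D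 g(y)^2\,dy-4\lambda^2\int_0^D y\,g(y)^2\int_0^y\frac1{g(s)^2}\int_s^D t\,g(t)^2\,dt\,ds\,dy\right)$$ and $$\int_0^D g(y)^2\,dy<4\lambda^2\int_0^D y\,g(y)^2\int_0^y\frac1{g(s)^2}\int_s^D t\,g(t)^2\,dt\,ds\,dy .$$ -/

import Mathlib

open Set Filter Topology

/-- The one-dimensional Ginzburg–Landau equations `φ'' = κ² φ (φ² + a² - 1)`, `a'' = φ² a`, written
as a first-order system for the state vector `y = (φ, φ', a, a')`. -/
def glField (κ : ℝ) (y : Fin 4 → ℝ) : Fin 4 → ℝ :=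
  ![y 1, κ ^ 2 * y 0 * (y 0 ^ 2 + y 2 ^ 2 - 1), y 3, y 0 ^ 2 * y 2]

/-- `y = (φ, φ', a, a')` solves the Ginzburg–Landau equations on `[-d, d]` with the initial
conditions `(φ, φ', a, a')(0) = p = (α, β, γ, δ)`. -/
def IsGLSolution (κ d : ℝ) (p : Fin 4 → ℝ) (y : ℝ → Fin 4 → ℝ) : Prop :=
  y 0 = p ∧ ∀ x ∈ Icc (-d) d, HasDerivWithinAt y (glField κ (y x)) (Icc (-d) d) x

open Classical in
/-- The solution on `[-d, d]` with initial conditions `p` at `x = 0`, as a function of `p` and `x`.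
On `[-d, d]` it is unique where it exists; it is set to `0` if it does not exist on `[-d, d]`. -/
noncomputable def glFlow (κ d : ℝ) (p : Fin 4 → ℝ) : ℝ → Fin 4 → ℝ :=
  if h : ∃ y, IsGLSolution κ d p y then h.choose else 0

/-- The solution with `φ(0) = α`, `φ'(0) = 0`, `a(0) = 0`, `a'(0) = δ` exists on `[-d, d]`, has
`φ > 0` and satisfies `φ'(d) = 0`. By uniqueness `φ` is then even and `a` is odd. -/
def IsSymmetricSolution (κ d α δ : ℝ) : Prop :=
  ∃ y, IsGLSolution κ d ![α, 0, 0, δ] y ∧ (∀ x ∈ Icc (-d) d, 0 < y x 0) ∧ y d 1 = 0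

/-- The partial derivative, with respect to the initial condition number `j`
(`0, 1, 2, 3` for `α, β, γ, δ`), of the component number `i` of the solution
(`0, 1, 2, 3` for `φ, φ', a, a'`) at the point `x`, evaluated at the initial conditions `p`. -/
noncomputable def glVar (κ d : ℝ) (p : Fin 4 → ℝ) (j i : Fin 4) (x : ℝ) : ℝ :=
  deriv (fun t : ℝ => glFlow κ d (Function.update p j t) x i) (p j)

/-- `q'(x) = ∂φ'(x)/∂β` at the initial conditions `(α, 0, 0, δ)`. -/
noncomputable def qPrime (κ d α δ x : ℝ) : ℝ := glVar κ d ![α, 0, 0, δ] 1 1 x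

/-- `r'(x) = ∂φ'(x)/∂γ` at the initial conditions `(α, 0, 0, δ)`. -/
noncomputable def rPrime (κ d α δ x : ℝ) : ℝ := glVar κ d ![α, 0, 0, δ] 2 1 x

/-- `s'(x) = ∂φ'(x)/∂δ` at the initial conditions `(α, 0, 0, δ)`. -/
noncomputable def sPrime (κ d α δ x : ℝ) : ℝ := glVar κ d ![α, 0, 0, δ] 3 1 x

/-- `v'(x) = ∂a'(x)/∂β` at the initial conditions `(α, 0, 0, δ)`. -/
noncomputable def vPrime (κ d α δ x : ℝ) : ℝ := glVar κ d ![α, 0, 0, δ] 1 3 x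

/-- `w'(x) = ∂a'(x)/∂γ` at the initial conditions `(α, 0, 0, δ)`. -/
noncomputable def wPrime (κ d α δ x : ℝ) : ℝ := glVar κ d ![α, 0, 0, δ] 2 3 x

/-- `z'(x) = ∂a'(x)/∂δ` at the initial conditions `(α, 0, 0, δ)`. -/
noncomputable def zPrime (κ d α δ x : ℝ) : ℝ := glVar κ d ![α, 0, 0, δ] 3 3 x

/-- The Jacobian determinant, at the initial conditions `(α, 0, 0, δ)`, of the map
`(β, γ, δ) ↦ (φ'(d), φ'(-d), a'(d) - a'(-d))`. -/
noncomputable def glJ (κ d α δ : ℝ) : ℝ :=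
  Matrix.det
    !![qPrime κ d α δ d, rPrime κ d α δ d, sPrime κ d α δ d;
       qPrime κ d α δ (-d), rPrime κ d α δ (-d), sPrime κ d α δ (-d);
       vPrime κ d α δ d - vPrime κ d α δ (-d),
       wPrime κ d α δ d - wPrime κ d α δ (-d),
       zPrime κ d α δ d - zPrime κ d α δ (-d)]

/-- `M = q'(d) w'(d) - r'(d) v'(d)`. -/
noncomputable def glM (κ d α δ : ℝ) : ℝ :=
  qPrime κ d α δ d * wPrime κ d α δ d - rPrime κ d α δ d * vPrime κ d α δ d

/-- `g` is a positive eigenfunction with eigenvalue parameter `lam > 0` of the rescaled linear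
problem `g'' = (lam² y² - 1) g` on `[0, D]`, `g(0) = 1`, `g'(0) = g'(D) = 0`;
`g'` is denoted by `g₁`. -/
structure IsRescaledEigenpair (D lam : ℝ) (g g₁ : ℝ → ℝ) : Prop where
  lam_pos : 0 < lam
  pos : ∀ y ∈ Icc 0 D, 0 < g y
  hasDeriv : ∀ y ∈ Icc 0 D, HasDerivWithinAt g (g₁ y) (Icc 0 D) y
  hasDeriv₁ : ∀ y ∈ Icc 0 D, HasDerivWithinAt g₁ ((lam ^ 2 * y ^ 2 - 1) * g y) (Icc 0 D) y
  init : g 0 = 1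
  init₁ : g₁ 0 = 0
  bdry : g₁ D = 0

/-- The integral `∫₀ᴰ y g(y)² ∫₀ʸ g(s)⁻² ∫ₛᴰ t g(t)² dt ds dy`. -/
noncomputable def tripleIntegral (D : ℝ) (g : ℝ → ℝ) : ℝ :=
  ∫ y in (0 : ℝ)..D, y * g y ^ 2 *
    ∫ s in (0 : ℝ)..y, 1 / g s ^ 2 * ∫ t in s..D, t * g t ^ 2

/-! Writing φ = αψ and ε = α² gives ψ'' = κ²ψ(εψ² + a² - 1), a'' = εψ²a with ψ(0) = 1, a problem
that stays regular at ε = 0. The symmetric branch is then a one-parameter shooting problem: choose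
the slope δ = a'(0) so that ψ'(d) = 0 with ψ > 0.

Uniqueness is a comparison argument. For two slopes the quotient of the two ψ's minus one, their
Wronskian, and the differences of a and a' satisfy a linear system with nonnegative coefficients, so
larger δ means strictly larger ψ'(d)/ψ(d) (`wronskian_pos_of_lt`). Existence comes from the
intermediate value theorem applied to ψ'(d) for an equation with ψ clamped to [0, 1], the clamp
being inactive wherever ψ'(d) = 0 (`IsClampedSol.isODESol`).

Reflection x ↦ -x makes every entry of J even or odd in x, and the determinant collapses to 4 s'(d)
M (`glJ_eq`). The linearized form of the same comparison gives s'(d) > 0 for 0 < α < 1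
(`sPrime_pos`), so J has the sign of M there.

After rescaling the linearizations by suitable powers of α, M = α²N, where N depends continuously on
(ε, δ), and the branch δ depends continuously on ε (`IsLinearizedSol.tendsto_glM_div`). Signs of M
near both ends of the branch therefore follow from N at ε = 1 and ε = 0. At ε = 1 the solution is
constant and N = cosh(√2 κd) sinh d > 0. At ε = 0 the potential a is linear, ψ is the eigenfunction
g in the variable y = κx, and reduction of order solves the linearizations by quadratures, which
yields the stated limit.

Its negativity rests on the first integral of g'' = (λ²y² - 1)g. Integrating it turns the triple
integral into ∫g² - D g(D)² + 2(λ²D² - 1) g(D)² I with I = ∫₀ᴰ t g² ∫₀ᵗ g⁻²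
(`four_mul_tripleIntegral`). Since λ > 1 and I ≥ 1/12, the last term beats D g(D)² once D ≥ 10. -/

/-- `y` solves the autonomous equation `y' = f y` on `[a, b]` with `y 0 = p`. -/
def IsODESol {E : Type*} [NormedAddCommGroup E] [NormedSpace ℝ E] (f : E → E) (a b : ℝ) (p : E)
    (y : ℝ → E) : Prop :=
  y 0 = p ∧ ∀ x ∈ Icc a b, HasDerivWithinAt y (f (y x)) (Icc a b) x

/-! ### Smooth autonomous equations: Grönwall, uniqueness, stability, differentiability of the flow.
-/

section GeneralODE

variable {E F : Type*} [NormedAddCommGroup E] [NormedSpace ℝ E]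
  [NormedAddCommGroup F] [NormedSpace ℝ F]

theorem IsODESol.continuousOn {f : E → E} {a b : ℝ} {p : E} {y : ℝ → E}
    (h : IsODESol f a b p y) : ContinuousOn y (Icc a b) :=
  fun x hx => (h.2 x hx).continuousWithinAt

theorem IsODESol.mono {f : E → E} {a b a' b' : ℝ} {p : E} {y : ℝ → E}
    (h : IsODESol f a b p y) (ha : a ≤ a') (hb : b' ≤ b) : IsODESol f a' b' p y :=
  ⟨h.1, fun x hx => (h.2 x ⟨ha.trans hx.1, hx.2.trans hb⟩).mono (Icc_subset_Icc ha hb)⟩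

theorem norm_le_gronwallBound_of_nonneg {e e' : ℝ → E} {b δ K ε : ℝ}
    (he : ∀ x ∈ Icc 0 b, HasDerivWithinAt e (e' x) (Icc 0 b) x) (h0 : ‖e 0‖ ≤ δ)
    (hK : ∀ x ∈ Icc 0 b, ‖e' x‖ ≤ K * ‖e x‖ + ε) {x : ℝ} (hx : x ∈ Icc 0 b) :
    ‖e x‖ ≤ gronwallBound δ K ε x := by
  have := norm_le_gronwallBound_of_norm_deriv_right_le (f := e) (f' := e')
    (fun x hx => (he x hx).continuousWithinAt)
    (fun x hx => (he x ⟨hx.1, hx.2.le⟩).mono_of_mem_nhdsWithin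
      (Icc_mem_nhdsGE_of_mem hx)) h0
    (fun x hx => hK x ⟨hx.1, hx.2.le⟩) x hx
  simpa using this

/-- Time reversal of a derivative within an interval. -/
theorem HasDerivWithinAt.comp_neg_Icc {e : ℝ → E} {e' : E} {a b x : ℝ}
    (h : HasDerivWithinAt e e' (Icc a b) (-x)) :
    HasDerivWithinAt (fun t => e (-t)) (-e') (Icc (-b) (-a)) x := by
  have := HasDerivWithinAt.scomp (x := x) (s := Icc (-b) (-a)) (h := fun t : ℝ => -t) (h' := -1)
    h (hasDerivAt_neg x).hasDerivWithinAt
    (fun t ht => ⟨by linarith [ht.2], by linarith [ht.1]⟩)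
  simpa [Function.comp_def] using this

/-- A two-sided Grönwall inequality. -/
theorem norm_le_gronwallBound_abs {e e' : ℝ → E} {a b δ K ε : ℝ}
    (ha : a ≤ 0) (hb : 0 ≤ b)
    (he : ∀ x ∈ Icc a b, HasDerivWithinAt e (e' x) (Icc a b) x) (h0 : ‖e 0‖ ≤ δ)
    (hK : ∀ x ∈ Icc a b, ‖e' x‖ ≤ K * ‖e x‖ + ε) {x : ℝ} (hx : x ∈ Icc a b) :
    ‖e x‖ ≤ gronwallBound δ K ε |x| := by
  rcases le_total 0 x with h | h
  · rw [abs_of_nonneg h]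
    exact norm_le_gronwallBound_of_nonneg (b := b) (e' := e')
      (fun t ht => (he t ⟨ha.trans ht.1, ht.2⟩).mono (Icc_subset_Icc ha le_rfl)) h0
      (fun t ht => hK t ⟨ha.trans ht.1, ht.2⟩) ⟨h, hx.2⟩
  · rw [abs_of_nonpos h]
    have := norm_le_gronwallBound_of_nonneg (b := -a) (e := fun t => e (-t))
      (e' := fun t => -e' (-t)) (δ := δ) (K := K) (ε := ε) (x := -x)
      (fun t ht => by
        have := (he (-t) ⟨by linarith [ht.2], by linarith [ht.1]⟩).comp_neg_Icc
        exact this.mono (Icc_subset_Icc (by linarith) le_rfl))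
      (by simpa using h0)
      (fun t ht => by
        simpa using hK (-t) ⟨by linarith [ht.2], by linarith [ht.1]⟩)
      ⟨by linarith, by linarith [hx.1]⟩
    simpa using this

/-- A bounded Lipschitz field has a solution on every interval. -/
theorem exists_isODESol_of_bounded [CompleteSpace E] {f : E → E} {K : NNReal} {L : ℝ}
    (hf : LipschitzWith K f) (hL : ∀ x, ‖f x‖ ≤ L) {a b : ℝ} (ha : a ≤ 0) (hb : 0 ≤ b) (p : E) :
    ∃ y, IsODESol f a b p y := by
  have hL0 : 0 ≤ L := (norm_nonneg _).trans (hL 0)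
  lift L to NNReal using hL0
  have hm : 0 ≤ max (b - 0) (0 - a) := le_max_of_le_left (by linarith)
  obtain ⟨y, hy0, hy⟩ :=
    (IsPicardLindelof.of_time_independent (f := f) (t₀ := ⟨0, ha, hb⟩) (x₀ := p)
      (a := L * ⟨max (b - 0) (0 - a), hm⟩) (r := 0) (L := L) (K := K)
      (fun x _ => hL x) hf.lipschitzOnWith
      (le_of_eq (sub_zero _).symm)).exists_eq_forall_mem_Icc_hasDerivWithinAt₀
  exact ⟨y, hy0, hy⟩

theorem exists_lipschitz_on_ball [FiniteDimensional ℝ E] {f : E → F} (hf : ContDiff ℝ 1 f)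
    (R : ℝ) : ∃ K : ℝ, 0 ≤ K ∧ ∀ x y : E, ‖x‖ ≤ R → ‖y‖ ≤ R → ‖f x - f y‖ ≤ K * ‖x - y‖ := by
  have : ProperSpace E := FiniteDimensional.proper ℝ E
  obtain ⟨K, hK⟩ := (isCompact_closedBall (0 : E) R).exists_bound_of_continuousOn
    (hf.continuous_fderiv one_ne_zero).continuousOn
  refine ⟨max K 0, le_max_right _ _, fun x y hx hy => ?_⟩
  exact (convex_closedBall (0 : E) R).norm_image_sub_le_of_norm_fderiv_le (𝕜 := ℝ)
    (fun z _ => hf.differentiable one_ne_zero z) (fun z hz => (hK z hz).trans (le_max_left _ _))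
    (by simpa using hy) (by simpa using hx)

theorem IsODESol.exists_bound {f : E → E} {a b : ℝ} {p : E} {y : ℝ → E}
    (h : IsODESol f a b p y) : ∃ R, 0 ≤ R ∧ ∀ x ∈ Icc a b, ‖y x‖ ≤ R := by
  obtain ⟨R, hR⟩ := isCompact_Icc.exists_bound_of_continuousOn h.continuousOn
  exact ⟨max R 0, le_max_right _ _, fun x hx => (hR x hx).trans (le_max_left _ _)⟩

/-- Uniqueness of solutions for a continuously differentiable field. -/
theorem IsODESol.unique [FiniteDimensional ℝ E] {f : E → E} (hf : ContDiff ℝ 1 f) {a b : ℝ}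
    (ha : a ≤ 0) (hb : 0 ≤ b) {p : E} {y z : ℝ → E} (hy : IsODESol f a b p y)
    (hz : IsODESol f a b p z) {x : ℝ} (hx : x ∈ Icc a b) : y x = z x := by
  obtain ⟨R₁, -, h₁⟩ := hy.exists_bound
  obtain ⟨R₂, -, h₂⟩ := hz.exists_bound
  obtain ⟨K, hK, hlip⟩ := exists_lipschitz_on_ball hf (max R₁ R₂)
  have := norm_le_gronwallBound_abs (e := fun t => y t - z t)
    (e' := fun t => f (y t) - f (z t)) (δ := 0) (K := K) (ε := 0) ha hb
    (fun t ht => (hy.2 t ht).sub (hz.2 t ht)) (by simp [hy.1, hz.1])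
    (fun t ht => by
      simpa using hlip _ _ ((h₁ t ht).trans (le_max_left _ _)) ((h₂ t ht).trans (le_max_right _ _)))
    hx
  rw [gronwallBound_ε0_δ0] at this
  exact sub_eq_zero.1 (norm_le_zero_iff.1 this)

/-- Solutions exist near a given solution, and depend on the initial value in a Lipschitz way. -/
theorem IsODESol.stability [FiniteDimensional ℝ E] {f : E → E} (hf : ContDiff ℝ 1 f) {a b : ℝ}
    (ha : a ≤ 0) (hb : 0 ≤ b) {p : E} {y : ℝ → E} (hy : IsODESol f a b p y) :
    ∃ C, 0 ≤ C ∧ ∀ᶠ p' in 𝓝 p, ∃ y', IsODESol f a b p' y' ∧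
      ∀ x ∈ Icc a b, ‖y' x - y x‖ ≤ C * ‖p' - p‖ := by
  have : CompleteSpace E := FiniteDimensional.complete ℝ E
  obtain ⟨R, hR0, hR⟩ := hy.exists_bound
  -- Cutting the field off outside a ball makes it bounded and globally Lipschitz, hence globally
  -- solvable; solutions that stay within R + 1 do not see the cutoff.
  let χ : ContDiffBump (0 : E) := ⟨R + 1, R + 2, by linarith, by linarith⟩
  let g : E → E := fun x => χ x • f x
  have hg1 : ContDiff ℝ 1 g := (χ.contDiff).smul hf
  have hgc : HasCompactSupport g := χ.hasCompactSupport.smul_right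
  obtain ⟨K, hK⟩ := hg1.lipschitzWith_of_hasCompactSupport hgc one_ne_zero
  obtain ⟨L, hL⟩ := hgc.exists_bound_of_continuous hg1.continuous
  have hgf : ∀ x, ‖x‖ ≤ R + 1 → g x = f x := fun x hx => by
    simp [g, χ.one_of_mem_closedBall (x := x) (by simpa using hx)]
  set B := max b (-a) with hB
  refine ⟨Real.exp (K * B), (Real.exp_pos _).le, ?_⟩
  -- A deviation below 1 keeps the nearby solution inside the ball of radius R + 1.
  have hnear : ∀ᶠ p' in 𝓝 p, Real.exp (K * B) * ‖p' - p‖ < 1 := by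
    have : Tendsto (fun p' => Real.exp (K * B) * ‖p' - p‖) (𝓝 p) (𝓝 0) := by
      have h : Continuous fun p' : E => Real.exp (K * B) * ‖p' - p‖ := by fun_prop
      simpa using h.tendsto p
    exact this.eventually (gt_mem_nhds one_pos)
  filter_upwards [hnear] with p' hp'
  obtain ⟨y', hy'⟩ := exists_isODESol_of_bounded hK hL ha hb p'
  have hest : ∀ x ∈ Icc a b, ‖y' x - y x‖ ≤ Real.exp (K * B) * ‖p' - p‖ := by
    intro x hx
    have h1 := norm_le_gronwallBound_abs (e := fun t => y' t - y t)
      (e' := fun t => g (y' t) - f (y t)) (δ := ‖p' - p‖) (K := K) (ε := 0) ha hb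
      (fun t ht => (hy'.2 t ht).sub (hy.2 t ht)) (by simp [hy.1, hy'.1])
      (fun t ht => by
        rw [← hgf (y t) ((hR t ht).trans (by linarith)), add_zero, ← dist_eq_norm, ← dist_eq_norm]
        exact hK.dist_le_mul _ _) hx
    rw [gronwallBound_ε0] at h1
    refine h1.trans ?_
    rw [mul_comm]
    gcongr
    rcases le_total 0 x with h | h
    · rw [abs_of_nonneg h]; exact hx.2.trans (le_max_left _ _)
    · rw [abs_of_nonpos h]; exact le_trans (by linarith [hx.1]) (le_max_right _ _)
  refine ⟨y', ⟨hy'.1, fun x hx => ?_⟩, hest⟩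
  have h2 : ‖y' x‖ ≤ R + 1 := by
    have h3 := hest x hx
    have h4 := hR x hx
    have h5 : ‖y' x‖ ≤ ‖y' x - y x‖ + ‖y x‖ := norm_le_norm_sub_add _ _
    linarith
  have h3 := hy'.2 x hx
  rwa [hgf _ h2] at h3

/-- The combined field of an equation and of a second equation driven by it. -/
def pairField (f : E → E) (G : E → F → F) (z : E × F) : E × F := (f z.1, G z.1 z.2)

theorem IsODESol.pair {f : E → E} {G : E → F → F} {a b : ℝ} {p : E} {v : F} {y : ℝ → E}
    {Y : ℝ → F} (hy : IsODESol f a b p y) (hY0 : Y 0 = v)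
    (hY : ∀ x ∈ Icc a b, HasDerivWithinAt Y (G (y x) (Y x)) (Icc a b) x) :
    IsODESol (pairField f G) a b (p, v) (fun x => (y x, Y x)) :=
  ⟨by simp [hy.1, hY0], fun x hx => (hy.2 x hx).prodMk (hY x hx)⟩

theorem IsODESol.of_pair {f : E → E} {G : E → F → F} {a b : ℝ} {p : E} {v : F} {z : ℝ → E × F}
    (hz : IsODESol (pairField f G) a b (p, v) z) :
    IsODESol f a b p (fun x => (z x).1) ∧ (z 0).2 = v ∧
      ∀ x ∈ Icc a b, HasDerivWithinAt (fun x => (z x).2) (G (z x).1 (z x).2) (Icc a b) x :=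
  ⟨⟨by simp [hz.1], fun x hx => (hz.2 x hx).fst⟩, by simp [hz.1], fun x hx => (hz.2 x hx).snd⟩

/-- Solvability of a homogeneous equation along a given solution. -/
theorem IsODESol.exists_linear [FiniteDimensional ℝ E] [FiniteDimensional ℝ F] {f : E → E}
    (hf : ContDiff ℝ 1 f) {G : E → F → F} (hG : ContDiff ℝ 1 (fun z : E × F => G z.1 z.2))
    (hG' : ∀ (c : ℝ) y Y, G y (c • Y) = c • G y Y) {a b : ℝ} (ha : a ≤ 0) (hb : 0 ≤ b)
    {p : E} {y : ℝ → E} (hy : IsODESol f a b p y) (v : F) :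
    ∃ Y : ℝ → F, Y 0 = v ∧ ∀ x ∈ Icc a b, HasDerivWithinAt Y (G (y x) (Y x)) (Icc a b) x := by
  have hpf : ContDiff ℝ 1 (pairField f G) := (hf.comp contDiff_fst).prodMk hG
  have h0 : ∀ y, G y 0 = 0 := fun y => by simpa using hG' 0 y 0
  -- The pair (y, 0) solves the combined nonlinear system on the whole interval. By stability so
  -- does a solution starting from (p, c • v) for some small c > 0, and homogeneity allows division
  -- by c.
  have hbase : IsODESol (pairField f G) a b (p, (0 : F)) (fun x => (y x, 0)) :=
    hy.pair (Y := fun _ => 0) rfl (fun x _ => by rw [h0]; exact hasDerivWithinAt_const _ _ _)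
  obtain ⟨C, -, hC⟩ := hbase.stability hpf ha hb
  have ht : Tendsto (fun c : ℝ => (p, c • v)) (𝓝[>] 0) (𝓝 (p, (0 : F))) := by
    have : Continuous fun c : ℝ => (p, c • v) := by fun_prop
    have := this.tendsto 0
    simp only [zero_smul] at this
    exact this.mono_left nhdsWithin_le_nhds
  obtain ⟨c, ⟨z, hz, -⟩, hc⟩ := ((ht.eventually hC).and self_mem_nhdsWithin).exists
  have hc0 : c ≠ 0 := ne_of_gt hc
  obtain ⟨h1, h2, h3⟩ := hz.of_pair
  refine ⟨fun x => c⁻¹ • (z x).2, by simp [h2, smul_smul, hc0], fun x hx => ?_⟩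
  have := (h3 x hx).const_smul c⁻¹
  rwa [← hG', h1.unique hf ha hb hy hx] at this

/-- Uniqueness for a homogeneous equation along a given solution. -/
theorem IsODESol.linear_unique [FiniteDimensional ℝ E] [FiniteDimensional ℝ F] {f : E → E}
    (hf : ContDiff ℝ 1 f) {G : E → F → F} (hG : ContDiff ℝ 1 (fun z : E × F => G z.1 z.2))
    {a b : ℝ} (ha : a ≤ 0) (hb : 0 ≤ b) {p : E} {y : ℝ → E} (hy : IsODESol f a b p y)
    {Y Z : ℝ → F} (h0 : Y 0 = Z 0)
    (hY : ∀ x ∈ Icc a b, HasDerivWithinAt Y (G (y x) (Y x)) (Icc a b) x)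
    (hZ : ∀ x ∈ Icc a b, HasDerivWithinAt Z (G (y x) (Z x)) (Icc a b) x)
    {x : ℝ} (hx : x ∈ Icc a b) : Y x = Z x := by
  have hpf : ContDiff ℝ 1 (pairField f G) := (hf.comp contDiff_fst).prodMk hG
  exact congrArg Prod.snd ((hy.pair rfl hY).unique hpf ha hb (hy.pair h0.symm hZ) hx)

/-- The solution is a differentiable function of the initial value, and its derivative solves the
linearized equation. -/
theorem IsODESol.hasFDerivAt_flow [FiniteDimensional ℝ E] {f : E → E} {f' : E → E →L[ℝ] E}
    (hf : ContDiff ℝ 1 f) (hff : ∀ y, HasFDerivAt f (f' y) y) (hf' : ContDiff ℝ 1 f')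
    {a b : ℝ} (ha : a ≤ 0) (hb : 0 ≤ b)
    {p : E} {Φ : E → ℝ → E} (hy : IsODESol f a b p (Φ p))
    (hΦ : ∀ p' y', IsODESol f a b p' y' → IsODESol f a b p' (Φ p')) {x : ℝ} (hx : x ∈ Icc a b) :
    ∃ A : E →L[ℝ] E, HasFDerivAt (fun p' => Φ p' x) A p ∧
      ∀ Y : ℝ → E, (∀ x ∈ Icc a b, HasDerivWithinAt Y (f' (Φ p x) (Y x)) (Icc a b) x) →
        A (Y 0) = Y x := by
  have : ProperSpace E := FiniteDimensional.proper ℝ E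
  have hG : ContDiff ℝ 1 (fun z : E × E => f' z.1 z.2) :=
    (hf'.comp contDiff_fst).clm_apply contDiff_snd
  have hlin := fun v : E => hy.exists_linear hf (G := fun y Y => f' y Y) hG
    (fun c y Y => by simp) ha hb v
  choose Y hY0 hY using hlin
  have huniq : ∀ Z W : ℝ → E, Z 0 = W 0 →
      (∀ x ∈ Icc a b, HasDerivWithinAt Z (f' (Φ p x) (Z x)) (Icc a b) x) →
      (∀ x ∈ Icc a b, HasDerivWithinAt W (f' (Φ p x) (W x)) (Icc a b) x) → Z x = W x :=
    fun Z W h0 hZ hW => hy.linear_unique hf (G := fun y Y => f' y Y) hG ha hb h0 hZ hW hx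
  let A₀ : E →ₗ[ℝ] E :=
    { toFun := fun v => Y v x
      map_add' := fun v w => huniq (Y (v + w)) (fun t => Y v t + Y w t) (by simp [hY0])
        (hY _) (fun t ht => by rw [map_add]; exact (hY v t ht).add (hY w t ht))
      map_smul' := fun c v => huniq (Y (c • v)) (fun t => c • Y v t) (by simp [hY0])
        (hY _) (fun t ht => by rw [map_smul]; exact (hY v t ht).const_smul c) }
  refine ⟨LinearMap.toContinuousLinearMap A₀, ?_, fun Z hZ =>
    huniq (Y (Z 0)) Z (hY0 _) (hY _) hZ⟩
  obtain ⟨C, hC0, hC⟩ := hy.stability hf ha hb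
  obtain ⟨R, hR0, hR⟩ := hy.exists_bound
  obtain ⟨K₂, hK₂, hlip⟩ := exists_lipschitz_on_ball hf' (R + C)
  obtain ⟨K₁, hK₁⟩ := (isCompact_closedBall (0 : E) R).exists_bound_of_continuousOn
    hf'.continuous.continuousOn
  -- Second-order Taylor estimate: on the segment-sized ball around u the derivative differs from
  -- `f' u` by at most K₂‖v - u‖.
  have hquad : ∀ u v : E, ‖u‖ ≤ R → ‖v - u‖ ≤ C →
      ‖f v - f u - f' u (v - u)‖ ≤ K₂ * ‖v - u‖ * ‖v - u‖ := by
    intro u v hu huv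
    refine (convex_closedBall u ‖v - u‖).norm_image_sub_le_of_norm_hasFDerivWithin_le'
      (f' := f') (fun z _ => (hff z).hasFDerivWithinAt) (fun z hz => ?_)
      (Metric.mem_closedBall_self (norm_nonneg _)) (by simp [dist_eq_norm])
    have hz' : ‖z - u‖ ≤ ‖v - u‖ := by simpa [dist_eq_norm] using hz
    have : ‖z‖ ≤ ‖z - u‖ + ‖u‖ := norm_le_norm_sub_add _ _
    exact (hlip z u (by linarith) (by linarith)).trans (by gcongr)
  have hK₁0 : 0 ≤ max K₁ 0 := le_max_right _ _
  have hO : (fun p' => Φ p' x - Φ p x - A₀ (p' - p)) =O[𝓝 p] fun p' => ‖p' - p‖ ^ 2 := by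
    refine Asymptotics.IsBigO.of_bound
      (gronwallBound 0 (max K₁ 0) (K₂ * C * C) |x|) ?_
    have hnear : ∀ᶠ p' in 𝓝 p, ‖p' - p‖ < 1 := by
      filter_upwards [Metric.ball_mem_nhds p one_pos] with p' hp'
      simpa [dist_eq_norm] using hp'
    filter_upwards [hC, hnear] with p' ⟨y', hy', hyC⟩ hp1
    have hΦ' := hΦ p' y' hy'
    have heq : ∀ t ∈ Icc a b, Φ p' t = y' t := fun t ht => hΦ'.unique hf ha hb hy' ht
    have hd : ∀ t ∈ Icc a b, ‖Φ p' t - Φ p t‖ ≤ C * ‖p' - p‖ := fun t ht => by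
      rw [heq t ht]; exact hyC t ht
    have h1 := norm_le_gronwallBound_abs (e := fun t => Φ p' t - Φ p t - Y (p' - p) t)
      (e' := fun t => f (Φ p' t) - f (Φ p t) - f' (Φ p t) (Y (p' - p) t)) (δ := 0)
      (K := max K₁ 0) (ε := K₂ * C * C * ‖p' - p‖ ^ 2) ha hb
      (fun t ht => ((hΦ'.2 t ht).sub (hy.2 t ht)).sub (hY _ t ht))
      (by simp [hy.1, hΦ'.1, hY0])
      (fun t ht => by
        have e1 : f (Φ p' t) - f (Φ p t) - f' (Φ p t) (Y (p' - p) t) =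
            f' (Φ p t) (Φ p' t - Φ p t - Y (p' - p) t) +
            (f (Φ p' t) - f (Φ p t) - f' (Φ p t) (Φ p' t - Φ p t)) := by
          simp only [map_sub]; abel
        rw [e1]
        refine (norm_add_le _ _).trans (add_le_add ?_ ?_)
        · refine (ContinuousLinearMap.le_opNorm _ _).trans ?_
          gcongr
          exact (hK₁ _ (by simpa using hR t ht)).trans (le_max_left _ _)
        · have hd' := hd t ht
          refine (hquad _ _ (hR t ht) (hd'.trans ?_)).trans ?_
          · nlinarith
          · calc K₂ * ‖Φ p' t - Φ p t‖ * ‖Φ p' t - Φ p t‖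
                ≤ K₂ * (C * ‖p' - p‖) * (C * ‖p' - p‖) := by gcongr
              _ = _ := by ring) hx
    -- With zero initial error the Grönwall bound is linear in its inhomogeneity, which is quadratic
    -- in p' - p; this gives the little-o remainder.
    have hscale : ∀ m : ℝ, gronwallBound 0 (max K₁ 0) (K₂ * C * C * m) |x| =
        gronwallBound 0 (max K₁ 0) (K₂ * C * C) |x| * m := by
      intro m
      by_cases hk : max K₁ 0 = 0
      · rw [hk]; simp [gronwallBound_K0]; ring
      · rw [gronwallBound_of_K_ne_0 hk, gronwallBound_of_K_ne_0 hk]; simp; ring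
    rw [hscale] at h1
    simpa [A₀] using h1
  have ho : (fun p' => ‖p' - p‖ ^ 2) =o[𝓝 p] fun p' => p' - p :=
    Asymptotics.isLittleO_pow_sub_sub p one_lt_two
  exact HasFDerivAt.of_isLittleO (hO.trans_isLittleO ho)

end GeneralODE

/-! ### Comparison principles and truncated fields. -/

/-- A linear system with nonnegative coefficients preserves the nonnegative orthant. -/
theorem nonneg_of_cooperative {n : ℕ} {X : ℝ → Fin n → ℝ} {A : ℝ → Fin n → Fin n → ℝ} {d : ℝ}
    (hX : ∀ x ∈ Icc 0 d, HasDerivWithinAt X (fun i => ∑ j, A x i j * X x j) (Icc 0 d) x)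
    (hA : ∀ x ∈ Icc 0 d, ∀ i j, 0 ≤ A x i j) (hAc : ∀ i j, ContinuousOn (fun x => A x i j) (Icc 0 d))
    (h0 : ∀ i, 0 ≤ X 0 i) {x : ℝ} (hx : x ∈ Icc 0 d) (i : Fin n) : 0 ≤ X x i := by
  have hd : 0 ≤ d := hx.1.trans hx.2
  have hbdd : ∃ K, ∀ x ∈ Icc 0 d, ∀ i j, A x i j ≤ K := by
    choose K hK using fun i j => isCompact_Icc.exists_bound_of_continuousOn (hAc i j)
    refine ⟨∑ i, ∑ j, |K i j|, fun x hx i j => ?_⟩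
    calc A x i j ≤ |K i j| := (le_abs_self _).trans ((hK i j x hx).trans (le_abs_self _))
      _ ≤ ∑ j, |K i j| := Finset.single_le_sum (f := fun j => |K i j|)
          (fun _ _ => abs_nonneg _) (Finset.mem_univ j)
      _ ≤ ∑ i, ∑ j, |K i j| := Finset.single_le_sum (f := fun i => ∑ j, |K i j|)
          (fun _ _ => Finset.sum_nonneg fun _ _ => abs_nonneg _) (Finset.mem_univ i)
  obtain ⟨K, hK⟩ := hbdd
  have hK0 : 0 ≤ K := (hA 0 ⟨le_rfl, hd⟩ i i).trans (hK 0 ⟨le_rfl, hd⟩ i i)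
  -- Perturb each component by η e^{Lt}. Up to the first time some component reaches zero, its
  -- derivative is at least (L - nK) η e^{Lt} > 0, so it cannot have come down to zero. Then η → 0.
  set L : ℝ := n * K + 1 with hL
  have key : ∀ η > 0, ∀ t ∈ Icc 0 d, ∀ i, 0 < X t i + η * Real.exp (L * t) := by
    intro η hη
    set Z : ℝ → Fin n → ℝ := fun t i => X t i + η * Real.exp (L * t) with hZ
    have hZd : ∀ t ∈ Icc 0 d, ∀ i, HasDerivWithinAt (fun t => Z t i)
        (∑ j, A t i j * X t j + η * (Real.exp (L * t) * L)) (Icc 0 d) t := fun t ht i =>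
      (hasDerivWithinAt_pi.1 (hX t ht) i).add
        ((((hasDerivAt_id t).const_mul L).exp.const_mul η).hasDerivWithinAt.congr_deriv
          (by simp))
    have hZc : ∀ i, ContinuousOn (fun t => Z t i) (Icc 0 d) := fun i t ht =>
      (hZd t ht i).continuousWithinAt
    by_contra hcon
    push Not at hcon
    set S : Set ℝ := ⋃ i, {t ∈ Icc 0 d | Z t i ≤ 0} with hS
    have hSc : IsCompact S := isCompact_iUnion fun i =>
      isCompact_Icc.of_isClosed_subset
        ((hZc i).preimage_isClosed_of_isClosed isClosed_Icc isClosed_Iic) (fun t ht => ht.1)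
    obtain ⟨t₁, ht₁, j₁, hj₁⟩ := hcon
    obtain ⟨t₀, ht₀, hmin⟩ := hSc.exists_isLeast ⟨t₁, mem_iUnion.2 ⟨j₁, ht₁, hj₁⟩⟩
    obtain ⟨j, ht₀d, hj⟩ := mem_iUnion.1 ht₀
    have hpos : ∀ t ∈ Ico 0 t₀, ∀ i, 0 < Z t i := by
      intro t ht i
      by_contra hle
      exact absurd (hmin (mem_iUnion.2 ⟨i, ⟨ht.1, ht.2.le.trans ht₀d.2⟩, not_lt.1 hle⟩))
        (not_le.2 ht.2)
    have hmono : MonotoneOn (fun t => Z t j) (Icc 0 t₀) := by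
      have hsub : Icc 0 t₀ ⊆ Icc 0 d := Icc_subset_Icc le_rfl ht₀d.2
      refine monotoneOn_of_hasDerivWithinAt_nonneg (convex_Icc _ _) ((hZc j).mono hsub)
        (fun t ht => (hZd t (hsub (interior_subset ht)) j).mono (interior_subset.trans hsub)) ?_
      intro t ht
      rw [interior_Icc] at ht
      have htd : t ∈ Icc 0 d := hsub ⟨ht.1.le, ht.2.le⟩
      have h1 : ∑ k, A t j k * X t k =
          ∑ k, A t j k * Z t k - (∑ k, A t j k) * (η * Real.exp (L * t)) := by
        simp only [hZ, mul_add, Finset.sum_add_distrib, Finset.sum_mul]; ring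
      have h2 : 0 ≤ ∑ k, A t j k * Z t k := Finset.sum_nonneg fun k _ =>
        mul_nonneg (hA t htd j k) (hpos t ⟨ht.1.le, ht.2⟩ k).le
      have h3 : ∑ k, A t j k ≤ n * K := by
        simpa using Finset.sum_le_card_nsmul Finset.univ (fun k => A t j k) K
          (fun k _ => hK t htd j k)
      have h4 : 0 < η * Real.exp (L * t) := by positivity
      rw [h1]
      nlinarith
    have h5 := hmono ⟨le_rfl, ht₀d.1⟩ ⟨ht₀d.1, le_rfl⟩ ht₀d.1
    have h6 : 0 < Z 0 j := by
      have := h0 j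
      simp only [hZ]; positivity
    linarith
  refine le_of_forall_pos_le_add fun ε hε => ?_
  have h1 := key (ε / Real.exp (L * x)) (by positivity) x hx i
  rw [div_mul_cancel₀ _ (Real.exp_pos _).ne'] at h1
  exact h1.le

/-- A field truncated outside a box has solutions on every interval. -/
theorem exists_isODESol_truncated {n : ℕ} {f : (Fin n → ℝ) → Fin n → ℝ} (hf : ContDiff ℝ 1 f)
    {lo hi : Fin n → ℝ} (hlh : lo ≤ hi) {a b : ℝ} (ha : a ≤ 0) (hb : 0 ≤ b) :
    ∃ K : NNReal, LipschitzWith K (fun y => f (lo ⊔ hi ⊓ y)) ∧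
      ∀ p, ∃ y, IsODESol (fun y => f (lo ⊔ hi ⊓ y)) a b p y := by
  obtain ⟨R, hR⟩ := (isCompact_Icc (a := lo) (b := hi)).exists_bound_of_continuousOn
    (f := id) continuousOn_id
  have hmem : ∀ y, lo ⊔ hi ⊓ y ∈ Icc lo hi := fun y =>
    ⟨le_sup_left, sup_le hlh inf_le_left⟩
  obtain ⟨K, hK, hlip⟩ := exists_lipschitz_on_ball hf R
  obtain ⟨L, hL⟩ := (isCompact_Icc (a := lo) (b := hi)).exists_bound_of_continuousOn
    hf.continuous.continuousOn
  have hπ : LipschitzWith 1 (fun y : Fin n → ℝ => lo ⊔ hi ⊓ y) := by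
    refine LipschitzWith.of_dist_le_mul fun y z => ?_
    rw [NNReal.coe_one, one_mul, dist_pi_le_iff dist_nonneg]
    intro i
    refine le_trans ?_ (dist_le_pi_dist y z i)
    simp only [Pi.sup_apply, Pi.inf_apply, Real.dist_eq]
    refine (abs_max_sub_max_le_max _ _ _ _).trans ?_
    rw [sub_self, abs_zero, max_eq_right (abs_nonneg _)]
    refine (abs_min_sub_min_le_max _ _ _ _).trans ?_
    rw [sub_self, abs_zero, max_eq_right (abs_nonneg _)]
  have hl : LipschitzWith ⟨K, hK⟩ (fun y => f (lo ⊔ hi ⊓ y)) := by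
    refine LipschitzWith.of_dist_le_mul fun y z => ?_
    rw [dist_eq_norm]
    refine (hlip _ _ (hR _ (hmem y)) (hR _ (hmem z))).trans ?_
    have := hπ.dist_le_mul y z
    rw [dist_eq_norm, NNReal.coe_one, one_mul] at this
    exact mul_le_mul_of_nonneg_left this hK
  exact ⟨_, hl, exists_isODESol_of_bounded hl (fun y => hL _ (hmem y)) ha hb⟩

/-- The shape common to all comparison arguments below: c is a quotient of two functions (minus one,
when two solutions are compared), W is their Wronskian, so that c' = W/ψ² for the denominator ψ, and
b, b₁ are the variation of the potential and its derivative. -/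
theorem nonneg_of_cooperative_pair {c W b b₁ p q₁ q₂ q₃ q₄ : ℝ → ℝ} {d : ℝ}
    (hc : ∀ x ∈ Icc 0 d, HasDerivWithinAt c (p x * W x) (Icc 0 d) x)
    (hW : ∀ x ∈ Icc 0 d, HasDerivWithinAt W (q₁ x * c x + q₂ x * b x) (Icc 0 d) x)
    (hb : ∀ x ∈ Icc 0 d, HasDerivWithinAt b (b₁ x) (Icc 0 d) x)
    (hb₁ : ∀ x ∈ Icc 0 d, HasDerivWithinAt b₁ (q₃ x * c x + q₄ x * b x) (Icc 0 d) x)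
    (hp : ∀ x ∈ Icc 0 d, 0 ≤ p x) (hq₁ : ∀ x ∈ Icc 0 d, 0 ≤ q₁ x) (hq₂ : ∀ x ∈ Icc 0 d, 0 ≤ q₂ x)
    (hq₃ : ∀ x ∈ Icc 0 d, 0 ≤ q₃ x) (hq₄ : ∀ x ∈ Icc 0 d, 0 ≤ q₄ x)
    (hpc : ContinuousOn p (Icc 0 d)) (hq₁c : ContinuousOn q₁ (Icc 0 d))
    (hq₂c : ContinuousOn q₂ (Icc 0 d)) (hq₃c : ContinuousOn q₃ (Icc 0 d))
    (hq₄c : ContinuousOn q₄ (Icc 0 d))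
    (c0 : 0 ≤ c 0) (W0 : 0 ≤ W 0) (b0 : 0 ≤ b 0) (b₁0 : 0 ≤ b₁ 0) {x : ℝ} (hx : x ∈ Icc 0 d) :
    0 ≤ c x ∧ 0 ≤ W x ∧ 0 ≤ b x ∧ 0 ≤ b₁ x := by
  have key := nonneg_of_cooperative (d := d) (X := fun x => ![c x, W x, b x, b₁ x])
    (A := fun x => ![![0, p x, 0, 0], ![q₁ x, 0, q₂ x, 0], ![0, 0, 0, 1], ![q₃ x, 0, q₄ x, 0]])
    (fun x hx => by
      rw [hasDerivWithinAt_pi]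
      intro i
      fin_cases i
      · simpa [Fin.sum_univ_four] using hc x hx
      · simpa [Fin.sum_univ_four] using hW x hx
      · simpa [Fin.sum_univ_four] using hb x hx
      · simpa [Fin.sum_univ_four] using hb₁ x hx)
    (fun x hx i j => by
      fin_cases i <;> fin_cases j <;>
        simp [hp x hx, hq₁ x hx, hq₂ x hx, hq₃ x hx, hq₄ x hx])
    (fun i j => by
      fin_cases i <;> fin_cases j <;>
        simp [hpc, hq₁c, hq₂c, hq₃c, hq₄c, continuousOn_const])
    (fun i => by fin_cases i <;> simp [c0, W0, b0, b₁0]) hx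
  exact ⟨key 0, key 1, key 2, key 3⟩

theorem le_of_hasDerivWithinAt_le {f g f' g' : ℝ → ℝ} {a b : ℝ}
    (hf : ∀ x ∈ Icc a b, HasDerivWithinAt f (f' x) (Icc a b) x)
    (hg : ∀ x ∈ Icc a b, HasDerivWithinAt g (g' x) (Icc a b) x)
    (h : ∀ x ∈ Icc a b, f' x ≤ g' x) (h0 : f a ≤ g a) {x : ℝ} (hx : x ∈ Icc a b) : f x ≤ g x := by
  have hm : MonotoneOn (fun t => g t - f t) (Icc a b) :=
    monotoneOn_of_hasDerivWithinAt_nonneg (convex_Icc _ _)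
      (fun t ht => ((hg t ht).sub (hf t ht)).continuousWithinAt)
      (fun t ht => ((hg t (interior_subset ht)).sub (hf t (interior_subset ht))).mono
        interior_subset)
      (fun t ht => sub_nonneg.2 (h t (interior_subset ht)))
  have := hm ⟨le_rfl, hx.1.trans hx.2⟩ hx hx.1
  simp only at this
  linarith

/-- Strictness is asked only in the open interval because in the Wronskian arguments the derivative
vanishes at x = 0, where a = 0. -/
theorem lt_of_hasDerivWithinAt_lt {f g f' g' : ℝ → ℝ} {a b : ℝ} (hab : a < b)
    (hf : ∀ x ∈ Icc a b, HasDerivWithinAt f (f' x) (Icc a b) x)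
    (hg : ∀ x ∈ Icc a b, HasDerivWithinAt g (g' x) (Icc a b) x)
    (h : ∀ x ∈ Ioo a b, f' x < g' x) (h0 : f a ≤ g a) : f b < g b := by
  have hm : StrictMonoOn (fun t => g t - f t) (Icc a b) :=
    strictMonoOn_of_hasDerivWithinAt_pos (convex_Icc _ _)
      (fun t ht => ((hg t ht).sub (hf t ht)).continuousWithinAt)
      (fun t ht => ((hg t (interior_subset ht)).sub (hf t (interior_subset ht))).mono
        interior_subset)
      (fun t ht => sub_pos.2 (h t (by rwa [interior_Icc] at ht)))
  have := hm ⟨le_rfl, hab.le⟩ ⟨hab.le, le_rfl⟩ hab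
  simp only at this
  linarith

/-- Solutions on `[a, 0]` and `[0, b]` with the same initial value combine to one on `[a, b]`. -/
theorem IsODESol.glue {E : Type*} [NormedAddCommGroup E] [NormedSpace ℝ E] {f : E → E} {a b : ℝ}
    (ha : a ≤ 0) (hb : 0 ≤ b) {p : E} {y z : ℝ → E} (hy : IsODESol f a 0 p y)
    (hz : IsODESol f 0 b p z) : IsODESol f a b p (fun x => if x ≤ 0 then y x else z x) := by
  set w : ℝ → E := fun x => if x ≤ 0 then y x else z x with hw
  have hwz : ∀ x, 0 ≤ x → w x = z x := fun x hx => by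
    rcases hx.eq_or_lt with rfl | h
    · simp [hw, hy.1, hz.1]
    · simp [hw, not_le.2 h]
  have hwy : ∀ x ≤ 0, w x = y x := fun x hx => by simp [hw, hx]
  have h1 : ∀ x ∈ Icc a 0, HasDerivWithinAt w (f (w x)) (Icc a 0) x := fun x hx => by
    rw [hwy x hx.2]
    exact (hy.2 x hx).congr (fun t ht => hwy t ht.2) (hwy x hx.2)
  have h2 : ∀ x ∈ Icc 0 b, HasDerivWithinAt w (f (w x)) (Icc 0 b) x := fun x hx => by
    rw [hwz x hx.1]
    exact (hz.2 x hx).congr (fun t ht => hwz t ht.1) (hwz x hx.1)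
  refine ⟨by simp [hw, hy.1], fun x hx => ?_⟩
  rcases lt_trichotomy x 0 with h | h | h
  · refine (h1 x ⟨hx.1, h.le⟩).mono_of_mem_nhdsWithin ?_
    filter_upwards [self_mem_nhdsWithin, nhdsWithin_le_nhds (Iio_mem_nhds h)] with t ht ht'
    exact ⟨ht.1, le_of_lt ht'⟩
  · subst h
    rw [← Icc_union_Icc_eq_Icc ha hb]
    exact (h1 0 ⟨ha, le_rfl⟩).union (h2 0 ⟨le_rfl, hb⟩)
  · refine (h2 x ⟨h.le, hx.2⟩).mono_of_mem_nhdsWithin ?_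
    filter_upwards [self_mem_nhdsWithin, nhdsWithin_le_nhds (Ioi_mem_nhds h)] with t ht ht'
    exact ⟨le_of_lt ht', ht.2⟩

/-! ### The rescaled equations and their reflection symmetry. -/

/-- The Ginzburg–Landau field for `ψ = φ / α`, with `ε = α²`. -/
def reField (κ ε : ℝ) (y : Fin 4 → ℝ) : Fin 4 → ℝ :=
  ![y 1, κ ^ 2 * y 0 * (ε * y 0 ^ 2 + y 2 ^ 2 - 1), y 3, ε * y 0 ^ 2 * y 2]

theorem glField_eq_reField (κ : ℝ) : glField κ = reField κ 1 := by
  funext y; simp [glField, reField]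

theorem contDiff_reField (κ ε : ℝ) {n : WithTop ℕ∞} : ContDiff ℝ n (reField κ ε) := by
  rw [contDiff_pi]
  intro i
  fin_cases i <;> simp only [reField] <;> simp <;> fun_prop

/-- The reflection `x ↦ -x` of the state vector of a solution. -/
def reflState (y : Fin 4 → ℝ) : Fin 4 → ℝ := ![y 0, -y 1, -y 2, y 3]

section Components

variable {κ ε a b : ℝ} {p : Fin 4 → ℝ} {y : ℝ → Fin 4 → ℝ}

theorem IsODESol.deriv_zero (h : IsODESol (reField κ ε) a b p y) :
    ∀ x ∈ Icc a b, HasDerivWithinAt (fun t => y t 0) (y x 1) (Icc a b) x :=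
  fun x hx => hasDerivWithinAt_pi.1 (h.2 x hx) 0

theorem IsODESol.deriv_one (h : IsODESol (reField κ ε) a b p y) :
    ∀ x ∈ Icc a b, HasDerivWithinAt (fun t => y t 1)
      (κ ^ 2 * y x 0 * (ε * y x 0 ^ 2 + y x 2 ^ 2 - 1)) (Icc a b) x :=
  fun x hx => hasDerivWithinAt_pi.1 (h.2 x hx) 1

theorem IsODESol.deriv_two (h : IsODESol (reField κ ε) a b p y) :
    ∀ x ∈ Icc a b, HasDerivWithinAt (fun t => y t 2) (y x 3) (Icc a b) x :=
  fun x hx => hasDerivWithinAt_pi.1 (h.2 x hx) 2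

theorem IsODESol.deriv_three (h : IsODESol (reField κ ε) a b p y) :
    ∀ x ∈ Icc a b, HasDerivWithinAt (fun t => y t 3) (ε * y x 0 ^ 2 * y x 2) (Icc a b) x :=
  fun x hx => hasDerivWithinAt_pi.1 (h.2 x hx) 3

theorem IsODESol.continuousOn_apply {f : (Fin 4 → ℝ) → Fin 4 → ℝ} (h : IsODESol f a b p y)
    (i : Fin 4) : ContinuousOn (fun t => y t i) (Icc a b) :=
  (continuous_apply i).comp_continuousOn h.continuousOn

theorem IsODESol.reflect (h : IsODESol (reField κ ε) a b p y) :
    IsODESol (reField κ ε) (-b) (-a) (reflState p) (fun x => reflState (y (-x))) := by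
  refine ⟨by simp [h.1], fun x hx => ?_⟩
  have hx' : -x ∈ Icc a b := ⟨by linarith [hx.2], by linarith [hx.1]⟩
  rw [hasDerivWithinAt_pi]
  intro i
  fin_cases i
  · exact (h.deriv_zero _ hx').comp_neg_Icc.congr_deriv (by simp [reField, reflState])
  · exact (h.deriv_one _ hx').comp_neg_Icc.neg.congr_deriv (by simp [reField, reflState])
  · exact (h.deriv_two _ hx').comp_neg_Icc.neg.congr_deriv (by simp [reField, reflState])
  · exact (h.deriv_three _ hx').comp_neg_Icc.congr_deriv (by simp [reField, reflState])

theorem IsODESol.extend_symmetric {d : ℝ} (hd : 0 ≤ d) (hp : reflState p = p)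
    (h : IsODESol (reField κ ε) 0 d p y) :
    IsODESol (reField κ ε) (-d) d p (fun x => if x ≤ 0 then reflState (y (-x)) else y x) := by
  have h1 := h.reflect
  rw [hp, neg_zero] at h1
  exact h1.glue (by linarith) hd h

end Components

/-! ### Uniqueness of the symmetric slope. -/

/-- The vector potential is nonnegative for `x ≥ 0`. -/
theorem IsODESol.two_nonneg {κ ε d δ : ℝ} {y : ℝ → Fin 4 → ℝ} (hε : 0 ≤ ε) (hδ : 0 ≤ δ)
    (h : IsODESol (reField κ ε) 0 d ![1, 0, 0, δ] y) {x : ℝ} (hx : x ∈ Icc 0 d) :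
    0 ≤ y x 2 ∧ 0 ≤ y x 3 := by
  have hc : ContinuousOn (fun t => y t 0) (Icc 0 d) := h.continuousOn_apply 0
  have key := nonneg_of_cooperative_pair (d := d) (c := fun _ => 0) (W := fun _ => 0)
    (b := fun t => y t 2) (b₁ := fun t => y t 3) (p := fun _ => 0) (q₁ := fun _ => 0)
    (q₂ := fun _ => 0) (q₃ := fun _ => 0) (q₄ := fun t => ε * y t 0 ^ 2)
    (fun x _ => by simpa using hasDerivWithinAt_const x _ (0 : ℝ))
    (fun x _ => by simpa using hasDerivWithinAt_const x _ (0 : ℝ))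
    h.deriv_two (fun x hx => by simpa using h.deriv_three x hx)
    (fun _ _ => le_rfl) (fun _ _ => le_rfl) (fun _ _ => le_rfl) (fun _ _ => le_rfl)
    (fun _ _ => by positivity) continuousOn_const continuousOn_const continuousOn_const
    continuousOn_const (by fun_prop) le_rfl le_rfl (by simp [h.1]) (by simp [h.1, hδ]) hx
  exact key.2.2

/-- Strict monotonicity of `ψ'/ψ` in the initial slope of the vector potential. -/
theorem wronskian_pos_of_lt {κ ε d δ₁ δ₂ : ℝ} (hκ : 0 < κ) (hε : 0 ≤ ε) (hd : 0 < d)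
    (hδ₁ : 0 ≤ δ₁) (hδ : δ₁ < δ₂) {y z : ℝ → Fin 4 → ℝ}
    (hy : IsODESol (reField κ ε) 0 d ![1, 0, 0, δ₁] y)
    (hz : IsODESol (reField κ ε) 0 d ![1, 0, 0, δ₂] z)
    (hy0 : ∀ x ∈ Icc 0 d, 0 < y x 0) (hz0 : ∀ x ∈ Icc 0 d, 0 < z x 0) :
    z d 0 * y d 1 < y d 0 * z d 1 := by
  have cy := hy.continuousOn_apply
  have cz := hz.continuousOn_apply
  have cy0 := cy 0
  have cy2 := cy 2
  have cz0 := cz 0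
  have cz2 := cz 2
  have ha := fun x hx => (hy.two_nonneg hε hδ₁ (x := x) hx).1
  have ha' := fun x hx => (hz.two_nonneg hε (hδ₁.trans hδ.le) (x := x) hx).1
  have hne : ∀ x ∈ Icc 0 d, y x 0 ≠ 0 := fun x hx => (hy0 x hx).ne'
  -- Factoring the differences of ψ² and a² expresses W' through the quotient minus one and the
  -- difference of the potentials, with coefficients that are nonnegative because ψ > 0 and a ≥ 0.
  have hWd : ∀ x ∈ Icc 0 d, HasDerivWithinAt (fun t => y t 0 * z t 1 - z t 0 * y t 1)
      (κ ^ 2 * y x 0 ^ 2 * z x 0 * ε * (y x 0 + z x 0) * (z x 0 / y x 0 - 1) +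
        κ ^ 2 * y x 0 * z x 0 * (y x 2 + z x 2) * (z x 2 - y x 2)) (Icc 0 d) x := fun x hx => by
    have := ((hy.deriv_zero x hx).mul (hz.deriv_one x hx)).sub
      ((hz.deriv_zero x hx).mul (hy.deriv_one x hx))
    refine this.congr_deriv ?_
    have := hne x hx
    field_simp
    ring
  have hcd : ∀ x ∈ Icc 0 d, HasDerivWithinAt (fun t => z t 0 / y t 0 - 1)
      ((y x 0 ^ 2)⁻¹ * (y x 0 * z x 1 - z x 0 * y x 1)) (Icc 0 d) x := fun x hx => by
    have := ((hz.deriv_zero x hx).div (hy.deriv_zero x hx) (hne x hx)).sub_const 1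
    refine this.congr_deriv ?_
    have := hne x hx
    field_simp
  have hb₁d : ∀ x ∈ Icc 0 d, HasDerivWithinAt (fun t => z t 3 - y t 3)
      (ε * y x 2 * y x 0 * (y x 0 + z x 0) * (z x 0 / y x 0 - 1) +
        ε * z x 0 ^ 2 * (z x 2 - y x 2)) (Icc 0 d) x := fun x hx => by
    refine ((hz.deriv_three x hx).sub (hy.deriv_three x hx)).congr_deriv ?_
    have := hne x hx
    field_simp
    ring
  have hbd : ∀ x ∈ Icc 0 d, HasDerivWithinAt (fun t => z t 2 - y t 2) (z x 3 - y x 3)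
      (Icc 0 d) x := fun x hx => (hz.deriv_two x hx).sub (hy.deriv_two x hx)
  have h0d : (0 : ℝ) ∈ Icc 0 d := ⟨le_rfl, hd.le⟩
  have key : ∀ x ∈ Icc 0 d, 0 ≤ z x 0 / y x 0 - 1 ∧ 0 ≤ y x 0 * z x 1 - z x 0 * y x 1 ∧
      0 ≤ z x 2 - y x 2 ∧ 0 ≤ z x 3 - y x 3 := fun x hx =>
    nonneg_of_cooperative_pair (d := d) (x := x)
    (c := fun t => z t 0 / y t 0 - 1) (W := fun t => y t 0 * z t 1 - z t 0 * y t 1)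
    (b := fun t => z t 2 - y t 2) (b₁ := fun t => z t 3 - y t 3)
    (p := fun t => (y t 0 ^ 2)⁻¹)
    (q₁ := fun t => κ ^ 2 * y t 0 ^ 2 * z t 0 * ε * (y t 0 + z t 0))
    (q₂ := fun t => κ ^ 2 * y t 0 * z t 0 * (y t 2 + z t 2))
    (q₃ := fun t => ε * y t 2 * y t 0 * (y t 0 + z t 0))
    (q₄ := fun t => ε * z t 0 ^ 2) hcd hWd hbd hb₁d
    (fun t ht => by positivity)
    (fun t ht => by have := hy0 t ht; have := hz0 t ht; positivity)
    (fun t ht => by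
      have := hy0 t ht; have := hz0 t ht; have := ha t ht; have := ha' t ht; positivity)
    (fun t ht => by have := hy0 t ht; have := hz0 t ht; have := ha t ht; positivity)
    (fun t ht => by positivity)
    ((cy0.pow 2).inv₀ fun t ht => pow_ne_zero 2 (hne t ht))
    (by fun_prop) (by fun_prop) (by fun_prop) (by fun_prop)
    (by simp [hy.1, hz.1]) (by simp [hy.1, hz.1]) (by simp [hy.1, hz.1])
    (by simp [hy.1, hz.1, hδ.le]) hx
  -- The initial gap in slope never shrinks, so the potentials separate at least linearly; this
  -- makes W' strictly positive in the interior.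
  have hb₁ : ∀ x ∈ Icc 0 d, δ₂ - δ₁ ≤ z x 3 - y x 3 := fun x hx =>
    le_of_hasDerivWithinAt_le (f := fun _ => δ₂ - δ₁) (f' := fun _ => 0)
      (fun t _ => hasDerivWithinAt_const _ _ _) hb₁d
      (fun t ht => by
        have := hy0 t ht; have := hz0 t ht; have := ha t ht
        obtain ⟨h1, -, h3, -⟩ := key t ht
        positivity)
      (by simp [hy.1, hz.1]) hx
  have hb : ∀ x ∈ Icc 0 d, (δ₂ - δ₁) * x ≤ z x 2 - y x 2 := fun x hx =>
    le_of_hasDerivWithinAt_le (f := fun t => (δ₂ - δ₁) * t) (f' := fun _ => δ₂ - δ₁)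
      (fun t _ => by simpa using (hasDerivWithinAt_id t _).const_mul (δ₂ - δ₁)) hbd hb₁
      (by simp [hy.1, hz.1]) hx
  have hfin := lt_of_hasDerivWithinAt_lt hd (f := fun _ => (0 : ℝ)) (f' := fun _ => 0)
    (fun t _ => hasDerivWithinAt_const _ _ _) hWd
    (fun t ht => by
      have ht' : t ∈ Icc 0 d := ⟨ht.1.le, ht.2.le⟩
      have h1 := hy0 t ht'
      have h2 := hz0 t ht'
      have h3 := ha t ht'
      have h4 := ha' t ht'
      have h5 := hb t ht'
      have h6 : 0 < (δ₂ - δ₁) * t := mul_pos (sub_pos.2 hδ) ht.1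
      have h7 : 0 < z t 2 - y t 2 := h6.trans_le h5
      have h8 : 0 < y t 2 + z t 2 := by linarith
      have h9 := (key t ht').1
      positivity)
    (by simp [hy.1, hz.1])
  linarith

/-- Two different slopes with ψ'(d) = 0 would make the strict Wronskian inequality read 0 < 0. -/
theorem symmetric_slope_unique {κ ε d δ₁ δ₂ : ℝ} (hκ : 0 < κ) (hε : 0 ≤ ε) (hd : 0 < d)
    (hδ₁ : 0 ≤ δ₁) (hδ₂ : 0 ≤ δ₂) {y z : ℝ → Fin 4 → ℝ}
    (hy : IsODESol (reField κ ε) 0 d ![1, 0, 0, δ₁] y)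
    (hz : IsODESol (reField κ ε) 0 d ![1, 0, 0, δ₂] z)
    (hy0 : ∀ x ∈ Icc 0 d, 0 < y x 0) (hz0 : ∀ x ∈ Icc 0 d, 0 < z x 0)
    (hyd : y d 1 = 0) (hzd : z d 1 = 0) : δ₁ = δ₂ := by
  rcases lt_trichotomy δ₁ δ₂ with h | h | h
  · simpa [hyd, hzd] using wronskian_pos_of_lt hκ hε hd hδ₁ h hy hz hy0 hz0
  · exact h
  · simpa [hyd, hzd] using wronskian_pos_of_lt hκ hε hd hδ₂ h hz hy hz0 hy0

/-! ### Existence of the symmetric slope by shooting. -/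

/-- Truncation of a real number to `[0, 1]`. -/
noncomputable def unitClamp (t : ℝ) : ℝ := max 0 (min 1 t)

theorem unitClamp_nonneg (t : ℝ) : 0 ≤ unitClamp t := le_max_left _ _

theorem unitClamp_le_one (t : ℝ) : unitClamp t ≤ 1 := max_le zero_le_one (min_le_left _ _)

theorem unitClamp_of_mem {t : ℝ} (h0 : 0 ≤ t) (h1 : t ≤ 1) : unitClamp t = t := by
  rw [unitClamp, min_eq_right h1, max_eq_right h0]

theorem unitClamp_of_nonpos {t : ℝ} (h : t ≤ 0) : unitClamp t = 0 := by
  rw [unitClamp, max_eq_left ((min_le_right _ _).trans h)]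

theorem unitClamp_le_abs (t : ℝ) : unitClamp t ≤ |t| :=
  max_le (abs_nonneg _) ((min_le_right _ _).trans (le_abs_self _))

theorem unitClamp_mono {s t : ℝ} (h : s ≤ t) : unitClamp s ≤ unitClamp t :=
  max_le_max le_rfl (min_le_min le_rfl h)

/-- The rescaled equations on `[0, d]` with the nonlinearity truncated to `0 ≤ ψ ≤ 1`. -/
structure IsClampedSol (κ ε d δ : ℝ) (y : ℝ → Fin 4 → ℝ) : Prop where
  init : y 0 = ![1, 0, 0, δ]
  deriv_zero : ∀ x ∈ Icc 0 d, HasDerivWithinAt (fun t => y t 0) (y x 1) (Icc 0 d) x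
  deriv_one : ∀ x ∈ Icc 0 d, HasDerivWithinAt (fun t => y t 1)
    (κ ^ 2 * unitClamp (y x 0) * (ε * unitClamp (y x 0) ^ 2 + y x 2 ^ 2 - 1)) (Icc 0 d) x
  deriv_two : ∀ x ∈ Icc 0 d, HasDerivWithinAt (fun t => y t 2) (y x 3) (Icc 0 d) x
  deriv_three : ∀ x ∈ Icc 0 d, HasDerivWithinAt (fun t => y t 3)
    (ε * unitClamp (y x 0) ^ 2 * y x 2) (Icc 0 d) x
  two_nonneg : ∀ x ∈ Icc 0 d, 0 ≤ y x 2
  le_three : ∀ x ∈ Icc 0 d, δ ≤ y x 3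
  two_le : ∀ x ∈ Icc 0 d, y x 2 ≤ δ * Real.exp x

/-- Shooting needs solutions on all of [0, d] depending continuously on δ, although the true
equation may blow up. Every component is truncated to a box to get a bounded Lipschitz field, and a
priori bounds show that only the truncation of ψ can be active. -/
theorem exists_isClampedSol {κ ε d δm : ℝ} (hε : 0 ≤ ε) (hε1 : ε ≤ 1) (hd : 0 ≤ d)
    (hδm : 0 ≤ δm) : ∃ Y : ℝ → ℝ → Fin 4 → ℝ, (∀ δ ∈ Icc 0 δm, IsClampedSol κ ε d δ (Y δ)) ∧
      Continuous (fun δ => Y δ d 1) := by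
  -- R bounds a ≤ δeˣ. C bounds both a' ≤ δ + Rx and |ψ'| ≤ κ²(2 + R²)d, the factor 2 + R²
  -- dominating |εψ² + a² - 1| after clamping.
  set R : ℝ := δm * Real.exp d with hR
  have hR0 : 0 ≤ R := by positivity
  set C : ℝ := δm + R * d + κ ^ 2 * (2 + R ^ 2) * d with hC
  have hC1 : δm + R * d ≤ C := le_add_of_nonneg_right (by positivity)
  have hC2 : κ ^ 2 * (2 + R ^ 2) * d ≤ C := le_add_of_nonneg_left (by positivity)
  have hC0 : 0 ≤ C := le_trans (by positivity) hC1
  obtain ⟨K, hK, hY⟩ := exists_isODESol_truncated (contDiff_reField κ ε)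
    (lo := ![0, -C, 0, 0]) (hi := ![1, C, R, C])
    (fun i => by fin_cases i <;> simp [hC0, hR0]) (le_refl (0 : ℝ)) hd
  choose Y hY using hY
  refine ⟨fun δ => Y ![1, 0, 0, δ], fun δ hδ => ?_, ?_⟩
  · set y := Y ![1, 0, 0, δ] with hy
    have hsol := hY ![1, 0, 0, δ]
    rw [← hy] at hsol
    have e0 : ∀ x, (![0, -C, 0, 0] ⊔ ![1, C, R, C] ⊓ y x) 0 = unitClamp (y x 0) := fun x => rfl
    have e1 : ∀ x, (![0, -C, 0, 0] ⊔ ![1, C, R, C] ⊓ y x) 1 = max (-C) (min C (y x 1)) :=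
      fun x => rfl
    have e2 : ∀ x, (![0, -C, 0, 0] ⊔ ![1, C, R, C] ⊓ y x) 2 = max 0 (min R (y x 2)) :=
      fun x => rfl
    have e3 : ∀ x, (![0, -C, 0, 0] ⊔ ![1, C, R, C] ⊓ y x) 3 = max 0 (min C (y x 3)) :=
      fun x => rfl
    have hd0 : ∀ x ∈ Icc 0 d, HasDerivWithinAt (fun t => y t 0) (max (-C) (min C (y x 1)))
        (Icc 0 d) x := fun x hx => hasDerivWithinAt_pi.1 (hsol.2 x hx) 0
    have hd1 : ∀ x ∈ Icc 0 d, HasDerivWithinAt (fun t => y t 1)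
        (κ ^ 2 * unitClamp (y x 0) * (ε * unitClamp (y x 0) ^ 2 +
          (max 0 (min R (y x 2))) ^ 2 - 1)) (Icc 0 d) x :=
      fun x hx => hasDerivWithinAt_pi.1 (hsol.2 x hx) 1
    have hd2 : ∀ x ∈ Icc 0 d, HasDerivWithinAt (fun t => y t 2) (max 0 (min C (y x 3)))
        (Icc 0 d) x := fun x hx => hasDerivWithinAt_pi.1 (hsol.2 x hx) 2
    have hd3 : ∀ x ∈ Icc 0 d, HasDerivWithinAt (fun t => y t 3)
        (ε * unitClamp (y x 0) ^ 2 * max 0 (min R (y x 2))) (Icc 0 d) x :=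
      fun x hx => hasDerivWithinAt_pi.1 (hsol.2 x hx) 3
    have i0 : y 0 = ![1, 0, 0, δ] := hsol.1
    have hm0 := fun x => unitClamp_nonneg (y x 0)
    have hm1 := fun x => unitClamp_le_one (y x 0)
    have hmsq : ∀ x, ε * unitClamp (y x 0) ^ 2 ≤ 1 := fun x =>
      mul_le_one₀ hε1 (by positivity) (pow_le_one₀ (hm0 x) (hm1 x))
    have ha0 : ∀ x, 0 ≤ max 0 (min R (y x 2)) := fun x => le_max_left _ _
    have haR : ∀ x, max 0 (min R (y x 2)) ≤ R := fun x => max_le hR0 (min_le_left _ _)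
    have w1 : ∀ x ∈ Icc 0 d, δ ≤ y x 3 := fun x hx =>
      le_of_hasDerivWithinAt_le (f := fun _ => δ) (f' := fun _ => 0)
        (fun _ _ => hasDerivWithinAt_const _ _ _) hd3
        (fun t _ => mul_nonneg (by positivity) (ha0 t)) (by simp [i0]) hx
    have w2 : ∀ x ∈ Icc 0 d, y x 3 ≤ δ + R * x := fun x hx =>
      le_of_hasDerivWithinAt_le (g := fun t => δ + R * t) (g' := fun _ => R) hd3
        (fun t _ => by
          simpa using ((hasDerivWithinAt_id t _).const_mul R).const_add δ)
        (fun t _ => (mul_le_of_le_one_left (ha0 t) (hmsq t)).trans (haR t)) (by simp [i0]) hx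
    have w3 : ∀ x ∈ Icc 0 d, max 0 (min C (y x 3)) = y x 3 := fun x hx => by
      have h1 := w1 x hx
      have h2 := w2 x hx
      have h3 : R * x ≤ R * d := by gcongr; exact hx.2
      rw [min_eq_right (by linarith [hδ.2]), max_eq_right (by linarith [hδ.1])]
    have a1 : ∀ x ∈ Icc 0 d, 0 ≤ y x 2 := fun x hx =>
      le_of_hasDerivWithinAt_le (f := fun _ => 0) (f' := fun _ => 0)
        (fun _ _ => hasDerivWithinAt_const _ _ _) hd2 (fun t _ => le_max_left _ _)
        (by simp [i0]) hx
    -- Since a'' ≤ a, the quantity (a + a')e⁻ˣ is nonincreasing, with initial value δ.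
    have a2 : ∀ x ∈ Icc 0 d, (y x 2 + y x 3) * Real.exp (-x) ≤ δ := fun x hx =>
      le_of_hasDerivWithinAt_le (g := fun _ => δ) (g' := fun _ => 0)
        (fun t ht => ((hd2 t ht).add (hd3 t ht)).mul
          ((hasDerivAt_neg t).exp.hasDerivWithinAt (s := Icc 0 d)))
        (fun _ _ => hasDerivWithinAt_const _ _ _)
        (fun t ht => by
          have h1 : ε * unitClamp (y t 0) ^ 2 * max 0 (min R (y t 2)) ≤ y t 2 :=
            (mul_le_of_le_one_left (ha0 t) (hmsq t)).trans (max_le (a1 t ht) (min_le_right _ _))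
          have h2 := Real.exp_pos (-t)
          rw [w3 t ht]
          simp only [Pi.add_apply]
          nlinarith) (by simp [i0]) hx
    have a3 : ∀ x ∈ Icc 0 d, y x 2 ≤ δ * Real.exp x := fun x hx => by
      have h1 := a2 x hx
      rw [Real.exp_neg, ← div_eq_mul_inv, div_le_iff₀ (Real.exp_pos _)] at h1
      linarith [w1 x hx, hδ.1]
    have a4 : ∀ x ∈ Icc 0 d, max 0 (min R (y x 2)) = y x 2 := fun x hx => by
      have h1 : δ * Real.exp x ≤ R := by
        have := hδ.2
        have := hx.2
        rw [hR]; gcongr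
      rw [min_eq_right ((a3 x hx).trans h1), max_eq_right (a1 x hx)]
    have u1 : ∀ x ∈ Icc 0 d, |y x 1| ≤ κ ^ 2 * (2 + R ^ 2) * d := fun x hx => by
      have hB : ∀ t, |κ ^ 2 * unitClamp (y t 0) * (ε * unitClamp (y t 0) ^ 2 +
          (max 0 (min R (y t 2))) ^ 2 - 1)| ≤ κ ^ 2 * (2 + R ^ 2) := fun t => by
        rw [abs_mul, abs_of_nonneg (mul_nonneg (sq_nonneg κ) (hm0 t))]
        have h1 : (max 0 (min R (y t 2))) ^ 2 ≤ R ^ 2 :=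
          pow_le_pow_left₀ (ha0 t) (haR t) 2
        have h2 : |ε * unitClamp (y t 0) ^ 2 + (max 0 (min R (y t 2))) ^ 2 - 1| ≤ 2 + R ^ 2 := by
          have h3 := hmsq t
          have h4 : 0 ≤ ε * unitClamp (y t 0) ^ 2 := by positivity
          have h5 := sq_nonneg (max 0 (min R (y t 2)))
          rw [abs_le]; constructor <;> linarith
        have h3 : κ ^ 2 * unitClamp (y t 0) ≤ κ ^ 2 :=
          mul_le_of_le_one_right (sq_nonneg _) (hm1 t)
        gcongr
      have h1 := (convex_Icc 0 d).norm_image_sub_le_of_norm_hasDerivWithin_le hd1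
        (fun t _ => hB t) ⟨le_rfl, hd⟩ hx
      rw [i0] at h1
      simp only [Matrix.cons_val_one, Matrix.cons_val_zero, sub_zero, Real.norm_eq_abs] at h1
      refine h1.trans ?_
      rw [abs_of_nonneg hx.1]
      gcongr
      exact hx.2
    have u2 : ∀ x ∈ Icc 0 d, max (-C) (min C (y x 1)) = y x 1 := fun x hx => by
      obtain ⟨h1, h2⟩ := abs_le.1 ((u1 x hx).trans hC2)
      rw [min_eq_right h2, max_eq_right h1]
    exact
      { init := i0
        deriv_zero := fun x hx => (hd0 x hx).congr_deriv (u2 x hx)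
        deriv_one := fun x hx => (hd1 x hx).congr_deriv (by rw [a4 x hx])
        deriv_two := fun x hx => (hd2 x hx).congr_deriv (w3 x hx)
        deriv_three := fun x hx => (hd3 x hx).congr_deriv (by rw [a4 x hx])
        two_nonneg := a1
        le_three := w1
        two_le := a3 }
  · have hl : ∀ δ δ' : ℝ, |Y ![1, 0, 0, δ] d 1 - Y ![1, 0, 0, δ'] d 1| ≤
        |δ - δ'| * Real.exp (K * d) := fun δ δ' => by
      have h1 := norm_le_gronwallBound_of_nonneg (b := d) (δ := |δ - δ'|) (K := K) (ε := 0)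
        (fun t ht => ((hY ![1, 0, 0, δ]).2 t ht).sub ((hY ![1, 0, 0, δ']).2 t ht))
        (by
          simp only [Pi.sub_apply]
          rw [(hY ![1, 0, 0, δ]).1, (hY ![1, 0, 0, δ']).1, pi_norm_le_iff_of_nonneg (abs_nonneg _)]
          intro i
          fin_cases i <;> simp)
        (fun t _ => by
          rw [add_zero, ← dist_eq_norm, Pi.sub_apply, ← dist_eq_norm]
          exact hK.dist_le_mul _ _) (x := d) ⟨hd, le_rfl⟩
      rw [gronwallBound_ε0] at h1
      exact (norm_le_pi_norm (Y ![1, 0, 0, δ] d - Y ![1, 0, 0, δ'] d) 1).trans h1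
    refine LipschitzWith.continuous (K := ⟨Real.exp (K * d), (Real.exp_pos _).le⟩)
      (LipschitzWith.of_dist_le_mul fun δ δ' => ?_)
    rw [Real.dist_eq, Real.dist_eq, mul_comm]
    exact hl δ δ'

section Clamped

variable {κ ε d δ : ℝ} {y : ℝ → Fin 4 → ℝ}

theorem IsClampedSol.continuousOn (h : IsClampedSol κ ε d δ y) (i : Fin 4) :
    ContinuousOn (fun t => y t i) (Icc 0 d) := by
  intro x hx
  fin_cases i
  · exact (h.deriv_zero x hx).continuousWithinAt
  · exact (h.deriv_one x hx).continuousWithinAt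
  · exact (h.deriv_two x hx).continuousWithinAt
  · exact (h.deriv_three x hx).continuousWithinAt

theorem IsClampedSol.two_mono (h : IsClampedSol κ ε d δ y) (hδ : 0 ≤ δ) :
    MonotoneOn (fun t => y t 2) (Icc 0 d) :=
  monotoneOn_of_hasDerivWithinAt_nonneg (convex_Icc _ _) (h.continuousOn 2)
    (fun x hx => (h.deriv_two x (interior_subset hx)).mono interior_subset)
    (fun x hx => hδ.trans (h.le_three x (interior_subset hx)))

/-- Once `ψ'` is positive it stays positive. -/
theorem IsClampedSol.one_pos_end (h : IsClampedSol κ ε d δ y) (hε : 0 ≤ ε) (hδ : 0 ≤ δ)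
    {x₁ : ℝ} (hx₁ : x₁ ∈ Icc 0 d) (hpos : 0 < y x₁ 1) : 0 < y d 1 := by
  by_contra hle
  rw [not_lt] at hle
  have hc := h.continuousOn 1
  -- Between the last point l before x₁ and the first point r after it where ψ' ≤ 0, the mean value
  -- theorem gives s < t with ψ''(s) > 0 > ψ''(t). But ψ and a increase on [l, r], so the bracket
  -- fixing the sign of ψ'' cannot drop from positive to negative.
  obtain ⟨l, ⟨hl, hl0⟩, hlmax⟩ : ∃ l, IsGreatest {x ∈ Icc 0 x₁ | y x 1 ≤ 0} l :=
    (isCompact_Icc.of_isClosed_subset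
      ((hc.mono (Icc_subset_Icc le_rfl hx₁.2)).preimage_isClosed_of_isClosed isClosed_Icc
        isClosed_Iic) (fun t ht => ht.1)).exists_isGreatest
      ⟨0, ⟨le_rfl, hx₁.1⟩, by simp [h.init]⟩
  obtain ⟨r, ⟨hr, hr0⟩, hrmin⟩ : ∃ r, IsLeast {x ∈ Icc x₁ d | y x 1 ≤ 0} r :=
    (isCompact_Icc.of_isClosed_subset
      ((hc.mono (Icc_subset_Icc hx₁.1 le_rfl)).preimage_isClosed_of_isClosed isClosed_Icc
        isClosed_Iic) (fun t ht => ht.1)).exists_isLeast ⟨d, ⟨hx₁.2, le_rfl⟩, hle⟩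
  have hlx : l < x₁ := lt_of_le_of_ne hl.2 (by rintro rfl; linarith)
  have hxr : x₁ < r := lt_of_le_of_ne hr.1 (by rintro rfl; linarith)
  have hin : ∀ t ∈ Ioo l r, 0 < y t 1 := by
    intro t ht
    by_contra hneg
    rw [not_lt] at hneg
    rcases le_total t x₁ with h1 | h1
    · exact absurd (hlmax ⟨⟨hl.1.trans ht.1.le, h1⟩, hneg⟩) (not_le.2 ht.1)
    · exact absurd (hrmin ⟨⟨h1, ht.2.le.trans hr.2⟩, hneg⟩) (not_le.2 ht.2)
  have hsub : Icc l r ⊆ Icc 0 d := Icc_subset_Icc hl.1 hr.2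
  have hderiv : ∀ t ∈ Ioo l r, HasDerivAt (fun t => y t 1)
      (κ ^ 2 * unitClamp (y t 0) * (ε * unitClamp (y t 0) ^ 2 + y t 2 ^ 2 - 1)) t :=
    fun t ht => (h.deriv_one t (hsub (Ioo_subset_Icc_self ht))).hasDerivAt
      (Icc_mem_nhds (hl.1.trans_lt ht.1) (ht.2.trans_le hr.2))
  obtain ⟨s, hs, hs'⟩ := exists_hasDerivAt_eq_slope (fun t => y t 1) _ hlx
    (hc.mono ((Icc_subset_Icc le_rfl hxr.le).trans hsub))
    (fun t ht => hderiv t ⟨ht.1, ht.2.trans hxr⟩)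
  obtain ⟨t, ht, ht'⟩ := exists_hasDerivAt_eq_slope (fun t => y t 1) _ hxr
    (hc.mono ((Icc_subset_Icc hlx.le le_rfl).trans hsub))
    (fun t ht => hderiv t ⟨hlx.trans ht.1, ht.2⟩)
  have hsd : s ∈ Icc 0 d := hsub ⟨hs.1.le, (hs.2.trans hxr).le⟩
  have htd : t ∈ Icc 0 d := hsub ⟨(hlx.trans ht.1).le, ht.2.le⟩
  have hst : s ≤ t := (hs.2.trans ht.1).le
  have h1 : 0 < κ ^ 2 * unitClamp (y s 0) * (ε * unitClamp (y s 0) ^ 2 + y s 2 ^ 2 - 1) := by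
    rw [hs']; apply div_pos <;> linarith
  have h2 : κ ^ 2 * unitClamp (y t 0) * (ε * unitClamp (y t 0) ^ 2 + y t 2 ^ 2 - 1) < 0 := by
    rw [ht']; apply div_neg_of_neg_of_pos <;> linarith
  have hk : ∀ x, 0 ≤ κ ^ 2 * unitClamp (y x 0) := fun x =>
    mul_nonneg (sq_nonneg _) (unitClamp_nonneg _)
  have h3 := pos_of_mul_pos_right h1 (hk s)
  have h4 := neg_of_mul_neg_right h2 (hk t)
  have hψ : y s 0 ≤ y t 0 := by
    have hm : MonotoneOn (fun t => y t 0) (Icc l r) :=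
      monotoneOn_of_hasDerivWithinAt_nonneg (convex_Icc _ _) ((h.continuousOn 0).mono hsub)
        (fun x hx => (h.deriv_zero x (hsub (interior_subset hx))).mono
          (interior_subset.trans hsub))
        (fun x hx => (hin x (by rwa [interior_Icc] at hx)).le)
    exact hm ⟨hs.1.le, (hs.2.trans hxr).le⟩ ⟨(hlx.trans ht.1).le, ht.2.le⟩ hst
  have ha : y s 2 ≤ y t 2 := h.two_mono hδ hsd htd hst
  have h5 : y s 2 ^ 2 ≤ y t 2 ^ 2 := pow_le_pow_left₀ (h.two_nonneg s hsd) ha 2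
  have h6 : unitClamp (y s 0) ^ 2 ≤ unitClamp (y t 0) ^ 2 :=
    pow_le_pow_left₀ (unitClamp_nonneg _) (unitClamp_mono hψ) 2
  have h7 : ε * unitClamp (y s 0) ^ 2 ≤ ε * unitClamp (y t 0) ^ 2 := by gcongr
  linarith

/-- With zero slope a vanishes, the bracket is at most ε - 1 < 0, and ψ' is nonincreasing; it
becomes strictly negative at once because ψ > 0 near 0. -/
theorem IsClampedSol.one_neg_of_slope_zero (h : IsClampedSol κ ε d 0 y) (hκ : 0 < κ)
    (hε : 0 ≤ ε) (hε1 : ε < 1) (hd : 0 < d) : y d 1 < 0 := by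
  have ha : ∀ x ∈ Icc 0 d, y x 2 = 0 := fun x hx =>
    le_antisymm (by simpa using h.two_le x hx) (h.two_nonneg x hx)
  have hm1 : ∀ x, ε * unitClamp (y x 0) ^ 2 ≤ ε := fun x =>
    mul_le_of_le_one_right hε (pow_le_one₀ (unitClamp_nonneg _) (unitClamp_le_one _))
  have hk : ∀ x, 0 ≤ κ ^ 2 * unitClamp (y x 0) := fun x =>
    mul_nonneg (sq_nonneg _) (unitClamp_nonneg _)
  have hle : ∀ x ∈ Icc 0 d, κ ^ 2 * unitClamp (y x 0) *
      (ε * unitClamp (y x 0) ^ 2 + y x 2 ^ 2 - 1) ≤ κ ^ 2 * unitClamp (y x 0) * (ε - 1) :=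
    fun x hx => mul_le_mul_of_nonneg_left (by rw [ha x hx]; linarith [hm1 x]) (hk x)
  obtain ⟨t, ht, htψ⟩ : ∃ t ∈ Ioc 0 d, ∀ x ∈ Icc 0 t, 0 < y x 0 := by
    have h0 : ContinuousWithinAt (fun t => y t 0) (Icc 0 d) 0 :=
      h.continuousOn 0 0 ⟨le_rfl, hd.le⟩
    have h1 : ∀ᶠ x in 𝓝[Icc 0 d] 0, 0 < y x 0 :=
      h0.eventually (lt_mem_nhds (by simp [h.init]))
    rw [eventually_nhdsWithin_iff, Metric.eventually_nhds_iff] at h1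
    obtain ⟨η, hη, h2⟩ := h1
    refine ⟨min d (η / 2), ⟨lt_min hd (by linarith), min_le_left _ _⟩, fun x hx => ?_⟩
    refine h2 ?_ ⟨hx.1, hx.2.trans (min_le_left _ _)⟩
    have := hx.2.trans (min_le_right _ _)
    rw [Real.dist_eq, sub_zero, abs_of_nonneg hx.1]; linarith
  have hsub : Icc 0 t ⊆ Icc 0 d := Icc_subset_Icc le_rfl ht.2
  have h1 : y t 1 < 0 :=
    lt_of_hasDerivWithinAt_lt ht.1 (g := fun _ => 0) (g' := fun _ => 0)
      (fun x hx => (h.deriv_one x (hsub hx)).mono hsub)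
      (fun _ _ => hasDerivWithinAt_const _ _ _)
      (fun x hx => (hle x (hsub (Ioo_subset_Icc_self hx))).trans_lt
        (mul_neg_of_pos_of_neg (mul_pos (by positivity)
          (lt_max_of_lt_right (lt_min one_pos (htψ x (Ioo_subset_Icc_self hx))))) (by linarith)))
      (by simp [h.init])
  have hanti : AntitoneOn (fun t => y t 1) (Icc 0 d) :=
    antitoneOn_of_hasDerivWithinAt_nonpos (convex_Icc _ _) (h.continuousOn 1)
      (fun x hx => (h.deriv_one x (interior_subset hx)).mono interior_subset)
      (fun x hx => (hle x (interior_subset hx)).trans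
        (mul_nonpos_of_nonneg_of_nonpos (hk x) (by linarith)))
  exact (hanti (hsub ⟨ht.1.le, le_rfl⟩) ⟨hd.le, le_rfl⟩ ht.2).trans_lt h1

/-- On [0, x₁] with κx₁ ≤ 1 one has ψ ≥ 1/2 and a ≥ δx, so integrating ψ'' gives ψ'(x₁) ≥
κ²x₁((δx₁)²/6 - 1). This explains the 6; positivity then persists up to d. -/
theorem IsClampedSol.one_pos_of_slope_large (h : IsClampedSol κ ε d δ y) (hκ : 0 < κ)
    (hε : 0 ≤ ε) (hδ : 0 ≤ δ) (hd : 0 < d) (hlarge : 6 < (δ * min d (1 / κ)) ^ 2) :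
    0 < y d 1 := by
  set x₁ := min d (1 / κ) with hx₁
  have hx0 : 0 < x₁ := lt_min hd (by positivity)
  have hxd : x₁ ≤ d := min_le_left _ _
  have hxκ : κ * x₁ ≤ 1 := by
    calc κ * x₁ ≤ κ * (1 / κ) := by gcongr; exact min_le_right _ _
      _ = 1 := by field_simp
  have hsub : Icc 0 x₁ ⊆ Icc 0 d := Icc_subset_Icc le_rfl hxd
  have a1 : ∀ x ∈ Icc 0 x₁, δ * x ≤ y x 2 := fun x hx =>
    le_of_hasDerivWithinAt_le (f := fun t => δ * t) (f' := fun _ => δ)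
      (fun t _ => by simpa using (hasDerivWithinAt_id t _).const_mul δ) h.deriv_two h.le_three
      (by simp [h.init]) (hsub hx)
  have u1 : ∀ x ∈ Icc 0 x₁, -κ ^ 2 * x ≤ y x 1 := fun x hx =>
    le_of_hasDerivWithinAt_le (f := fun t => -κ ^ 2 * t) (f' := fun _ => -κ ^ 2)
      (fun t _ => by simpa using (hasDerivWithinAt_id t _).const_mul (-κ ^ 2)) h.deriv_one
      (fun t _ => by
        have h1 := unitClamp_nonneg (y t 0)
        have h2 := unitClamp_le_one (y t 0)
        have h3 : 0 ≤ ε * unitClamp (y t 0) ^ 2 + y t 2 ^ 2 := by positivity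
        have h4 : 0 ≤ κ ^ 2 * unitClamp (y t 0) * (ε * unitClamp (y t 0) ^ 2 + y t 2 ^ 2) := by
          positivity
        nlinarith [sq_nonneg κ])
      (by simp [h.init]) (hsub hx)
  have p1 : ∀ x ∈ Icc 0 x₁, 1 - κ ^ 2 * x ^ 2 / 2 ≤ y x 0 := fun x hx =>
    le_of_hasDerivWithinAt_le (f := fun t => 1 - κ ^ 2 * t ^ 2 / 2) (f' := fun t => -κ ^ 2 * t)
      (fun t _ => by
        refine HasDerivAt.hasDerivWithinAt ?_
        refine ((((hasDerivAt_id t).pow 2).const_mul (κ ^ 2)).div_const 2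
          |>.const_sub 1).congr_deriv ?_
        simp; ring)
      (fun t ht => (h.deriv_zero t (hsub ht)).mono hsub) u1 (by simp [h.init]) hx
  have m1 : ∀ x ∈ Icc 0 x₁, 1 / 2 ≤ unitClamp (y x 0) := fun x hx => by
    have h1 := p1 x hx
    have h2 : κ * x ≤ 1 := (mul_le_mul_of_nonneg_left hx.2 hκ.le).trans hxκ
    have h3 : 0 ≤ κ * x := mul_nonneg hκ.le hx.1
    have h4 : κ ^ 2 * x ^ 2 ≤ 1 := by nlinarith
    exact le_max_of_le_right (le_min (by norm_num) (by linarith))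
  have u2 : κ ^ 2 * (δ ^ 2 * x₁ ^ 3 / 6 - x₁) ≤ y x₁ 1 :=
    le_of_hasDerivWithinAt_le (f := fun t => κ ^ 2 * (δ ^ 2 * t ^ 3 / 6 - t))
      (f' := fun t => κ ^ 2 * (δ ^ 2 * t ^ 2 / 2 - 1))
      (fun t _ => by
        refine HasDerivAt.hasDerivWithinAt ?_
        refine (((((hasDerivAt_id t).pow 3).const_mul (δ ^ 2)).div_const 6
          |>.sub (hasDerivAt_id t)).const_mul (κ ^ 2)).congr_deriv ?_
        simp [-mul_eq_mul_left_iff]; ring)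
      (fun t ht => (h.deriv_one t (hsub ht)).mono hsub)
      (fun t ht => by
        have h1 := m1 t ht
        have h2 := unitClamp_le_one (y t 0)
        have h3 : (δ * t) ^ 2 ≤ y t 2 ^ 2 :=
          pow_le_pow_left₀ (mul_nonneg hδ ht.1) (a1 t ht) 2
        rw [mul_assoc]
        refine mul_le_mul_of_nonneg_left ?_ (sq_nonneg κ)
        have h4 : 0 ≤ unitClamp (y t 0) * (ε * unitClamp (y t 0) ^ 2) := by
          have := unitClamp_nonneg (y t 0); positivity
        have h5 : δ ^ 2 * t ^ 2 / 2 ≤ unitClamp (y t 0) * y t 2 ^ 2 := by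
          nlinarith [sq_nonneg (y t 2)]
        nlinarith)
      (by simp [h.init]) ⟨hx0.le, le_rfl⟩
  refine h.one_pos_end hε hδ ⟨hx0.le, hxd⟩ (lt_of_lt_of_le ?_ u2)
  have : δ ^ 2 * x₁ ^ 3 / 6 - x₁ = x₁ * ((δ * x₁) ^ 2 / 6 - 1) := by ring
  rw [this]
  have : 0 < (δ * x₁) ^ 2 / 6 - 1 := by linarith
  positivity

/-- If `ψ'(d) = 0` the truncation is inactive. -/
theorem IsClampedSol.isODESol (h : IsClampedSol κ ε d δ y) (hε : 0 ≤ ε)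
    (hε1 : ε ≤ 1) (hδ : 0 ≤ δ) (hd : 0 < d) (hyd : y d 1 = 0) :
    IsODESol (reField κ ε) 0 d ![1, 0, 0, δ] y ∧ ∀ x ∈ Icc 0 d, 0 < y x 0 := by
  -- A positive ψ' anywhere would persist to d, so ψ is nonincreasing and never exceeds 1.
  have hu : ∀ x ∈ Icc 0 d, y x 1 ≤ 0 := fun x hx => by
    by_contra hcon
    exact absurd (h.one_pos_end hε hδ hx (not_le.1 hcon)) (by simp [hyd])
  have hanti : AntitoneOn (fun t => y t 0) (Icc 0 d) :=
    antitoneOn_of_hasDerivWithinAt_nonpos (convex_Icc _ _) (h.continuousOn 0)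
      (fun x hx => (h.deriv_zero x (interior_subset hx)).mono interior_subset)
      (fun x hx => hu x (interior_subset hx))
  have h0d : (0 : ℝ) ∈ Icc 0 d := ⟨le_rfl, hd.le⟩
  have hψ1 : ∀ x ∈ Icc 0 d, y x 0 ≤ 1 := fun x hx => by
    simpa [h.init] using hanti h0d hx hx.1
  -- If ψ vanished at x₀, the clamped right-hand side would be zero beyond x₀, so ψ'(x₀) = ψ'(d) =
  -- 0. Backward Grönwall from x₀ would then force ψ = 0 on [0, x₀], contradicting ψ(0) = 1.
  have hψ : ∀ x ∈ Icc 0 d, 0 < y x 0 := by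
    by_contra hcon
    push Not at hcon
    obtain ⟨x₂, hx₂, hneg⟩ := hcon
    obtain ⟨x₀, hx₀, hz⟩ : ∃ x₀ ∈ Icc 0 x₂, y x₀ 0 = 0 :=
      intermediate_value_Icc' hx₂.1 ((h.continuousOn 0).mono (Icc_subset_Icc le_rfl hx₂.2))
        ⟨hneg, by simp [h.init]⟩
    have hx₀d : x₀ ∈ Icc 0 d := ⟨hx₀.1, hx₀.2.trans hx₂.2⟩
    have hu0 : y x₀ 1 = 0 := by
      have hsub : Icc x₀ d ⊆ Icc 0 d := Icc_subset_Icc hx₀.1 le_rfl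
      refine le_antisymm (hu x₀ hx₀d) ?_
      have := le_of_hasDerivWithinAt_le (f := fun t => y t 1) (f' := fun _ => 0)
        (g := fun _ => y x₀ 1) (g' := fun _ => 0) (a := x₀) (b := d)
        (fun t ht => ((h.deriv_one t (hsub ht)).mono hsub).congr_deriv (by
          have : y t 0 ≤ 0 := hz ▸ hanti hx₀d (hsub ht) ht.1
          rw [unitClamp_of_nonpos this]; ring))
        (fun _ _ => hasDerivWithinAt_const _ _ _) (fun _ _ => le_rfl) le_rfl
        (x := d) ⟨hx₀d.2, le_rfl⟩
      linarith
    obtain ⟨B, hB⟩ := isCompact_Icc.exists_bound_of_continuousOn (h.continuousOn 2)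
    have hrev : ∀ t ∈ Icc 0 x₀, HasDerivWithinAt
        (fun s => ((y (x₀ - s) 0, y (x₀ - s) 1) : ℝ × ℝ))
        (-y (x₀ - t) 1, -(κ ^ 2 * unitClamp (y (x₀ - t) 0) *
          (ε * unitClamp (y (x₀ - t) 0) ^ 2 + y (x₀ - t) 2 ^ 2 - 1))) (Icc 0 x₀) t := by
      intro t ht
      have hm : x₀ - t ∈ Icc 0 d := ⟨by linarith [ht.2], by linarith [ht.1, hx₀d.2]⟩
      have hsub : MapsTo (fun s => x₀ - s) (Icc 0 x₀) (Icc 0 d) := fun s hs =>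
        ⟨by linarith [hs.2], by linarith [hs.1, hx₀d.2]⟩
      have hd' : HasDerivWithinAt (fun s => x₀ - s) (-1) (Icc 0 x₀) t := by
        simpa using (hasDerivWithinAt_id t (Icc 0 x₀)).const_sub x₀
      have h1 := (h.deriv_zero _ hm).scomp t hd' hsub
      have h2 := (h.deriv_one _ hm).scomp t hd' hsub
      simpa [Function.comp_def] using h1.prodMk h2
    have hbound := norm_le_gronwallBound_of_nonneg (δ := 0) (ε := 0)
      (K := max 1 (κ ^ 2 * (1 + B ^ 2 + 1))) hrev (by simp [hz, hu0])
      (fun t ht => by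
        have hm : x₀ - t ∈ Icc 0 d := ⟨by linarith [ht.2], by linarith [ht.1, hx₀d.2]⟩
        set s := x₀ - t
        rw [add_zero, Prod.norm_def, Prod.norm_def, norm_neg, norm_neg]
        refine max_le ?_ ?_
        · calc ‖y s 1‖ ≤ 1 * max ‖y s 0‖ ‖y s 1‖ := by rw [one_mul]; exact le_max_right _ _
            _ ≤ _ := by gcongr; exact le_max_left _ _
        · have hm0 := unitClamp_nonneg (y s 0)
          have h1 : ε * unitClamp (y s 0) ^ 2 ≤ 1 :=
            mul_le_one₀ hε1 (by positivity) (pow_le_one₀ hm0 (unitClamp_le_one _))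
          have h2 : 0 ≤ ε * unitClamp (y s 0) ^ 2 := by positivity
          have h3 : y s 2 ^ 2 ≤ B ^ 2 := by
            have := hB s hm
            rw [Real.norm_eq_abs] at this
            exact sq_le_sq' (abs_le.1 this).1 (abs_le.1 this).2
          have h4 : |ε * unitClamp (y s 0) ^ 2 + y s 2 ^ 2 - 1| ≤ 1 + B ^ 2 + 1 := by
            rw [abs_le]; constructor <;> nlinarith [sq_nonneg (y s 2), sq_nonneg B]
          calc ‖κ ^ 2 * unitClamp (y s 0) * (ε * unitClamp (y s 0) ^ 2 + y s 2 ^ 2 - 1)‖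
              = κ ^ 2 * |ε * unitClamp (y s 0) ^ 2 + y s 2 ^ 2 - 1| * unitClamp (y s 0) := by
                rw [Real.norm_eq_abs, abs_mul, abs_of_nonneg (mul_nonneg (sq_nonneg κ) hm0)]
                ring
            _ ≤ κ ^ 2 * (1 + B ^ 2 + 1) * max ‖y s 0‖ ‖y s 1‖ := by
                gcongr
                exact (unitClamp_le_abs _).trans (le_max_left _ _)
            _ ≤ _ := by gcongr; exact le_max_right _ _) (x := x₀) ⟨hx₀.1, le_rfl⟩
    rw [gronwallBound_ε0_δ0] at hbound
    have := congrArg Prod.fst (norm_le_zero_iff.1 hbound)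
    simp [h.init] at this
  refine ⟨⟨h.init, fun x hx => ?_⟩, hψ⟩
  have hm : unitClamp (y x 0) = y x 0 := unitClamp_of_mem (hψ x hx).le (hψ1 x hx)
  rw [hasDerivWithinAt_pi]
  intro i
  fin_cases i
  · exact h.deriv_zero x hx
  · exact (h.deriv_one x hx).congr_deriv (by rw [hm]; rfl)
  · exact h.deriv_two x hx
  · exact (h.deriv_three x hx).congr_deriv (by rw [hm]; rfl)

end Clamped

/-- Existence of the symmetric branch. -/
theorem exists_symmetric_slope {κ ε d : ℝ} (hκ : 0 < κ) (hε : 0 ≤ ε) (hε1 : ε < 1) (hd : 0 < d) :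
    ∃ δ, 0 < δ ∧ ∃ y, IsODESol (reField κ ε) 0 d ![1, 0, 0, δ] y ∧ (∀ x ∈ Icc 0 d, 0 < y x 0) ∧
      y d 1 = 0 := by
  have hx1 : 0 < min d (1 / κ) := lt_min hd (by positivity)
  -- The numerator 3 makes (δm · min d (1/κ))² = 9 > 6.
  set δm := 3 / min d (1 / κ) with hδm
  have hδm0 : 0 ≤ δm := by positivity
  obtain ⟨Y, hY, hYc⟩ := exists_isClampedSol (κ := κ) hε hε1.le hd.le hδm0
  have h0 := (hY 0 ⟨le_rfl, hδm0⟩).one_neg_of_slope_zero hκ hε hε1 hd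
  have h1 := (hY δm ⟨hδm0, le_rfl⟩).one_pos_of_slope_large hκ hε hδm0 hd
    (by rw [hδm, div_mul_cancel₀ _ hx1.ne']; norm_num)
  obtain ⟨δ, hδ, hδ0⟩ : ∃ δ ∈ Icc 0 δm, Y δ d 1 = 0 :=
    intermediate_value_Icc hδm0 hYc.continuousOn ⟨h0.le, h1.le⟩
  have hpos : 0 < δ := lt_of_le_of_ne hδ.1 (by rintro rfl; linarith)
  obtain ⟨h2, h3⟩ := (hY δ hδ).isODESol hε hε1.le hδ.1 hd hδ0
  exact ⟨δ, hpos, Y δ, h2, h3, hδ0⟩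

/-! ### Derivatives of the flow, parity, and the factorization of J. -/

/-- The derivative of the Ginzburg–Landau field at `y`, applied to `Y`. -/
def glLin (κ : ℝ) (y Y : Fin 4 → ℝ) : Fin 4 → ℝ :=
  ![Y 1, κ ^ 2 * (3 * y 0 ^ 2 + y 2 ^ 2 - 1) * Y 0 + 2 * κ ^ 2 * y 0 * y 2 * Y 2, Y 3,
    y 0 ^ 2 * Y 2 + 2 * y 0 * y 2 * Y 0]

theorem contDiff_glField (κ : ℝ) {n : WithTop ℕ∞} : ContDiff ℝ n (glField κ) := by
  rw [glField_eq_reField]; exact contDiff_reField κ 1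

theorem contDiff_glLin (κ : ℝ) {n : WithTop ℕ∞} :
    ContDiff ℝ n (fun z : (Fin 4 → ℝ) × (Fin 4 → ℝ) => glLin κ z.1 z.2) := by
  rw [contDiff_pi]
  intro i
  fin_cases i <;> simp only [glLin] <;> simp <;> fun_prop

/-- Compares two computations of the derivative along the line t ↦ y + tY, which avoids assembling
the continuous linear map by hand. -/
theorem fderiv_glField (κ : ℝ) (y Y : Fin 4 → ℝ) : fderiv ℝ (glField κ) y Y = glLin κ y Y := by
  have hline : HasDerivAt (fun t : ℝ => y + t • Y) Y 0 := by
    simpa using ((hasDerivAt_id (0 : ℝ)).smul_const Y).const_add y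
  have h1 : HasDerivAt (fun t : ℝ => glField κ (y + t • Y)) (fderiv ℝ (glField κ) y Y) 0 := by
    have h : HasFDerivAt (glField κ) (fderiv ℝ (glField κ) y) (y + (0 : ℝ) • Y) := by
      rw [zero_smul, add_zero]
      exact ((contDiff_glField κ (n := 1)).differentiable one_ne_zero y).hasFDerivAt
    exact h.comp_hasDerivAt 0 hline
  have hc : ∀ i, HasDerivAt (fun t : ℝ => y i + t * Y i) (Y i) 0 := fun i =>
    hasDerivAt_pi.1 hline i
  have h2 : HasDerivAt (fun t : ℝ => glField κ (y + t • Y)) (glLin κ y Y) 0 := by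
    rw [hasDerivAt_pi]
    intro i
    fin_cases i
    · exact hc 1
    · refine (((hc 0).const_mul (κ ^ 2)).mul
        ((((hc 0).pow 2).add ((hc 2).pow 2)).sub_const 1)).congr_deriv ?_
      simp [glLin]
      ring
    · exact hc 3
    · refine (((hc 0).pow 2).mul (hc 2)).congr_deriv ?_
      simp [glLin]
      ring
  exact h1.unique h2

theorem isODESol_glFlow {κ d : ℝ} {p : Fin 4 → ℝ} {y : ℝ → Fin 4 → ℝ}
    (h : IsODESol (glField κ) (-d) d p y) : IsODESol (glField κ) (-d) d p (glFlow κ d p) := by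
  have hex : ∃ y, IsGLSolution κ d p y := ⟨y, h⟩
  rw [glFlow, dif_pos hex]
  exact hex.choose_spec

theorem glFlow_hasFDerivAt {κ d : ℝ} (hd : 0 ≤ d) {p : Fin 4 → ℝ} {y : ℝ → Fin 4 → ℝ}
    (h : IsODESol (glField κ) (-d) d p y) {x : ℝ} (hx : x ∈ Icc (-d) d) :
    ∃ A : (Fin 4 → ℝ) →L[ℝ] (Fin 4 → ℝ), HasFDerivAt (fun p' => glFlow κ d p' x) A p ∧
      ∀ Y : ℝ → Fin 4 → ℝ,
        (∀ x ∈ Icc (-d) d, HasDerivWithinAt Y (glLin κ (glFlow κ d p x) (Y x)) (Icc (-d) d) x) →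
        A (Y 0) = Y x := by
  obtain ⟨A, hA, hAY⟩ := (isODESol_glFlow h).hasFDerivAt_flow (f' := fderiv ℝ (glField κ))
    (contDiff_glField κ)
    (fun y => ((contDiff_glField κ (n := 1)).differentiable one_ne_zero y).hasFDerivAt)
    ((contDiff_glField κ (n := 2)).fderiv_right le_rfl) (neg_nonpos.2 hd) hd
    (fun _ _ h => isODESol_glFlow h) hx
  exact ⟨A, hA, fun Y hY => hAY Y fun x hx => (hY x hx).congr_deriv (fderiv_glField _ _ _).symm⟩

/-- The partial derivatives of the flow solve the linearized equations. -/
theorem glVar_eq {κ d : ℝ} (hd : 0 ≤ d) {p : Fin 4 → ℝ} {y₀ y Y : ℝ → Fin 4 → ℝ}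
    (h : IsODESol (glField κ) (-d) d p y₀) (hy : IsODESol (glField κ) 0 d p y) {j : Fin 4}
    (hY0 : Y 0 = Pi.single j 1)
    (hY : ∀ x ∈ Icc 0 d, HasDerivWithinAt Y (glLin κ (y x) (Y x)) (Icc 0 d) x)
    {x : ℝ} (hx : x ∈ Icc 0 d) (i : Fin 4) : glVar κ d p j i x = Y x i := by
  have hflow := isODESol_glFlow h
  have hx' : x ∈ Icc (-d) d := ⟨by linarith [hx.1], hx.2⟩
  obtain ⟨A, hA, hAY⟩ := glFlow_hasFDerivAt hd h hx'
  obtain ⟨Z, hZ0, hZ⟩ := hflow.exists_linear (contDiff_glField κ) (G := glLin κ)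
    (contDiff_glLin κ) (fun c y Y => by
      ext i; fin_cases i <;> simp [glLin] <;> ring) (neg_nonpos.2 hd) hd (Pi.single j 1)
  have hZY : Z x = Y x := by
    refine hy.linear_unique (contDiff_glField κ) (G := glLin κ) (contDiff_glLin κ) le_rfl hd
      (hZ0.trans hY0.symm) (fun t ht => ?_) hY hx
    have ht' : t ∈ Icc (-d) d := ⟨by linarith [ht.1], ht.2⟩
    rw [← (hflow.mono (by linarith) le_rfl).unique (contDiff_glField κ) le_rfl hd hy ht]
    exact (hZ t ht').mono (Icc_subset_Icc (by linarith) le_rfl)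
  have h1 : HasDerivAt (fun t => glFlow κ d (Function.update p j t) x) (A (Pi.single j 1)) (p j) := by
    have h2 : HasFDerivAt (fun p' => glFlow κ d p' x) A (Function.update p j (p j)) := by
      rwa [Function.update_eq_self]
    exact h2.comp_hasDerivAt (p j) (hasDerivAt_update p j (p j))
  rw [← hZ0, hAY Z hZ, hZY] at h1
  exact (hasDerivAt_pi.1 h1 i).deriv

theorem reflState_reflState (p : Fin 4 → ℝ) : reflState (reflState p) = p := by
  ext i; fin_cases i <;> simp [reflState]

/-- Reflection preserves solvability and fixes the default value 0, so no existence assumption is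
needed. -/
theorem glFlow_reflState {κ d : ℝ} (hd : 0 ≤ d) (p : Fin 4 → ℝ) {x : ℝ} (hx : x ∈ Icc (-d) d) :
    glFlow κ d (reflState p) (-x) = reflState (glFlow κ d p x) := by
  have hex : ∀ p, (∃ y, IsGLSolution κ d p y) → ∃ y, IsODESol (glField κ) (-d) d (reflState p) y ∧
      ∀ x, y (-x) = reflState (glFlow κ d p x) := by
    rintro p ⟨y, hy⟩
    have h1 := isODESol_glFlow hy
    rw [glField_eq_reField] at h1 ⊢
    have h2 := h1.reflect
    rw [neg_neg] at h2
    exact ⟨_, h2, fun x => by simp⟩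
  by_cases h : ∃ y, IsGLSolution κ d p y
  · obtain ⟨y, hy, hyx⟩ := hex p h
    rw [← hyx]
    exact (isODESol_glFlow hy).unique (contDiff_glField κ) (neg_nonpos.2 hd) hd hy
      ⟨by linarith [hx.2], by linarith [hx.1]⟩
  · have h' : ¬ ∃ y, IsGLSolution κ d (reflState p) y := fun h' => h (by
      obtain ⟨y, hy, -⟩ := hex _ h'
      rw [reflState_reflState] at hy
      exact ⟨y, hy⟩)
    rw [glFlow, dif_neg h', glFlow, dif_neg h]
    ext i; fin_cases i <;> simp [reflState]

/-- Parity of the partial derivatives at symmetric initial conditions. -/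
theorem glVar_neg {κ d α δ : ℝ} (hd : 0 ≤ d) (j i : Fin 4) :
    glVar κ d ![α, 0, 0, δ] j i (-d) =
      ![1, -1, -1, 1] j * ![1, -1, -1, 1] i * glVar κ d ![α, 0, 0, δ] j i d := by
  set p : Fin 4 → ℝ := ![α, 0, 0, δ] with hp
  set σ : Fin 4 → ℝ := ![1, -1, -1, 1] with hσ
  -- The base point is fixed by reflection, so reflection only multiplies the varied coordinate by
  -- its parity sign.
  have h1 : ∀ t, Function.update p j t = reflState (Function.update p j (σ j * t)) := by
    intro t
    ext k
    fin_cases j <;> fin_cases k <;> simp [reflState, hp, hσ, Function.update]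
  have h2 : ∀ y : Fin 4 → ℝ, reflState y i = σ i * y i := by
    intro y; fin_cases i <;> simp [reflState, hσ]
  have h3 : (fun t => glFlow κ d (Function.update p j t) (-d) i) =
      fun t => σ i * (fun s => glFlow κ d (Function.update p j s) d i) (σ j * t) := by
    funext t
    rw [h1 t, glFlow_reflState hd _ ⟨by linarith, le_rfl⟩, h2]
  have h4 : σ j * p j = p j := by fin_cases j <;> simp [hσ, hp]
  have h5 := deriv_comp_mul_left (σ j) (fun s => glFlow κ d (Function.update p j s) d i) (p j)
  rw [glVar, h3, deriv_const_mul_field, h5, h4, glVar, smul_eq_mul]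
  ring

/-- By parity the first two rows differ only in the sign of s', and the third row is (2v', 2w', 0);
expanding gives the product. -/
theorem glJ_eq {κ d α δ : ℝ} (hd : 0 ≤ d) : glJ κ d α δ = 4 * sPrime κ d α δ d *
    (qPrime κ d α δ d * wPrime κ d α δ d - rPrime κ d α δ d * vPrime κ d α δ d) := by
  have hq : qPrime κ d α δ (-d) = qPrime κ d α δ d := by
    simp [qPrime, glVar_neg hd]
  have hr : rPrime κ d α δ (-d) = rPrime κ d α δ d := by
    simp [rPrime, glVar_neg hd]
  have hs : sPrime κ d α δ (-d) = -sPrime κ d α δ d := by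
    simp [sPrime, glVar_neg hd]
  have hv : vPrime κ d α δ (-d) = -vPrime κ d α δ d := by
    simp [vPrime, glVar_neg hd]
  have hw : wPrime κ d α δ (-d) = -wPrime κ d α δ d := by
    simp [wPrime, glVar_neg hd]
  have hz : zPrime κ d α δ (-d) = zPrime κ d α δ d := by
    simp [zPrime, glVar_neg hd]
  rw [glJ, Matrix.det_fin_three, hq, hr, hs, hv, hw, hz]
  simp
  ring

/-! ### Passing to rescaled variables; continuity in ε and δ. -/

theorem isODESol_smul_reField {κ α a b δ : ℝ} {y : ℝ → Fin 4 → ℝ}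
    (h : IsODESol (reField κ (α ^ 2)) a b ![1, 0, 0, δ] y) :
    IsODESol (glField κ) a b ![α, 0, 0, δ]
      (fun x => ![α * y x 0, α * y x 1, y x 2, y x 3]) := by
  refine ⟨by simp [h.1], fun x hx => ?_⟩
  rw [hasDerivWithinAt_pi]
  intro i
  fin_cases i
  · exact (h.deriv_zero x hx).const_mul α
  · exact ((h.deriv_one x hx).const_mul α).congr_deriv (by simp [glField]; ring)
  · exact h.deriv_two x hx
  · exact (h.deriv_three x hx).congr_deriv (by simp [glField, -mul_eq_mul_right_iff]; ring)

theorem isODESol_div_glField {κ α a b δ : ℝ} (hα : α ≠ 0) {y : ℝ → Fin 4 → ℝ}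
    (h : IsODESol (glField κ) a b ![α, 0, 0, δ] y) :
    IsODESol (reField κ (α ^ 2)) a b ![1, 0, 0, δ]
      (fun x => ![y x 0 / α, y x 1 / α, y x 2, y x 3]) := by
  rw [glField_eq_reField] at h
  refine ⟨by simp [h.1, hα], fun x hx => ?_⟩
  rw [hasDerivWithinAt_pi]
  intro i
  fin_cases i
  · exact (h.deriv_zero x hx).div_const α
  · exact ((h.deriv_one x hx).div_const α).congr_deriv (by simp [reField]; field_simp)
  · exact h.deriv_two x hx
  · exact (h.deriv_three x hx).congr_deriv (by simp [reField, -mul_eq_mul_right_iff]; field_simp)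

/-- Linearization with respect to `φ'(0)`, for `Q = (q, q', v/α, v'/α)`. -/
def reLinQ (κ ε : ℝ) (y Q : Fin 4 → ℝ) : Fin 4 → ℝ :=
  ![Q 1, κ ^ 2 * (3 * ε * y 0 ^ 2 + y 2 ^ 2 - 1) * Q 0 + 2 * κ ^ 2 * ε * y 0 * y 2 * Q 2, Q 3,
    ε * y 0 ^ 2 * Q 2 + 2 * y 0 * y 2 * Q 0]

/-- Linearization with respect to `a(0)`, for `R = (r/α, r'/α, w, w'/α²)`. -/
def reLinR (κ ε : ℝ) (y R : Fin 4 → ℝ) : Fin 4 → ℝ :=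
  ![R 1, κ ^ 2 * (3 * ε * y 0 ^ 2 + y 2 ^ 2 - 1) * R 0 + 2 * κ ^ 2 * y 0 * y 2 * R 2, ε * R 3,
    y 0 ^ 2 * R 2 + 2 * y 0 * y 2 * R 0]

/-- The rescaled solution together with its two rescaled linearizations. -/
structure IsLinearizedSol (κ ε d δ : ℝ) (y Q R : ℝ → Fin 4 → ℝ) : Prop where
  sol : IsODESol (reField κ ε) 0 d ![1, 0, 0, δ] y
  initQ : Q 0 = ![0, 1, 0, 0]
  derivQ : ∀ x ∈ Icc 0 d, HasDerivWithinAt Q (reLinQ κ ε (y x) (Q x)) (Icc 0 d) x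
  initR : R 0 = ![0, 0, 1, 0]
  derivR : ∀ x ∈ Icc 0 d, HasDerivWithinAt R (reLinR κ ε (y x) (R x)) (Icc 0 d) x

/-- Undoing the rescalings, q'w' receives α² from w', and r'v' receives one α from each factor, so
exactly α² comes out of M. -/
theorem IsLinearizedSol.glM_eq {κ α d δ : ℝ} {y Q R y₀ : ℝ → Fin 4 → ℝ}
    (hd : 0 ≤ d) (h : IsLinearizedSol κ (α ^ 2) d δ y Q R)
    (h₀ : IsODESol (glField κ) (-d) d ![α, 0, 0, δ] y₀) :
    glM κ d α δ = α ^ 2 * (Q d 1 * R d 3 - R d 1 * Q d 3) := by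
  have hy := isODESol_smul_reField h.sol
  have hdd : d ∈ Icc 0 d := ⟨hd, le_rfl⟩
  have hQ := fun i x hx => hasDerivWithinAt_pi.1 (h.derivQ x hx) i
  have hR := fun i x hx => hasDerivWithinAt_pi.1 (h.derivR x hx) i
  have h1 := glVar_eq hd h₀ hy (j := 1)
    (Y := fun x => ![Q x 0, Q x 1, α * Q x 2, α * Q x 3])
    (by rw [h.initQ]; ext i; fin_cases i <;> simp)
    (fun x hx => by
      rw [hasDerivWithinAt_pi]
      intro i
      fin_cases i
      · exact hQ 0 x hx
      · exact (hQ 1 x hx).congr_deriv (by simp [reLinQ, glLin]; ring)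
      · exact (hQ 2 x hx).const_mul α
      · exact ((hQ 3 x hx).const_mul α).congr_deriv (by simp [reLinQ, glLin]; ring)) hdd
  have h2 := glVar_eq hd h₀ hy (j := 2)
    (Y := fun x => ![α * R x 0, α * R x 1, R x 2, α ^ 2 * R x 3])
    (by rw [h.initR]; ext i; fin_cases i <;> simp)
    (fun x hx => by
      rw [hasDerivWithinAt_pi]
      intro i
      fin_cases i
      · exact (hR 0 x hx).const_mul α
      · exact ((hR 1 x hx).const_mul α).congr_deriv (by simp [reLinR, glLin]; ring)
      · exact hR 2 x hx
      · exact ((hR 3 x hx).const_mul (α ^ 2)).congr_deriv (by simp [reLinR, glLin]; ring)) hdd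
  rw [glM, qPrime, wPrime, rPrime, vPrime, h1, h1, h2, h2]
  simp
  ring

/-- The combined field, with the parameter `ε` as an additional constant component. -/
def bigField (κ : ℝ) (z : ℝ × (Fin 4 → ℝ) × (Fin 4 → ℝ) × (Fin 4 → ℝ)) :
    ℝ × (Fin 4 → ℝ) × (Fin 4 → ℝ) × (Fin 4 → ℝ) :=
  (0, reField κ z.1 z.2.1, reLinQ κ z.1 z.2.1 z.2.2.1, reLinR κ z.1 z.2.1 z.2.2.2)

theorem contDiff_bigField (κ : ℝ) : ContDiff ℝ 1 (bigField κ) := by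
  unfold bigField
  refine contDiff_const.prodMk (ContDiff.prodMk ?_ (ContDiff.prodMk ?_ ?_)) <;>
  · rw [contDiff_pi]
    intro i
    fin_cases i <;> simp only [reField, reLinQ, reLinR] <;> simp <;> fun_prop

theorem IsLinearizedSol.isODESol {κ ε d δ : ℝ} {y Q R : ℝ → Fin 4 → ℝ}
    (h : IsLinearizedSol κ ε d δ y Q R) :
    IsODESol (bigField κ) 0 d (ε, ![1, 0, 0, δ], ![0, 1, 0, 0], ![0, 0, 1, 0])
      (fun x => (ε, y x, Q x, R x)) :=
  ⟨by simp [h.sol.1, h.initQ, h.initR], fun x hx =>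
    (hasDerivWithinAt_const _ _ _).prodMk
      ((h.sol.2 x hx).prodMk ((h.derivQ x hx).prodMk (h.derivR x hx)))⟩

theorem IsODESol.isLinearizedSol {κ ε d δ : ℝ}
    {z : ℝ → ℝ × (Fin 4 → ℝ) × (Fin 4 → ℝ) × (Fin 4 → ℝ)}
    (h : IsODESol (bigField κ) 0 d (ε, ![1, 0, 0, δ], ![0, 1, 0, 0], ![0, 0, 1, 0]) z) :
    IsLinearizedSol κ ε d δ (fun x => (z x).2.1) (fun x => (z x).2.2.1)
      (fun x => (z x).2.2.2) := by
  have hs1 : ∀ x ∈ Icc 0 d, HasDerivWithinAt (fun x => (z x).1) 0 (Icc 0 d) x :=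
    fun x hx => (h.2 x hx).fst
  have hs2 : ∀ x ∈ Icc 0 d, HasDerivWithinAt (fun x => (z x).2.1)
      (reField κ (z x).1 (z x).2.1) (Icc 0 d) x := fun x hx => (h.2 x hx).snd.fst
  have hs3 : ∀ x ∈ Icc 0 d, HasDerivWithinAt (fun x => (z x).2.2.1)
      (reLinQ κ (z x).1 (z x).2.1 (z x).2.2.1) (Icc 0 d) x :=
    fun x hx => (h.2 x hx).snd.snd.fst
  have hs4 : ∀ x ∈ Icc 0 d, HasDerivWithinAt (fun x => (z x).2.2.2)
      (reLinR κ (z x).1 (z x).2.1 (z x).2.2.2) (Icc 0 d) x :=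
    fun x hx => (h.2 x hx).snd.snd.snd
  have hε : ∀ x ∈ Icc 0 d, (z x).1 = ε := fun x hx => by
    have h1 := constant_of_has_deriv_right_zero (f := fun x => (z x).1) (a := 0) (b := d)
      (fun x hx => (hs1 x hx).continuousWithinAt)
      (fun x hx => (hs1 x ⟨hx.1, hx.2.le⟩).mono_of_mem_nhdsWithin
        (Icc_mem_nhdsGE_of_mem hx)) x hx
    simpa [h.1] using h1
  refine ⟨⟨by simp [h.1], fun x hx => ?_⟩, by simp [h.1], fun x hx => ?_, by simp [h.1],
    fun x hx => ?_⟩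
  · exact (hs2 x hx).congr_deriv (by rw [hε x hx])
  · exact (hs3 x hx).congr_deriv (by rw [hε x hx])
  · exact (hs4 x hx).congr_deriv (by rw [hε x hx])

/-- Continuous dependence of the linearized solutions on the parameter and on the slope. -/
theorem IsLinearizedSol.continuous_dependence {κ ε d δ : ℝ} {y Q R : ℝ → Fin 4 → ℝ} (hd : 0 ≤ d)
    (h : IsLinearizedSol κ ε d δ y Q R) {η : ℝ} (hη : 0 < η) :
    ∀ᶠ p in 𝓝 (ε, δ), ∃ y' Q' R', IsLinearizedSol κ p.1 d p.2 y' Q' R' ∧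
      (∀ x ∈ Icc 0 d, ∀ i, |y' x i - y x i| < η) ∧
      |(Q' d 1 * R' d 3 - R' d 1 * Q' d 3) - (Q d 1 * R d 3 - R d 1 * Q d 3)| < η := by
  obtain ⟨C, hC0, hC⟩ := h.isODESol.stability (contDiff_bigField κ) le_rfl hd
  set N : ℝ × (Fin 4 → ℝ) × (Fin 4 → ℝ) × (Fin 4 → ℝ) → ℝ :=
    fun z => z.2.2.1 1 * z.2.2.2 3 - z.2.2.2 1 * z.2.2.1 3 with hN
  have hNc : Continuous N := by fun_prop
  obtain ⟨ρ, hρ, hNρ⟩ := Metric.continuous_iff.1 hNc (ε, y d, Q d, R d) η hη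
  set P : ℝ × ℝ → ℝ × (Fin 4 → ℝ) × (Fin 4 → ℝ) × (Fin 4 → ℝ) :=
    fun p => (p.1, ![1, 0, 0, p.2], ![0, 1, 0, 0], ![0, 0, 1, 0]) with hP
  have hPc : Continuous P := by
    refine continuous_fst.prodMk (Continuous.prodMk ?_ continuous_const)
    refine continuous_pi fun i => ?_
    fin_cases i <;> simp <;> fun_prop
  have hPt : Tendsto P (𝓝 (ε, δ)) (𝓝 (P (ε, δ))) := hPc.tendsto _
  have hsmall : ∀ᶠ p in 𝓝 (ε, δ), C * ‖P p - P (ε, δ)‖ < min η ρ := by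
    have h1 : Continuous fun p => C * ‖P p - P (ε, δ)‖ := by fun_prop
    have h2 := h1.tendsto (ε, δ)
    simp only [sub_self, norm_zero, mul_zero] at h2
    exact h2.eventually (gt_mem_nhds (lt_min hη hρ))
  filter_upwards [hPt.eventually hC, hsmall] with p ⟨z, hz, hzC⟩ hp
  refine ⟨_, _, _, IsODESol.isLinearizedSol hz, fun x hx i => ?_, ?_⟩
  · have h1 := (hzC x hx).trans_lt (hp.trans_le (min_le_left _ _))
    exact (norm_le_pi_norm ((z x).2.1 - y x) i).trans_lt
      (((norm_fst_le _).trans (norm_snd_le (z x - (ε, y x, Q x, R x)))).trans_lt h1)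
  · refine hNρ (z d) ?_
    rw [dist_eq_norm]
    exact (hzC d ⟨hd, le_rfl⟩).trans_lt (hp.trans_le (min_le_right _ _))

/-! ### Positivity of s'(d). -/

/-- `s'(d) > 0` along the symmetric branch. -/
theorem sPrime_pos {κ α d δ : ℝ} (hκ : 0 < κ) (hα : 0 < α) (hδ : 0 < δ) (hd : 0 < d)
    {y₀ : ℝ → Fin 4 → ℝ} (h₀ : IsODESol (glField κ) (-d) d ![α, 0, 0, δ] y₀)
    (hpos : ∀ x ∈ Icc 0 d, 0 < y₀ x 0) (hend : y₀ d 1 = 0) : 0 < sPrime κ d α δ d := by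
  have hy : IsODESol (glField κ) 0 d ![α, 0, 0, δ] y₀ := h₀.mono (by linarith) le_rfl
  have hne : ∀ x ∈ Icc 0 d, y₀ x 0 ≠ 0 := fun x hx => (hpos x hx).ne'
  have ha := fun x hx => ((isODESol_div_glField hα.ne' hy).two_nonneg (sq_nonneg α) hδ.le
    (x := x) hx).1
  simp only [Matrix.cons_val] at ha
  obtain ⟨Y, hY0, hY⟩ := hy.exists_linear (contDiff_glField κ) (G := glLin κ)
    (contDiff_glLin κ) (fun c y Y => by
      ext i; fin_cases i <;> simp [glLin] <;> ring) le_rfl hd.le (Pi.single 3 1)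
  have hYd := fun i x hx => hasDerivWithinAt_pi.1 (hY x hx) i
  rw [sPrime, glVar_eq hd.le h₀ hy hY0 hY ⟨hd.le, le_rfl⟩ 1]
  rw [glField_eq_reField] at hy
  have i0 : y₀ 0 = ![α, 0, 0, δ] := hy.1
  have cY0 : ContinuousOn (fun t => y₀ t 0) (Icc 0 d) := hy.continuousOn_apply 0
  have cY2 : ContinuousOn (fun t => y₀ t 2) (Icc 0 d) := hy.continuousOn_apply 2
  -- Infinitesimal version of the uniqueness argument: the quotient s/φ, the Wronskian of φ and s,
  -- and z, z' form a cooperative system.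
  have hc : ∀ x ∈ Icc 0 d, HasDerivWithinAt (fun t => Y t 0 / y₀ t 0)
      ((y₀ x 0 ^ 2)⁻¹ * (y₀ x 0 * Y x 1 - Y x 0 * y₀ x 1)) (Icc 0 d) x := fun x hx => by
    refine ((hYd 0 x hx).div (hy.deriv_zero x hx) (hne x hx)).congr_deriv ?_
    have := hne x hx
    simp only [glLin, Matrix.cons_val]
    field_simp
  have hW : ∀ x ∈ Icc 0 d, HasDerivWithinAt (fun t => y₀ t 0 * Y t 1 - Y t 0 * y₀ t 1)
      (2 * κ ^ 2 * y₀ x 0 ^ 4 * (Y x 0 / y₀ x 0) + 2 * κ ^ 2 * y₀ x 0 ^ 2 * y₀ x 2 * Y x 2)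
      (Icc 0 d) x := fun x hx => by
    refine (((hy.deriv_zero x hx).mul (hYd 1 x hx)).sub
      ((hYd 0 x hx).mul (hy.deriv_one x hx))).congr_deriv ?_
    have := hne x hx
    simp only [glLin, Matrix.cons_val]
    field_simp
    ring
  have hb : ∀ x ∈ Icc 0 d, HasDerivWithinAt (fun t => Y t 2) (Y x 3) (Icc 0 d) x :=
    fun x hx => hYd 2 x hx
  have hb₁ : ∀ x ∈ Icc 0 d, HasDerivWithinAt (fun t => Y t 3)
      (2 * y₀ x 0 ^ 2 * y₀ x 2 * (Y x 0 / y₀ x 0) + y₀ x 0 ^ 2 * Y x 2) (Icc 0 d) x :=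
    fun x hx => (hYd 3 x hx).congr_deriv (by
      have := hne x hx
      simp only [glLin, Matrix.cons_val]
      field_simp
      ring)
  have key : ∀ x ∈ Icc 0 d, 0 ≤ Y x 0 / y₀ x 0 ∧ 0 ≤ y₀ x 0 * Y x 1 - Y x 0 * y₀ x 1 ∧
      0 ≤ Y x 2 ∧ 0 ≤ Y x 3 := fun x hx =>
    nonneg_of_cooperative_pair (d := d) (x := x)
      (p := fun t => (y₀ t 0 ^ 2)⁻¹) (q₁ := fun t => 2 * κ ^ 2 * y₀ t 0 ^ 4)
      (q₂ := fun t => 2 * κ ^ 2 * y₀ t 0 ^ 2 * y₀ t 2)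
      (q₃ := fun t => 2 * y₀ t 0 ^ 2 * y₀ t 2) (q₄ := fun t => y₀ t 0 ^ 2) hc hW hb hb₁
      (fun t ht => by positivity) (fun t ht => by positivity)
      (fun t ht => by have := ha t ht; positivity)
      (fun t ht => by have := ha t ht; positivity) (fun t ht => by positivity)
      ((cY0.pow 2).inv₀ fun t ht => pow_ne_zero 2 (hne t ht))
      (by fun_prop) (by fun_prop) (by fun_prop) (by fun_prop)
      (by simp [hY0]) (by simp [hY0]) (by simp [hY0]) (by simp [hY0]) hx
  have hb₁' : ∀ x ∈ Icc 0 d, 1 ≤ Y x 3 := fun x hx =>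
    le_of_hasDerivWithinAt_le (f := fun _ => 1) (f' := fun _ => 0)
      (fun t _ => hasDerivWithinAt_const _ _ _) hb₁
      (fun t ht => by
        have := ha t ht
        obtain ⟨h1, -, h3, -⟩ := key t ht
        positivity) (by simp [hY0]) hx
  have hb' : ∀ x ∈ Icc 0 d, x ≤ Y x 2 := fun x hx =>
    le_of_hasDerivWithinAt_le (f := fun t => t) (f' := fun _ => 1)
      (fun t _ => hasDerivWithinAt_id _ _) hb hb₁' (by simp [hY0]) hx
  have hw : ∀ x ∈ Icc 0 d, δ ≤ y₀ x 3 := fun x hx =>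
    le_of_hasDerivWithinAt_le (f := fun _ => δ) (f' := fun _ => 0)
      (fun t _ => hasDerivWithinAt_const _ _ _) hy.deriv_three
      (fun t ht => by have := ha t ht; positivity) (by simp [i0]) hx
  have ha' : ∀ x ∈ Icc 0 d, δ * x ≤ y₀ x 2 := fun x hx =>
    le_of_hasDerivWithinAt_le (f := fun t => δ * t) (f' := fun _ => δ)
      (fun t _ => by simpa using (hasDerivWithinAt_id t _).const_mul δ) hy.deriv_two hw
      (by simp [i0]) hx
  have hfin := lt_of_hasDerivWithinAt_lt hd (f := fun _ => (0 : ℝ)) (f' := fun _ => 0)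
    (fun t _ => hasDerivWithinAt_const _ _ _) hW
    (fun t ht => by
      have ht' : t ∈ Icc 0 d := ⟨ht.1.le, ht.2.le⟩
      have h1 := hpos t ht'
      have h2 : 0 < y₀ t 2 := (mul_pos hδ ht.1).trans_le (ha' t ht')
      have h3 : 0 < Y t 2 := ht.1.trans_le (hb' t ht')
      have h4 := (key t ht').1
      positivity) (by simp [hY0])
  -- Since φ'(d) = 0, the Wronskian at d is φ(d) s'(d).
  rw [hend, mul_zero, sub_zero] at hfin
  exact pos_of_mul_pos_right hfin (hpos d ⟨hd.le, le_rfl⟩).le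

/-! ### The limit problem ε = 0 solved by quadratures. -/

theorem hasDerivWithinAt_integral_Icc {f : ℝ → ℝ} {D : ℝ} (hf : ContinuousOn f (Icc 0 D)) {x : ℝ}
    (hx : x ∈ Icc 0 D) :
    HasDerivWithinAt (fun u => ∫ t in (0 : ℝ)..u, f t) (f x) (Icc 0 D) x := by
  have : Fact (x ∈ Icc 0 D) := ⟨hx⟩
  have hsub : uIcc 0 x ⊆ Icc 0 D := by
    rw [uIcc_of_le hx.1]; exact Icc_subset_Icc le_rfl hx.2
  exact intervalIntegral.integral_hasDerivWithinAt_right (s := Icc 0 D) (t := Icc 0 D)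
    ((hf.mono hsub).intervalIntegrable)
    (hf.stronglyMeasurableAtFilter_nhdsWithin measurableSet_Icc x) (hf x hx)

theorem eq_of_hasDerivWithinAt_eq {f g f' : ℝ → ℝ} {a b : ℝ}
    (hf : ∀ x ∈ Icc a b, HasDerivWithinAt f (f' x) (Icc a b) x)
    (hg : ∀ x ∈ Icc a b, HasDerivWithinAt g (f' x) (Icc a b) x)
    (h0 : f a = g a) {x : ℝ} (hx : x ∈ Icc a b) : f x = g x :=
  le_antisymm (le_of_hasDerivWithinAt_le hf hg (fun _ _ => le_rfl) h0.le hx)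
    (le_of_hasDerivWithinAt_le hg hf (fun _ _ => le_rfl) h0.ge hx)

theorem HasDerivWithinAt.comp_mul_Icc {F : ℝ → ℝ} {F' κ d x : ℝ} (hκ : 0 < κ)
    (h : HasDerivWithinAt F F' (Icc 0 (κ * d)) (κ * x)) :
    HasDerivWithinAt (fun t => F (κ * t)) (κ * F') (Icc 0 d) x := by
  have := h.scomp x ((hasDerivWithinAt_id x (Icc 0 d)).const_mul κ)
    (fun t ht => ⟨mul_nonneg hκ.le ht.1, mul_le_mul_of_nonneg_left ht.2 hκ.le⟩)
  simpa [Function.comp_def] using this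

namespace IsRescaledEigenpair

variable {D lam : ℝ} {g g₁ : ℝ → ℝ}

theorem continuousOn (h : IsRescaledEigenpair D lam g g₁) : ContinuousOn g (Icc 0 D) :=
  fun x hx => (h.hasDeriv x hx).continuousWithinAt

theorem ne_zero (h : IsRescaledEigenpair D lam g g₁) : ∀ x ∈ Icc 0 D, g x ≠ 0 :=
  fun x hx => (h.pos x hx).ne'

theorem continuousOn_inv_sq (h : IsRescaledEigenpair D lam g g₁) :
    ContinuousOn (fun s => 1 / g s ^ 2) (Icc 0 D) :=
  continuousOn_const.div (h.continuousOn.pow 2) fun x hx => pow_ne_zero 2 (h.ne_zero x hx)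

end IsRescaledEigenpair

/-- `∫₀ʸ g⁻²`. -/
noncomputable def invSqIntegral (g : ℝ → ℝ) (y : ℝ) : ℝ := ∫ s in (0 : ℝ)..y, 1 / g s ^ 2

/-- `∫₀ʸ t g(t)² dt`. -/
noncomputable def momentIntegral (g : ℝ → ℝ) (y : ℝ) : ℝ := ∫ t in (0 : ℝ)..y, t * g t ^ 2

/-- `∫₀ʸ t g(t)² ∫₀ᵗ g⁻² dt`. -/
noncomputable def momentInvSqIntegral (g : ℝ → ℝ) (y : ℝ) : ℝ :=
  ∫ t in (0 : ℝ)..y, t * g t ^ 2 * invSqIntegral g t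

/-- `∫₀ʸ g(s)⁻² ∫₀ˢ t g(t)² dt ds`. -/
noncomputable def invSqMomentIntegral (g : ℝ → ℝ) (y : ℝ) : ℝ :=
  ∫ s in (0 : ℝ)..y, 1 / g s ^ 2 * momentIntegral g s

namespace IsRescaledEigenpair

variable {D lam : ℝ} {g g₁ : ℝ → ℝ}

theorem deriv_invSq (h : IsRescaledEigenpair D lam g g₁) : ∀ x ∈ Icc 0 D,
    HasDerivWithinAt (invSqIntegral g) (1 / g x ^ 2) (Icc 0 D) x :=
  fun _ hx => hasDerivWithinAt_integral_Icc h.continuousOn_inv_sq hx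

theorem continuousOn_invSq (h : IsRescaledEigenpair D lam g g₁) :
    ContinuousOn (invSqIntegral g) (Icc 0 D) :=
  fun x hx => (h.deriv_invSq x hx).continuousWithinAt

theorem deriv_moment (h : IsRescaledEigenpair D lam g g₁) : ∀ x ∈ Icc 0 D,
    HasDerivWithinAt (momentIntegral g) (x * g x ^ 2) (Icc 0 D) x :=
  fun _ hx => hasDerivWithinAt_integral_Icc (continuousOn_id.mul (h.continuousOn.pow 2)) hx

theorem continuousOn_moment (h : IsRescaledEigenpair D lam g g₁) :
    ContinuousOn (momentIntegral g) (Icc 0 D) :=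
  fun x hx => (h.deriv_moment x hx).continuousWithinAt

theorem deriv_momentInvSq (h : IsRescaledEigenpair D lam g g₁) : ∀ x ∈ Icc 0 D,
    HasDerivWithinAt (momentInvSqIntegral g) (x * g x ^ 2 * invSqIntegral g x) (Icc 0 D) x :=
  fun _ hx => hasDerivWithinAt_integral_Icc
    ((continuousOn_id.mul (h.continuousOn.pow 2)).mul h.continuousOn_invSq) hx

theorem deriv_invSqMoment (h : IsRescaledEigenpair D lam g g₁) : ∀ x ∈ Icc 0 D,
    HasDerivWithinAt (invSqMomentIntegral g) (1 / g x ^ 2 * momentIntegral g x) (Icc 0 D) x :=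
  fun _ hx => hasDerivWithinAt_integral_Icc
    (h.continuousOn_inv_sq.mul h.continuousOn_moment) hx

theorem continuousOn_invSqMoment (h : IsRescaledEigenpair D lam g g₁) :
    ContinuousOn (invSqMomentIntegral g) (Icc 0 D) :=
  fun x hx => (h.deriv_invSqMoment x hx).continuousWithinAt

theorem integral_tail (h : IsRescaledEigenpair D lam g g₁) {s : ℝ} (hs : s ∈ Icc 0 D) :
    ∫ t in s..D, t * g t ^ 2 = momentIntegral g D - momentIntegral g s := by
  have hc : ContinuousOn (fun t => t * g t ^ 2) (Icc 0 D) :=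
    continuousOn_id.mul (h.continuousOn.pow 2)
  rw [momentIntegral, momentIntegral, eq_sub_iff_add_eq, add_comm]
  refine intervalIntegral.integral_add_adjacent_intervals
    (hc.mono ?_).intervalIntegrable (hc.mono ?_).intervalIntegrable
  · rw [uIcc_of_le hs.1]; exact Icc_subset_Icc le_rfl hs.2
  · rw [uIcc_of_le hs.2]; exact Icc_subset_Icc hs.1 le_rfl

/-- Trades the tail integral for integrals from 0, which are the ones appearing in the explicit
linearizations. -/
theorem integral_inner (h : IsRescaledEigenpair D lam g g₁) {y : ℝ} (hy : y ∈ Icc 0 D) :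
    ∫ s in (0 : ℝ)..y, 1 / g s ^ 2 * ∫ t in s..D, t * g t ^ 2 =
      momentIntegral g D * invSqIntegral g y - invSqMomentIntegral g y := by
  have h1 : ∫ s in (0 : ℝ)..y, 1 / g s ^ 2 * ∫ t in s..D, t * g t ^ 2 =
      ∫ s in (0 : ℝ)..y, 1 / g s ^ 2 * (momentIntegral g D - momentIntegral g s) := by
    refine intervalIntegral.integral_congr fun s hs => ?_
    rw [uIcc_of_le hy.1] at hs
    rw [h.integral_tail ⟨hs.1, hs.2.trans hy.2⟩]
  rw [h1]
  exact eq_of_hasDerivWithinAt_eq (a := 0) (b := D)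
    (f := fun y => ∫ s in (0 : ℝ)..y, 1 / g s ^ 2 * (momentIntegral g D - momentIntegral g s))
    (g := fun y => momentIntegral g D * invSqIntegral g y - invSqMomentIntegral g y)
    (f' := fun y => 1 / g y ^ 2 * (momentIntegral g D - momentIntegral g y))
    (fun x hx => hasDerivWithinAt_integral_Icc
      (h.continuousOn_inv_sq.mul (continuousOn_const.sub h.continuousOn_moment)) hx)
    (fun x hx => (((h.deriv_invSq x hx).const_mul _).sub (h.deriv_invSqMoment x hx)).congr_deriv
      (by ring)) (by simp [invSqIntegral, invSqMomentIntegral]) hy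

theorem tripleIntegral_eq (h : IsRescaledEigenpair D lam g g₁) (hD : 0 ≤ D) :
    tripleIntegral D g = ∫ y in (0 : ℝ)..D, y * g y ^ 2 *
      (momentIntegral g D * invSqIntegral g y - invSqMomentIntegral g y) := by
  refine intervalIntegral.integral_congr fun y hy => ?_
  rw [uIcc_of_le hD] at hy
  rw [h.integral_inner hy]

/-- The solution for `ε = 0`, with explicit linearizations. -/
theorem exists_isLinearizedSol {κ d : ℝ} (hκ : 0 < κ) (hd : 0 < d)
    (h : IsRescaledEigenpair (κ * d) lam g g₁) :
    ∃ y Q R, IsLinearizedSol κ 0 d (κ * lam) y Q R ∧ (∀ x ∈ Icc 0 d, 0 < y x 0) ∧ y d 1 = 0 ∧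
      Q d 1 * R d 3 - R d 1 * Q d 3 = 1 / (κ * g (κ * d)) *
        ((∫ y in (0 : ℝ)..(κ * d), g y ^ 2) - 4 * lam ^ 2 * tripleIntegral (κ * d) g) := by
  have hD : 0 < κ * d := mul_pos hκ hd
  have hmem : ∀ x ∈ Icc 0 d, κ * x ∈ Icc 0 (κ * d) := fun x hx =>
    ⟨mul_nonneg hκ.le hx.1, mul_le_mul_of_nonneg_left hx.2 hκ.le⟩
  have hg := fun x hx => (h.hasDeriv _ (hmem x hx)).comp_mul_Icc hκ
  have hg₁ := fun x hx => (h.hasDeriv₁ _ (hmem x hx)).comp_mul_Icc hκ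
  have hP := fun x hx => (h.deriv_invSq _ (hmem x hx)).comp_mul_Icc hκ
  have hH := fun x hx => (h.deriv_moment _ (hmem x hx)).comp_mul_Icc hκ
  have hI := fun x hx => (h.deriv_momentInvSq _ (hmem x hx)).comp_mul_Icc hκ
  have hK := fun x hx => (h.deriv_invSqMoment _ (hmem x hx)).comp_mul_Icc hκ
  set W : ℝ → ℝ := fun y => ∫ t in (0 : ℝ)..y,
    (g t ^ 2 + 4 * lam ^ 2 * (t * g t ^ 2 * invSqMomentIntegral g t)) with hWdef
  have hcg := h.continuousOn
  have hcK := h.continuousOn_invSqMoment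
  have hcP := h.continuousOn_invSq
  have hWd : ∀ x ∈ Icc 0 d, HasDerivWithinAt (fun t => W (κ * t)) _ (Icc 0 d) x := fun x hx =>
    (hasDerivWithinAt_integral_Icc (f := fun t => g t ^ 2 + 4 * lam ^ 2 *
      (t * g t ^ 2 * invSqMomentIntegral g t)) (by fun_prop) (hmem x hx)).comp_mul_Icc hκ
  set V : ℝ → ℝ := fun x => ∫ t in (0 : ℝ)..x,
    2 * lam / κ ^ 2 * momentInvSqIntegral g (κ * t) with hVdef
  have hVd : ∀ x ∈ Icc 0 d, HasDerivWithinAt V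
      (2 * lam / κ ^ 2 * momentInvSqIntegral g (κ * x)) (Icc 0 d) x := fun x hx =>
    hasDerivWithinAt_integral_Icc (continuousOn_const.mul fun t ht =>
      (hI t ht).continuousWithinAt) hx
  have hne : ∀ x ∈ Icc 0 d, g (κ * x) ≠ 0 := fun x hx => h.ne_zero _ (hmem x hx)
  have hκ0 := hκ.ne'
  -- Reduction of order: g∫g⁻² is the second solution of the linear equation, giving q. Since w = 1
  -- when ε = 0, r/α solves that equation with forcing 2κ²ψa and equals 2λ g∫g⁻²∫t g². The remaining
  -- components are integrals of these.
  refine ⟨fun x => ![g (κ * x), κ * g₁ (κ * x), κ * lam * x, κ * lam],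
    fun x => ![g (κ * x) * invSqIntegral g (κ * x) / κ,
      g₁ (κ * x) * invSqIntegral g (κ * x) + 1 / g (κ * x), V x,
      2 * lam / κ ^ 2 * momentInvSqIntegral g (κ * x)],
    fun x => ![2 * lam * (g (κ * x) * invSqMomentIntegral g (κ * x)),
      2 * lam * κ * (g₁ (κ * x) * invSqMomentIntegral g (κ * x) +
        momentIntegral g (κ * x) / g (κ * x)), 1, W (κ * x) / κ],
    ⟨⟨?_, fun x hx => ?_⟩, ?_, fun x hx => ?_, ?_, fun x hx => ?_⟩, fun x hx => ?_, ?_, ?_⟩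
  · simp [h.init, h.init₁]
  · rw [hasDerivWithinAt_pi]
    intro i
    fin_cases i
    · exact hg x hx
    · exact ((hg₁ x hx).const_mul κ).congr_deriv (by simp [reField]; ring)
    · exact ((hasDerivWithinAt_id x _).const_mul (κ * lam)).congr_deriv (by simp [reField])
    · exact (hasDerivWithinAt_const _ _ _).congr_deriv (by simp [reField])
  · simp [h.init, h.init₁, invSqIntegral, momentInvSqIntegral, hVdef]
  · rw [hasDerivWithinAt_pi]
    intro i
    have := hne x hx
    fin_cases i
    · refine (((hg x hx).mul (hP x hx)).div_const κ).congr_deriv ?_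
      simp only [reLinQ, Matrix.cons_val]
      simp
      field_simp
    · refine (((hg₁ x hx).mul (hP x hx)).add
        ((hasDerivWithinAt_const x _ (1 : ℝ)).div (hg x hx) (hne x hx))).congr_deriv ?_
      simp [reLinQ]
      field_simp
      ring
    · exact (hVd x hx).congr_deriv (by simp [reLinQ])
    · refine ((hI x hx).const_mul _).congr_deriv ?_
      simp [reLinQ]
      field_simp
  · simp [h.init, h.init₁, invSqMomentIntegral, momentIntegral, hWdef]
  · rw [hasDerivWithinAt_pi]
    intro i
    have := hne x hx
    fin_cases i
    · refine (((hg x hx).mul (hK x hx)).const_mul (2 * lam)).congr_deriv ?_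
      simp only [reLinR, Matrix.cons_val]
      simp
      field_simp
    · refine ((((hg₁ x hx).mul (hK x hx)).add
        ((hH x hx).div (hg x hx) (hne x hx))).const_mul (2 * lam * κ)).congr_deriv ?_
      simp [reLinR]
      field_simp
      ring
    · exact (hasDerivWithinAt_const _ _ _).congr_deriv (by simp [reLinR])
    · refine ((hWd x hx).div_const κ).congr_deriv ?_
      simp [reLinR]
      field_simp
      ring
  · exact h.pos _ (hmem x hx)
  · simp [h.bdry]
  -- Because g'(D) = 0, only 1/g(D) and the moment divided by g(D) survive in Q₁ and R₁; the
  -- determinant becomes (W - 4λ² · moment · double integral)/(κ g(D)).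
  · have hG := hne d ⟨hd.le, le_rfl⟩
    have hsubset : uIcc 0 (κ * d) ⊆ Icc 0 (κ * d) := by rw [uIcc_of_le hD.le]
    have i1 : IntervalIntegrable (fun t => g t ^ 2) MeasureTheory.volume 0 (κ * d) :=
      (ContinuousOn.mono (by fun_prop) hsubset).intervalIntegrable
    have i2 : IntervalIntegrable (fun t => t * g t ^ 2 * invSqMomentIntegral g t)
        MeasureTheory.volume 0 (κ * d) :=
      (ContinuousOn.mono (by fun_prop) hsubset).intervalIntegrable
    have i3 : IntervalIntegrable (fun t => t * g t ^ 2 * invSqIntegral g t)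
        MeasureTheory.volume 0 (κ * d) :=
      (ContinuousOn.mono (by fun_prop) hsubset).intervalIntegrable
    have hW : W (κ * d) = (∫ t in (0 : ℝ)..(κ * d), g t ^ 2) +
        4 * lam ^ 2 * ∫ t in (0 : ℝ)..(κ * d), t * g t ^ 2 * invSqMomentIntegral g t := by
      rw [hWdef]
      simp only
      rw [intervalIntegral.integral_add i1 (i2.const_mul _), intervalIntegral.integral_const_mul]
    have hT : tripleIntegral (κ * d) g = momentIntegral g (κ * d) * momentInvSqIntegral g (κ * d) -
        ∫ t in (0 : ℝ)..(κ * d), t * g t ^ 2 * invSqMomentIntegral g t := by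
      rw [h.tripleIntegral_eq hD.le, momentInvSqIntegral, ← intervalIntegral.integral_const_mul,
        ← intervalIntegral.integral_sub (i3.const_mul _) i2]
      refine intervalIntegral.integral_congr fun t _ => ?_
      ring
    simp only [Matrix.cons_val]
    rw [hW, hT, h.bdry]
    field_simp
    ring

end IsRescaledEigenpair

/-! ### The endpoint ε = 1. -/

/-- The solution `ψ = 1`, `a = 0` for `ε = 1`, with explicit linearizations. -/
theorem exists_isLinearizedSol_one {κ d : ℝ} (hκ : 0 < κ) (hd : 0 < d) :
    ∃ y Q R, IsLinearizedSol κ 1 d 0 y Q R ∧ (∀ x, 0 < y x 0) ∧ y d 1 = 0 ∧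
      0 < Q d 1 * R d 3 - R d 1 * Q d 3 := by
  -- The linearization at ψ = 1 is q'' = 2κ²q, and it decouples from w'' = w.
  set c : ℝ := κ * √2 with hc
  have hc0 : c ≠ 0 := by positivity
  have hc2 : c ^ 2 = 2 * κ ^ 2 := by rw [hc, mul_pow, Real.sq_sqrt zero_le_two]; ring
  have hlin : ∀ x, HasDerivAt (fun x => c * x) c x := fun x => by
    simpa using (hasDerivAt_id x).const_mul c
  refine ⟨fun _ => ![1, 0, 0, 0], fun x => ![Real.sinh (c * x) / c, Real.cosh (c * x), 0, 0],
    fun x => ![0, 0, Real.cosh x, Real.sinh x],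
    ⟨⟨rfl, fun x _ => ?_⟩, ?_, fun x _ => ?_, ?_, fun x _ => ?_⟩, ?_, rfl, ?_⟩
  · refine (hasDerivWithinAt_const _ _ _).congr_deriv ?_
    ext i; fin_cases i <;> simp [reField]
  · simp
  · rw [hasDerivWithinAt_pi]
    intro i
    fin_cases i
    · refine ((hlin x).sinh.div_const c).hasDerivWithinAt.congr_deriv ?_
      simp [reLinQ]
      field_simp
    · refine (hlin x).cosh.hasDerivWithinAt.congr_deriv ?_
      simp [reLinQ]
      field_simp
      linear_combination Real.sinh (c * x) * hc2
    · exact (hasDerivWithinAt_const _ _ _).congr_deriv (by simp [reLinQ])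
    · exact (hasDerivWithinAt_const _ _ _).congr_deriv (by simp [reLinQ])
  · simp
  · rw [hasDerivWithinAt_pi]
    intro i
    fin_cases i
    · exact (hasDerivWithinAt_const _ _ _).congr_deriv (by simp [reLinR])
    · exact (hasDerivWithinAt_const _ _ _).congr_deriv (by simp [reLinR])
    · exact (Real.hasDerivAt_cosh x).hasDerivWithinAt.congr_deriv (by simp [reLinR])
    · exact (Real.hasDerivAt_sinh x).hasDerivWithinAt.congr_deriv (by simp [reLinR])
  · simp
  · simp [Real.cosh_pos, Real.sinh_pos_iff.2 hd]

/-! ### The integral inequality. -/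

namespace IsRescaledEigenpair

variable {D lam : ℝ} {g g₁ : ℝ → ℝ}

/-- The function e^{-λy²/2}(g' + λyg) has derivative e^{-λy²/2}(λ - 1)g and vanishes at 0. For λ ≤ 1
it would be nonpositive at D, where it equals the positive number e^{-λD²/2} λD g(D). -/
theorem one_lt_lam (h : IsRescaledEigenpair D lam g g₁) (hD : 0 < D) : 1 < lam := by
  by_contra hle
  rw [not_lt] at hle
  have hexp : ∀ x, HasDerivAt (fun y => Real.exp (-lam * y ^ 2 / 2))
      (Real.exp (-lam * x ^ 2 / 2) * (-lam * x)) x := fun x => by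
    refine ((((hasDerivAt_id x).pow 2).const_mul (-lam)).div_const 2).exp.congr_deriv ?_
    simp
    ring
  have hW : ∀ x ∈ Icc 0 D, HasDerivWithinAt
      (fun y => Real.exp (-lam * y ^ 2 / 2) * (g₁ y + lam * (y * g y)))
      (Real.exp (-lam * x ^ 2 / 2) * ((lam - 1) * g x)) (Icc 0 D) x := fun x hx => by
    refine ((hexp x).hasDerivWithinAt.mul ((h.hasDeriv₁ x hx).add
      (((hasDerivWithinAt_id x _).mul (h.hasDeriv x hx)).const_mul lam))).congr_deriv ?_
    simp
    ring
  have h1 := le_of_hasDerivWithinAt_le hW (g := fun _ => 0) (g' := fun _ => 0)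
    (fun _ _ => hasDerivWithinAt_const _ _ _)
    (fun x hx => mul_nonpos_of_nonneg_of_nonpos (Real.exp_pos _).le
      (mul_nonpos_of_nonpos_of_nonneg (by linarith) (h.pos x hx).le))
    (by simp [h.init₁]) (x := D) ⟨hD.le, le_rfl⟩
  rw [h.bdry, zero_add] at h1
  have h2 := h.pos D ⟨hD.le, le_rfl⟩
  have h3 := h.lam_pos
  have h4 : 0 < Real.exp (-lam * D ^ 2 / 2) * (lam * (D * g D)) := by positivity
  linarith

/-- g' decreases while λy ≤ 1 and increases afterwards, and it vanishes at both ends. -/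
theorem deriv_nonpos (h : IsRescaledEigenpair D lam g g₁) {y : ℝ} (hy : y ∈ Icc 0 D) :
    g₁ y ≤ 0 := by
  have hl := h.lam_pos
  rcases le_total (lam * y) 1 with hle | hle
  · have hsub : Icc 0 y ⊆ Icc 0 D := Icc_subset_Icc le_rfl hy.2
    refine le_of_hasDerivWithinAt_le (g := fun _ => 0) (g' := fun _ => 0)
      (fun x hx => (h.hasDeriv₁ x (hsub hx)).mono hsub)
      (fun _ _ => hasDerivWithinAt_const _ _ _) (fun x hx => ?_) h.init₁.le ⟨hy.1, le_rfl⟩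
    refine mul_nonpos_of_nonpos_of_nonneg ?_ (h.pos x (hsub hx)).le
    have h1 : lam * x ≤ 1 := (mul_le_mul_of_nonneg_left hx.2 hl.le).trans hle
    have h2 : 0 ≤ lam * x := mul_nonneg hl.le hx.1
    nlinarith
  · have hsub : Icc y D ⊆ Icc 0 D := Icc_subset_Icc hy.1 le_rfl
    have := le_of_hasDerivWithinAt_le (f := fun _ => g₁ y) (f' := fun _ => 0)
      (fun _ _ => hasDerivWithinAt_const _ _ _)
      (fun x hx => (h.hasDeriv₁ x (hsub hx)).mono hsub) (fun x hx => ?_) le_rfl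
      (x := D) ⟨hy.2, le_rfl⟩
    · rwa [h.bdry] at this
    · refine mul_nonneg ?_ (h.pos x (hsub hx)).le
      have h1 : 1 ≤ lam * x := hle.trans (mul_le_mul_of_nonneg_left hx.1 hl.le)
      nlinarith

theorem le_one (h : IsRescaledEigenpair D lam g g₁) {y : ℝ} (hy : y ∈ Icc 0 D) : g y ≤ 1 :=
  le_of_hasDerivWithinAt_le (g := fun _ => 1) (g' := fun _ => 0) h.hasDeriv
    (fun _ _ => hasDerivWithinAt_const _ _ _) (fun _ hx => h.deriv_nonpos hx) h.init.le hy

/-- Integrate g'' ≥ -g ≥ -1 twice. -/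
theorem one_sub_le (h : IsRescaledEigenpair D lam g g₁) {y : ℝ} (hy : y ∈ Icc 0 D) :
    1 - y ^ 2 / 2 ≤ g y := by
  have h1 : ∀ x ∈ Icc 0 D, -x ≤ g₁ x := fun x hx =>
    le_of_hasDerivWithinAt_le (f := fun t => -t) (f' := fun _ => -1)
      (fun t _ => (hasDerivWithinAt_id t _).neg) h.hasDeriv₁
      (fun t ht => by
        have h2 := h.pos t ht
        have h3 := h.le_one ht
        have h4 : 0 ≤ lam ^ 2 * t ^ 2 * g t := by positivity
        linarith) (by simp [h.init₁]) hx
  exact le_of_hasDerivWithinAt_le (f := fun t => 1 - t ^ 2 / 2) (f' := fun t => -t)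
    (fun t _ => (((((hasDerivAt_id t).pow 2).div_const 2).const_sub 1).congr_deriv
      (by simp)).hasDerivWithinAt) h.hasDeriv h1 (by simp [h.init]) hy

theorem le_invSqIntegral (h : IsRescaledEigenpair D lam g g₁) {y : ℝ} (hy : y ∈ Icc 0 D) :
    y ≤ invSqIntegral g y :=
  le_of_hasDerivWithinAt_le (f := fun t => t) (f' := fun _ => 1)
    (fun _ _ => hasDerivWithinAt_id _ _) h.deriv_invSq
    (fun t ht => by
      have h2 := h.pos t ht
      have h3 := h.le_one ht
      rw [le_div_iff₀ (by positivity), one_mul]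
      exact pow_le_one₀ h2.le h3) (by simp [invSqIntegral]) hy

/-- On [0, 1] one has g ≥ 1/2 and ∫₀ᵗ g⁻² ≥ t, so the integrand is at least t²/4, which integrates
to 1/12; the rest of the integral is nonnegative. -/
theorem le_momentInvSqIntegral (h : IsRescaledEigenpair D lam g g₁) (hD : 1 ≤ D) :
    1 / 12 ≤ momentInvSqIntegral g D := by
  have hsub : Icc 0 1 ⊆ Icc 0 D := Icc_subset_Icc le_rfl hD
  have hsub' : Icc 1 D ⊆ Icc 0 D := Icc_subset_Icc zero_le_one le_rfl
  have h1 : 1 / 12 ≤ momentInvSqIntegral g 1 := by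
    have := le_of_hasDerivWithinAt_le (f := fun t => t ^ 3 / 12) (f' := fun t => t ^ 2 / 4)
      (a := 0) (b := 1) (x := 1)
      (fun t _ => ((((hasDerivAt_id t).pow 3).div_const 12).congr_deriv
        (by simp; ring)).hasDerivWithinAt)
      (fun t ht => (h.deriv_momentInvSq t (hsub ht)).mono hsub)
      (fun t ht => by
        have h2 := h.le_invSqIntegral (hsub ht)
        have h3 : 1 / 2 ≤ g t := by
          have := h.one_sub_le (hsub ht)
          nlinarith [ht.1, ht.2]
        have h4 : t * g t ^ 2 * t ≤ t * g t ^ 2 * invSqIntegral g t :=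
          mul_le_mul_of_nonneg_left h2 (mul_nonneg ht.1 (sq_nonneg _))
        have h5 : 1 / 4 ≤ g t ^ 2 := by nlinarith
        nlinarith [sq_nonneg t])
      (by simp [momentInvSqIntegral]) ⟨zero_le_one, le_rfl⟩
    simpa using this
  refine h1.trans ?_
  exact le_of_hasDerivWithinAt_le (f := fun _ => momentInvSqIntegral g 1) (f' := fun _ => 0)
    (fun _ _ => hasDerivWithinAt_const _ _ _)
    (fun t ht => (h.deriv_momentInvSq t (hsub' ht)).mono hsub')
    (fun t ht => mul_nonneg (mul_nonneg (zero_le_one.trans ht.1) (sq_nonneg _))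
      ((hsub' ht).1.trans (h.le_invSqIntegral (hsub' ht)))) le_rfl (x := D) ⟨hD, le_rfl⟩

/-- First integral of the linear problem, integrated. -/
theorem two_mul_inner_eq (h : IsRescaledEigenpair D lam g g₁) {y : ℝ} (hy : y ∈ Icc 0 D) :
    2 * lam ^ 2 * (momentIntegral g D * invSqIntegral g y - invSqMomentIntegral g y) =
      (lam ^ 2 * D ^ 2 - 1) * g D ^ 2 * invSqIntegral g y - g₁ y / g y := by
  have hDD : D ∈ Icc 0 D := ⟨hy.1.trans hy.2, le_rfl⟩
  -- First integral: the derivative of (λ²s² - 1)g² - g'² is 2λ²s g². Subtracting its values at D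
  -- and y and dividing by g² leaves a multiple of g⁻² minus (g'/g)'.
  have hE : ∀ s ∈ Icc 0 D, 2 * lam ^ 2 * momentIntegral g s =
      (lam ^ 2 * s ^ 2 - 1) * g s ^ 2 - g₁ s ^ 2 + 1 := fun s hs => by
    refine eq_of_hasDerivWithinAt_eq
      (f := fun s => 2 * lam ^ 2 * momentIntegral g s)
      (g := fun s => (lam ^ 2 * s ^ 2 - 1) * g s ^ 2 - g₁ s ^ 2 + 1)
      (fun x hx => (h.deriv_moment x hx).const_mul _) (fun x hx => ?_)
      (by simp [momentIntegral, h.init, h.init₁]) hs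
    refine (((((((hasDerivAt_id x).pow 2).const_mul (lam ^ 2)).sub_const 1).hasDerivWithinAt.mul
      ((h.hasDeriv x hx).pow 2)).sub ((h.hasDeriv₁ x hx).pow 2)).add_const 1).congr_deriv ?_
    simp
    ring
  refine eq_of_hasDerivWithinAt_eq
    (f := fun y => 2 * lam ^ 2 *
      (momentIntegral g D * invSqIntegral g y - invSqMomentIntegral g y))
    (g := fun y => (lam ^ 2 * D ^ 2 - 1) * g D ^ 2 * invSqIntegral g y - g₁ y / g y)
    (fun x hx => (((h.deriv_invSq x hx).const_mul _).sub (h.deriv_invSqMoment x hx)).const_mul _)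
    (fun x hx => ?_)
    (by simp [invSqIntegral, invSqMomentIntegral, h.init₁]) hy
  refine (((h.deriv_invSq x hx).const_mul _).sub
    ((h.hasDeriv₁ x hx).div (h.hasDeriv x hx) (h.ne_zero x hx))).congr_deriv ?_
  have h1 := hE x hx
  have h2 := hE D hDD
  rw [h.bdry] at h2
  have := h.ne_zero x hx
  field_simp
  linear_combination h1 - h2

/-- The triple integral in terms of a double integral. -/
theorem four_mul_tripleIntegral (h : IsRescaledEigenpair D lam g g₁) (hD : 0 ≤ D) :
    4 * lam ^ 2 * tripleIntegral D g = (∫ y in (0 : ℝ)..D, g y ^ 2) - D * g D ^ 2 +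
      2 * ((lam ^ 2 * D ^ 2 - 1) * g D ^ 2) * momentInvSqIntegral g D := by
  rw [h.tripleIntegral_eq hD]
  have hcg := h.continuousOn
  have hcK := h.continuousOn_invSqMoment
  have hcP := h.continuousOn_invSq
  refine eq_of_hasDerivWithinAt_eq (a := 0) (b := D)
    (f := fun x => 4 * lam ^ 2 * ∫ y in (0 : ℝ)..x, y * g y ^ 2 *
      (momentIntegral g D * invSqIntegral g y - invSqMomentIntegral g y))
    (g := fun x => (∫ y in (0 : ℝ)..x, g y ^ 2) - x * g x ^ 2 +
      2 * ((lam ^ 2 * D ^ 2 - 1) * g D ^ 2) * momentInvSqIntegral g x)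
    (fun x hx => (hasDerivWithinAt_integral_Icc (f := fun y => y * g y ^ 2 *
      (momentIntegral g D * invSqIntegral g y - invSqMomentIntegral g y))
      (by fun_prop) hx).const_mul _)
    (fun x hx => ?_) (by simp [momentInvSqIntegral]) ⟨hD, le_rfl⟩
  refine (((hasDerivWithinAt_integral_Icc (f := fun y => g y ^ 2) (by fun_prop) hx).sub
    ((hasDerivWithinAt_id x _).mul ((h.hasDeriv x hx).pow 2))).add
    ((h.deriv_momentInvSq x hx).const_mul _)).congr_deriv ?_
  -- The term -2y g g' so produced is the derivative of -y g² plus g², which accounts for ∫g² - D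
  -- g(D)².
  have h1 := h.two_mul_inner_eq hx
  have := h.ne_zero x hx
  simp
  field_simp at h1
  linear_combination (-2 * x * g x) * h1

/-- What remains is D < 2(λ²D² - 1)I. With λ > 1 and I ≥ 1/12 it suffices that 6D < D² - 1, which D
≥ 10 ensures with room to spare. -/
theorem integral_lt (h : IsRescaledEigenpair D lam g g₁) (hD : 10 ≤ D) :
    ∫ y in (0 : ℝ)..D, g y ^ 2 < 4 * lam ^ 2 * tripleIntegral D g := by
  have hD0 : 0 < D := by linarith
  rw [h.four_mul_tripleIntegral hD0.le]
  have h1 := h.le_momentInvSqIntegral (by linarith)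
  have h2 := h.one_lt_lam hD0
  have h3 : 0 < g D ^ 2 := pow_pos (h.pos D ⟨hD0.le, le_rfl⟩) 2
  have h4 : D ^ 2 ≤ lam ^ 2 * D ^ 2 := by
    have : 1 ≤ lam ^ 2 := one_le_pow₀ h2.le
    nlinarith [sq_nonneg D]
  have h5 : 0 ≤ lam ^ 2 * D ^ 2 - 1 := by nlinarith
  have h6 : (lam ^ 2 * D ^ 2 - 1) * (1 / 12) ≤ (lam ^ 2 * D ^ 2 - 1) * momentInvSqIntegral g D :=
    mul_le_mul_of_nonneg_left h1 h5
  have h7 : D < 2 * ((lam ^ 2 * D ^ 2 - 1) * momentInvSqIntegral g D) := by nlinarith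
  have h8 := mul_lt_mul_of_pos_right h7 h3
  linarith

end IsRescaledEigenpair

/-! ### Continuity of the branch and limits of M/α². -/

/-- `δ ≥ 0` is the slope of the vector potential on the symmetric branch for the parameter `ε`. -/
def IsBranchSlope (κ ε d δ : ℝ) : Prop :=
  0 ≤ δ ∧ ∃ y, IsODESol (reField κ ε) 0 d ![1, 0, 0, δ] y ∧ (∀ x ∈ Icc 0 d, 0 < y x 0) ∧ y d 1 = 0

theorem IsBranchSlope.unique {κ ε d δ₁ δ₂ : ℝ} (hκ : 0 < κ) (hε : 0 ≤ ε) (hd : 0 < d)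
    (h₁ : IsBranchSlope κ ε d δ₁) (h₂ : IsBranchSlope κ ε d δ₂) : δ₁ = δ₂ := by
  obtain ⟨hδ₁, y, hy, hy0, hyd⟩ := h₁
  obtain ⟨hδ₂, z, hz, hz0, hzd⟩ := h₂
  exact symmetric_slope_unique hκ hε hd hδ₁ hδ₂ hy hz hy0 hz0 hyd hzd

theorem isBranchSlope_one {κ d : ℝ} : IsBranchSlope κ 1 d 0 := by
  refine ⟨le_rfl, fun _ => ![1, 0, 0, 0], ⟨rfl, fun x _ => ?_⟩, fun _ _ => by simp, rfl⟩
  refine (hasDerivWithinAt_const _ _ _).congr_deriv ?_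
  ext i; fin_cases i <;> simp [reField]

theorem IsBranchSlope.exists_glSolution {κ α d δ : ℝ} (hα : 0 < α) (hd : 0 < d)
    (h : IsBranchSlope κ (α ^ 2) d δ) : ∃ y, IsODESol (glField κ) (-d) d ![α, 0, 0, δ] y ∧
      (∀ x ∈ Icc (-d) d, 0 < y x 0) ∧ y d 1 = 0 := by
  obtain ⟨-, y, hy, hpos, hend⟩ := h
  have h1 := isODESol_smul_reField (hy.extend_symmetric hd.le
    (by ext i; fin_cases i <;> simp [reflState]))
  refine ⟨_, h1, fun x hx => ?_, ?_⟩
  · simp only [Matrix.cons_val]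
    refine mul_pos hα ?_
    split_ifs with hx0
    · exact hpos _ ⟨by linarith, by linarith [hx.1]⟩
    · exact hpos _ ⟨(not_le.1 hx0).le, hx.2⟩
  · simp [not_le.2 hd, hend]

theorem isSymmetricSolution_iff {κ α d δ : ℝ} (hα : 0 < α) (hd : 0 < d) (hδ : 0 ≤ δ) :
    IsSymmetricSolution κ d α δ ↔ IsBranchSlope κ (α ^ 2) d δ := by
  constructor
  · rintro ⟨y, hy, hpos, hend⟩
    have h1 : IsODESol (glField κ) 0 d ![α, 0, 0, δ] y :=
      IsODESol.mono (a := -d) (b := d) hy (by linarith) le_rfl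
    refine ⟨hδ, _, isODESol_div_glField hα.ne' h1, fun x hx => ?_, ?_⟩
    · exact div_pos (hpos x ⟨by linarith [hx.1], hx.2⟩) hα
    · simp [hend]
  · intro h
    exact h.exists_glSolution hα hd

/-- Nearby linearized solutions stay positive, with endpoint values close to the given ones. -/
theorem IsLinearizedSol.eventually_near {κ ε d δ : ℝ} {y Q R : ℝ → Fin 4 → ℝ} (hd : 0 ≤ d)
    (h : IsLinearizedSol κ ε d δ y Q R) (hpos : ∀ x ∈ Icc 0 d, 0 < y x 0) {η : ℝ} (hη : 0 < η) :
    ∀ᶠ p in 𝓝 (ε, δ), ∃ y' Q' R', IsLinearizedSol κ p.1 d p.2 y' Q' R' ∧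
      (∀ x ∈ Icc 0 d, 0 < y' x 0) ∧ |y' d 1 - y d 1| < η ∧
      |(Q' d 1 * R' d 3 - R' d 1 * Q' d 3) - (Q d 1 * R d 3 - R d 1 * Q d 3)| < η := by
  obtain ⟨x₀, hx₀, hmin⟩ := isCompact_Icc.exists_isMinOn ⟨(0 : ℝ), ⟨le_rfl, hd⟩⟩
    (h.sol.continuousOn_apply 0)
  filter_upwards [h.continuous_dependence hd (lt_min hη (hpos x₀ hx₀))] with
    p ⟨y', Q', R', h', hy', hN⟩
  refine ⟨y', Q', R', h', fun x hx => ?_,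
    (hy' d ⟨hd, le_rfl⟩ 1).trans_le (min_le_left _ _), hN.trans_le (min_le_left _ _)⟩
  have h1 := (abs_lt.1 ((hy' x hx 0).trans_le (min_le_right _ _))).1
  have h2 : y x₀ 0 ≤ y x 0 := hmin hx
  linarith

/-- Continuity of the symmetric branch. -/
theorem IsLinearizedSol.eventually_branchSlope {κ ε d δ : ℝ} {y Q R : ℝ → Fin 4 → ℝ}
    (hκ : 0 < κ) (hε : 0 ≤ ε) (hδ : 0 ≤ δ) (hd : 0 < d) (h : IsLinearizedSol κ ε d δ y Q R)
    (hpos : ∀ x ∈ Icc 0 d, 0 < y x 0) (hend : y d 1 = 0) {η : ℝ} (hη : 0 < η) :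
    ∀ᶠ ε' in 𝓝 ε, 0 ≤ ε' → ∀ δ', IsBranchSlope κ ε' d δ' → |δ' - δ| < η := by
  have hdd : d ∈ Icc 0 d := ⟨hd.le, le_rfl⟩
  have hline : ∀ s : ℝ, Tendsto (fun t : ℝ => (ε, δ + s * t)) (𝓝[>] 0) (𝓝 (ε, δ)) := fun s => by
    have h1 : Continuous fun t : ℝ => (ε, δ + s * t) := by fun_prop
    have h2 := h1.tendsto 0
    simp only [mul_zero, add_zero] at h2
    exact h2.mono_left nhdsWithin_le_nhds
  have hslice : ∀ δ₁ : ℝ, Tendsto (fun e : ℝ => (e, δ₁)) (𝓝 ε) (𝓝 (ε, δ₁)) := fun δ₁ =>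
    (Continuous.prodMk_left δ₁).tendsto ε
  -- At the slope δ + t strict monotonicity gives ψ'(d) > 0, which survives small changes of ε; a
  -- branch slope above δ + t would then contradict monotonicity at ε'. The lower bound is
  -- symmetric, and trivial when δ = 0.
  have hupper : ∀ᶠ ε' in 𝓝 ε, 0 ≤ ε' → ∀ δ', IsBranchSlope κ ε' d δ' → δ' < δ + η := by
    have hsmall : ∀ᶠ t : ℝ in 𝓝[>] 0, t < η :=
      nhdsWithin_le_nhds (gt_mem_nhds hη)
    obtain ⟨t, ⟨⟨y₁, Q₁, R₁, h₁, hpos₁, -⟩, htη⟩, ht⟩ :=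
      ((((hline 1).eventually (h.eventually_near hd.le hpos one_pos)).and hsmall).and
        self_mem_nhdsWithin).exists
    replace ht : 0 < t := ht
    rw [one_mul] at h₁
    have hw := wronskian_pos_of_lt hκ hε hd hδ (lt_add_of_pos_right δ ht) h.sol h₁.sol hpos hpos₁
    rw [hend, mul_zero] at hw
    have hy₁ : 0 < y₁ d 1 := pos_of_mul_pos_right hw (hpos d hdd).le
    filter_upwards [(hslice (δ + t)).eventually (h₁.eventually_near hd.le hpos₁ hy₁)] with
      ε' ⟨y₂, Q₂, R₂, h₂, hpos₂, hy₂, _⟩ hε' δ' ⟨hδ', z, hz, hz0, hzd⟩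
    have hy₂' : 0 < y₂ d 1 := by have := (abs_lt.1 hy₂).1; linarith
    by_contra hcon
    have hlt : δ + t < δ' := by linarith
    have hw' := wronskian_pos_of_lt hκ hε' hd (by positivity) hlt h₂.sol hz hpos₂ hz0
    rw [hzd, mul_zero] at hw'
    exact absurd hw' (not_lt.2 (mul_pos (hz0 d hdd) hy₂').le)
  have hlower : ∀ᶠ ε' in 𝓝 ε, 0 ≤ ε' → ∀ δ', IsBranchSlope κ ε' d δ' → δ - η < δ' := by
    rcases hδ.eq_or_lt with rfl | hδ0
    · exact Eventually.of_forall fun ε' _ δ' hδ' => by linarith [hδ'.1]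
    have hsmall : ∀ᶠ t : ℝ in 𝓝[>] 0, t < min η δ :=
      nhdsWithin_le_nhds (gt_mem_nhds (lt_min hη hδ0))
    obtain ⟨t, ⟨⟨y₁, Q₁, R₁, h₁, hpos₁, -⟩, htη⟩, ht⟩ :=
      ((((hline (-1)).eventually (h.eventually_near hd.le hpos one_pos)).and hsmall).and
        self_mem_nhdsWithin).exists
    replace ht : 0 < t := ht
    obtain ⟨htη, htδ⟩ := lt_min_iff.1 htη
    rw [neg_one_mul] at h₁
    have hw := wronskian_pos_of_lt hκ hε hd (by linarith) (by linarith) h₁.sol h.sol hpos₁ hpos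
    rw [hend, mul_zero] at hw
    have hy₁ : y₁ d 1 < 0 := neg_of_mul_neg_right hw (hpos d hdd).le
    filter_upwards [(hslice (δ + -t)).eventually
      (h₁.eventually_near hd.le hpos₁ (neg_pos.2 hy₁))] with
      ε' ⟨y₂, Q₂, R₂, h₂, hpos₂, hy₂, _⟩ hε' δ' ⟨hδ', z, hz, hz0, hzd⟩
    have hy₂' : y₂ d 1 < 0 := by have := (abs_lt.1 hy₂).2; linarith
    by_contra hcon
    have hlt : δ' < δ + -t := by linarith
    have hw' := wronskian_pos_of_lt hκ hε' hd hδ' hlt hz h₂.sol hz0 hpos₂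
    rw [hzd, mul_zero] at hw'
    exact absurd hw' (not_lt.2 (mul_neg_of_pos_of_neg (hz0 d hdd) hy₂').le)
  filter_upwards [hupper, hlower] with ε' h1 h2 hε' δ' hδ'
  rw [abs_lt]
  constructor <;> linarith [h1 hε' δ' hδ', h2 hε' δ' hδ']

/-- The limit of `M / α²` along the symmetric branch. -/
theorem IsLinearizedSol.tendsto_glM_div {κ ε d δ : ℝ} {y Q R : ℝ → Fin 4 → ℝ}
    (hκ : 0 < κ) (hε : 0 ≤ ε) (hδ : 0 ≤ δ) (hd : 0 < d) (h : IsLinearizedSol κ ε d δ y Q R)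
    (hpos : ∀ x ∈ Icc 0 d, 0 < y x 0) (hend : y d 1 = 0) {l : Filter ℝ} {δ₀ : ℝ → ℝ}
    (hl : Tendsto (fun α : ℝ => α ^ 2) l (𝓝 ε))
    (hδ₀ : ∀ᶠ α in l, 0 < α ∧ IsBranchSlope κ (α ^ 2) d (δ₀ α)) :
    Tendsto (fun α => glM κ d α (δ₀ α) / α ^ 2) l (𝓝 (Q d 1 * R d 3 - R d 1 * Q d 3)) := by
  have hδl : Tendsto δ₀ l (𝓝 δ) := by
    rw [Metric.tendsto_nhds]
    intro η hη
    filter_upwards [hl.eventually (h.eventually_branchSlope hκ hε hδ hd hpos hend hη), hδ₀] with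
      α h1 h2
    exact h1 (sq_nonneg α) _ h2.2
  rw [Metric.tendsto_nhds]
  intro η hη
  filter_upwards [(hl.prodMk_nhds hδl).eventually (h.eventually_near hd.le hpos hη), hδ₀] with
    α ⟨y', Q', R', h', _, _, hN⟩ ⟨hα, hbr⟩
  obtain ⟨y₀, hy₀, -⟩ := hbr.exists_glSolution hα hd
  rw [IsLinearizedSol.glM_eq hd.le h' hy₀, mul_div_cancel_left₀ _ (pow_ne_zero 2 hα.ne')]
  exact hN

/-- The linear problem has a positive eigenfunction. -/
theorem exists_isRescaledEigenpair {κ d : ℝ} (hκ : 0 < κ) (hd : 0 < d) :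
    ∃ lam g g₁, IsRescaledEigenpair (κ * d) lam g g₁ := by
  obtain ⟨δ, hδ, y, hy, hpos, hend⟩ := exists_symmetric_slope hκ le_rfl one_pos hd
  have hκi : 0 < κ⁻¹ := inv_pos.2 hκ
  have hdd : κ⁻¹ * (κ * d) = d := inv_mul_cancel_left₀ hκ.ne' d
  have h3 : ∀ x ∈ Icc 0 d, y x 3 = δ := fun x hx =>
    eq_of_hasDerivWithinAt_eq (g := fun _ => δ) (f' := fun _ => 0)
      (fun x hx => (hy.deriv_three x hx).congr_deriv (by simp))
      (fun _ _ => hasDerivWithinAt_const _ _ _) (by simp [hy.1]) hx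
  have h2 : ∀ x ∈ Icc 0 d, y x 2 = δ * x := fun x hx =>
    eq_of_hasDerivWithinAt_eq (g := fun t => δ * t) (f' := fun _ => δ)
      (fun x hx => (hy.deriv_two x hx).congr_deriv (h3 x hx))
      (fun t _ => by simpa using (hasDerivWithinAt_id t _).const_mul δ) (by simp [hy.1]) hx
  have hmem : ∀ x ∈ Icc 0 (κ * d), κ⁻¹ * x ∈ Icc 0 d := fun x hx =>
    ⟨mul_nonneg hκi.le hx.1, hdd ▸ mul_le_mul_of_nonneg_left hx.2 hκi.le⟩
  have hκ0 := hκ.ne'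
  -- At ε = 0 the shooting solution has a = δx exactly, so in the variable κx it is the
  -- eigenfunction with λ = δ/κ.
  refine ⟨δ / κ, fun x => y (κ⁻¹ * x) 0, fun x => κ⁻¹ * y (κ⁻¹ * x) 1,
    { lam_pos := div_pos hδ hκ
      pos := fun x hx => hpos _ (hmem x hx)
      hasDeriv := fun x hx => ?_
      hasDeriv₁ := fun x hx => ?_
      init := by simp [hy.1]
      init₁ := by simp [hy.1]
      bdry := by rw [hdd, hend, mul_zero] }⟩
  · refine HasDerivWithinAt.comp_mul_Icc (F := fun t => y t 0) hκi ?_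
    rw [hdd]
    exact hy.deriv_zero _ (hmem x hx)
  · have h4 := HasDerivWithinAt.comp_mul_Icc (F := fun t => y t 1) (d := κ * d) (x := x) hκi
      (by rw [hdd]; exact hy.deriv_one _ (hmem x hx))
    refine (h4.const_mul κ⁻¹).congr_deriv ?_
    rw [h2 _ (hmem x hx)]
    field_simp
    ring

/-! ### The branch as a function of α, and the sign change. -/

open Classical in
/-- The slope `a'(0)` on the symmetric branch with `φ(0) = α`. -/
noncomputable def branchSlope (κ d α : ℝ) : ℝ :=
  if h : ∃ δ, IsBranchSlope κ (α ^ 2) d δ then h.choose else 0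

theorem isBranchSlope_branchSlope {κ d α : ℝ} (hκ : 0 < κ) (hd : 0 < d) (hα : α ∈ Ioc 0 1) :
    IsBranchSlope κ (α ^ 2) d (branchSlope κ d α) := by
  have hex : ∃ δ, IsBranchSlope κ (α ^ 2) d δ := by
    rcases hα.2.eq_or_lt with rfl | hlt
    · exact ⟨0, by rw [one_pow]; exact isBranchSlope_one⟩
    · obtain ⟨δ, hδ, h⟩ := exists_symmetric_slope hκ (sq_nonneg α)
        (pow_lt_one₀ hα.1.le hlt two_ne_zero) hd
      exact ⟨δ, hδ.le, h⟩
  rw [branchSlope, dif_pos hex]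
  exact hex.choose_spec

theorem branchSlope_one {κ d : ℝ} (hκ : 0 < κ) (hd : 0 < d) : branchSlope κ d 1 = 0 := by
  have h := isBranchSlope_branchSlope hκ hd (α := 1) ⟨one_pos, le_rfl⟩
  rw [one_pow] at h
  exact h.unique hκ zero_le_one hd isBranchSlope_one

theorem branchSlope_pos {κ d α : ℝ} (hκ : 0 < κ) (hd : 0 < d) (hα : α ∈ Ioo 0 1) :
    0 < branchSlope κ d α := by
  obtain ⟨δ, hδ, h⟩ := exists_symmetric_slope hκ (sq_nonneg α)
    (pow_lt_one₀ hα.1.le hα.2 two_ne_zero) hd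
  rw [(isBranchSlope_branchSlope hκ hd ⟨hα.1, hα.2.le⟩).unique hκ (sq_nonneg α) hd ⟨hδ.le, h⟩]
  exact hδ

theorem sPrime_branch_pos {κ d α : ℝ} (hκ : 0 < κ) (hd : 0 < d) (hα : α ∈ Ioo 0 1) :
    0 < sPrime κ d α (branchSlope κ d α) d := by
  obtain ⟨y, hy, hpos, hend⟩ :=
    (isBranchSlope_branchSlope hκ hd ⟨hα.1, hα.2.le⟩).exists_glSolution hα.1 hd
  exact sPrime_pos hκ hα.1 (branchSlope_pos hκ hd hα) hd hy
    (fun x hx => hpos x ⟨by linarith [hx.1], hx.2⟩) hend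

theorem glJ_eq_glM {κ d α δ : ℝ} (hd : 0 ≤ d) :
    glJ κ d α δ = 4 * sPrime κ d α δ d * glM κ d α δ := glJ_eq hd

theorem glM_one_pos {κ d : ℝ} (hκ : 0 < κ) (hd : 0 < d) : 0 < glM κ d 1 0 := by
  obtain ⟨y, Q, R, h, hpos, hend, hN⟩ := exists_isLinearizedSol_one hκ hd
  have hb : IsBranchSlope κ (1 ^ 2) d 0 := by rw [one_pow]; exact isBranchSlope_one
  obtain ⟨y₀, hy₀, -⟩ := hb.exists_glSolution one_pos hd
  rw [IsLinearizedSol.glM_eq (y := y) (Q := Q) (R := R) hd.le (by rwa [one_pow]) hy₀, one_pow,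
    one_mul]
  exact hN

theorem tendsto_glM_div_zero {κ d lam : ℝ} {g g₁ : ℝ → ℝ} (hκ : 0 < κ) (hd : 0 < d)
    (h : IsRescaledEigenpair (κ * d) lam g g₁) :
    Tendsto (fun α => glM κ d α (branchSlope κ d α) / α ^ 2) (𝓝[>] 0)
      (𝓝 (1 / (κ * g (κ * d)) *
        ((∫ y in (0 : ℝ)..(κ * d), g y ^ 2) - 4 * lam ^ 2 * tripleIntegral (κ * d) g))) := by
  obtain ⟨y, Q, R, hlin, hpos, hend, hN⟩ := h.exists_isLinearizedSol hκ hd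
  rw [← hN]
  refine hlin.tendsto_glM_div hκ le_rfl (mul_nonneg hκ.le h.lam_pos.le) hd hpos hend ?_ ?_
  · have h1 : Continuous fun α : ℝ => α ^ 2 := by fun_prop
    have h2 := h1.tendsto 0
    rw [zero_pow two_ne_zero] at h2
    exact h2.mono_left nhdsWithin_le_nhds
  · filter_upwards [Ioc_mem_nhdsGT one_pos] with α hα
    exact ⟨hα.1, isBranchSlope_branchSlope hκ hd hα⟩

theorem eventually_glM_pos {κ d : ℝ} (hκ : 0 < κ) (hd : 0 < d) :
    ∀ᶠ α in 𝓝[<] 1, 0 < glM κ d α (branchSlope κ d α) := by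
  obtain ⟨y, Q, R, hlin, hpos, hend, hN⟩ := exists_isLinearizedSol_one hκ hd
  have hev : Ioo (0 : ℝ) 1 ∈ 𝓝[<] (1 : ℝ) := Ioo_mem_nhdsLT one_pos
  have ht : Tendsto (fun α => glM κ d α (branchSlope κ d α) / α ^ 2) (𝓝[<] 1) _ :=
    hlin.tendsto_glM_div hκ zero_le_one le_rfl hd (fun x _ => hpos x) hend (by
      have h1 : Continuous fun α : ℝ => α ^ 2 := by fun_prop
      have h2 := h1.tendsto 1
      rw [one_pow] at h2
      exact h2.mono_left nhdsWithin_le_nhds) (by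
      filter_upwards [hev] with α hα
      exact ⟨hα.1, isBranchSlope_branchSlope hκ hd ⟨hα.1, hα.2.le⟩⟩)
  filter_upwards [ht.eventually (lt_mem_nhds hN), hev] with α h1 h2
  have h3 : 0 < α ^ 2 := pow_pos h2.1 2
  rwa [div_pos_iff_of_pos_right h3] at h1

theorem eventually_glM_neg {κ d : ℝ} (hκ : 0 < κ) (hd : 0 < d) (hD : 10 ≤ κ * d) :
    ∀ᶠ α in 𝓝[>] 0, glM κ d α (branchSlope κ d α) < 0 := by
  obtain ⟨lam, g, g₁, h⟩ := exists_isRescaledEigenpair hκ hd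
  have hG := h.pos (κ * d) ⟨by positivity, le_rfl⟩
  have hneg : 1 / (κ * g (κ * d)) *
      ((∫ y in (0 : ℝ)..(κ * d), g y ^ 2) - 4 * lam ^ 2 * tripleIntegral (κ * d) g) < 0 :=
    mul_neg_of_pos_of_neg (by positivity) (sub_neg.2 (h.integral_lt hD))
  filter_upwards [(tendsto_glM_div_zero hκ hd h).eventually (gt_mem_nhds hneg),
    self_mem_nhdsWithin] with α h1 h2
  have h3 : 0 < α ^ 2 := pow_pos h2 2
  by_contra hcon
  exact absurd h1 (not_lt.2 (div_nonneg (not_lt.1 hcon) h3.le))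

theorem mainTheorem5 :
    ∃ D₀ : ℝ, 0 < D₀ ∧ ∀ κ d : ℝ, 0 < κ → 0 < d → D₀ ≤ κ * d →
      ∃ δ₀ : ℝ → ℝ,
        -- the symmetric branch
        (δ₀ 1 = 0 ∧ (∀ α ∈ Ioo (0 : ℝ) 1, 0 < δ₀ α) ∧
          ∀ α ∈ Ioc (0 : ℝ) 1, ∀ δ : ℝ, 0 ≤ δ → (IsSymmetricSolution κ d α δ ↔ δ = δ₀ α)) ∧
        -- all the partial derivatives involved exist along the branch
        (∀ α ∈ Ioc (0 : ℝ) 1, ∀ x ∈ Icc (-d) d,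
          DifferentiableAt ℝ (fun p : Fin 4 → ℝ => glFlow κ d p x) ![α, 0, 0, δ₀ α]) ∧
        -- the formula for the determinant
        (∀ α ∈ Ioc (0 : ℝ) 1,
          glJ κ d α (δ₀ α) = 4 * sPrime κ d α (δ₀ α) d *
            (qPrime κ d α (δ₀ α) d * wPrime κ d α (δ₀ α) d -
              rPrime κ d α (δ₀ α) d * vPrime κ d α (δ₀ α) d)) ∧
        -- the change of sign
        (∃ α₁ α₂ : ℝ, 0 < α₁ ∧ α₁ < α₂ ∧ α₂ < 1 ∧
          (∀ α ∈ Ioo 0 α₁, glJ κ d α (δ₀ α) < 0) ∧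
          (∀ α ∈ Ioo α₂ 1, 0 < glJ κ d α (δ₀ α))) ∧
        0 < glM κ d 1 (δ₀ 1) ∧
        -- the limit as `α → 0`, and the integral inequality that makes it negative
        (∃ (lam : ℝ) (g g₁ : ℝ → ℝ), IsRescaledEigenpair (κ * d) lam g g₁) ∧
        (∀ (lam : ℝ) (g g₁ : ℝ → ℝ), IsRescaledEigenpair (κ * d) lam g g₁ →
          Tendsto (fun α => glM κ d α (δ₀ α) / α ^ 2) (𝓝[>] 0)
            (𝓝 (1 / (κ * g (κ * d)) *
              ((∫ y in (0 : ℝ)..(κ * d), g y ^ 2) -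
                4 * lam ^ 2 * tripleIntegral (κ * d) g))) ∧
          (∫ y in (0 : ℝ)..(κ * d), g y ^ 2) < 4 * lam ^ 2 * tripleIntegral (κ * d) g) := by
  refine ⟨10, by norm_num, fun κ d hκ hd hD => ⟨branchSlope κ d, ⟨branchSlope_one hκ hd,
    fun α hα => branchSlope_pos hκ hd hα, fun α hα δ hδ => ?_⟩, fun α hα x hx => ?_,
    fun α _ => glJ_eq hd.le, ?_, ?_, exists_isRescaledEigenpair hκ hd, fun lam g g₁ h =>
      ⟨tendsto_glM_div_zero hκ hd h, h.integral_lt hD⟩⟩⟩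
  · rw [isSymmetricSolution_iff hα.1 hd hδ]
    have hb := isBranchSlope_branchSlope hκ hd hα
    exact ⟨fun h => h.unique hκ (sq_nonneg α) hd hb, fun h => h ▸ hb⟩
  · obtain ⟨y, hy, -⟩ := (isBranchSlope_branchSlope hκ hd hα).exists_glSolution hα.1 hd
    obtain ⟨A, hA, -⟩ := glFlow_hasFDerivAt hd.le hy hx
    exact hA.differentiableAt
  · obtain ⟨u, hu, hu'⟩ := mem_nhdsGT_iff_exists_Ioo_subset.1 (eventually_glM_neg hκ hd hD)
    obtain ⟨v, hv, hv'⟩ := mem_nhdsLT_iff_exists_Ioo_subset.1 (eventually_glM_pos hκ hd)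
    rw [mem_Ioi] at hu
    rw [mem_Iio] at hv
    have h1 : min u (1 / 4) ≤ 1 / 4 := min_le_right _ _
    have h2 : 1 / 2 ≤ max v (1 / 2) := le_max_right _ _
    -- Capping at 1/4 and 1/2 forces α₁ < α₂ and keeps both ranges inside (0, 1), where s'(d) > 0.
    refine ⟨min u (1 / 4), max v (1 / 2), lt_min hu (by norm_num), by linarith,
      max_lt hv (by norm_num), fun α hα => ?_, fun α hα => ?_⟩
    · rw [glJ_eq_glM hd.le]
      have h3 := sPrime_branch_pos hκ hd (α := α) ⟨hα.1, by linarith [hα.2]⟩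
      exact mul_neg_of_pos_of_neg (by positivity) (hu' ⟨hα.1, hα.2.trans_le (min_le_left _ _)⟩)
    · rw [glJ_eq_glM hd.le]
      have h3 := sPrime_branch_pos hκ hd (α := α) ⟨by linarith [hα.1], hα.2⟩
      exact mul_pos (by positivity) (hv' ⟨(le_max_left _ _).trans_lt hα.1, hα.2⟩)
  · rw [branchSlope_one hκ hd]
    exact glM_one_pos hκ hd
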